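/- **Setting.** Let $D_0=[d_0^1,\dots,d_0^p]\in\mathbb R^{m\times p}$ have unit-norm columns, coherence $\mu_0=\max_{i\ne j}|\langle d_0^i,d_0^j\rangle|$, and put $\mu(t)=\mu_0+3t$. Let $\|\cdot\|$ be the spectral norm and let $\delta_k(D_0)$ be the restricted isometry constant of order $k$, i.e. the smallest $\delta\ge 0$ with $(1-\delta)\|z\|_2^2\le\|D_0z\|_2^2\le(1+\delta)\|z\|_2^2$ for all $z$ supported on a set of $k$ indices. Let $\mathcal W_{D_0}$ be the set of $W\in\mathbb R^{m\times p}$ with unit-norm columns, $w^j\perp d_0^j$ for all $j$, let $\mathcal S^p$ be the Euclidean unit sphere of $\mathbb R^p$, and $$D(W,v,t)=D_0\,\mathrm{Diag}(\cos(v_jt))+W\,\mathrm{Diag}(\sin(v_jt)).$$ Signals: $x^i=D_0\alpha^i+\varepsilon^i$, $i=1,\dots,n$, where the pairs $(\alpha^i,\varepsilon^i)$ are i.i.d. and are distributed as follows. A random support $J\subseteq\{1,\dots,p\}$ with $|J|=k$, $\Pr(j\in J)=\frac kp$, and $\Pr(i,j\in J)=\frac{k(k-1)}{p(p-1)}$ for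 $i\ne j$ is drawn; given $J$, the entries of $\alpha^i$ in $J$ are i.i.d. with law $\nu$, the others are zero. A variable $\alpha_0\sim\nu$ is sub-Gaussian with parameter $\sigma_\alpha$ ($\mathbb E e^{u\alpha_0}\le e^{\sigma_\alpha^2u^2/2}$ for all $u\in\mathbb R$), satisfies $|\alpha_0|\ge\underline\alpha$ almost surely for some $\underline\alpha>0$, and $\mathbb E[\mathrm{sign}(\alpha_0)]=0$. The noise $\varepsilon^i$ is independent of $\alpha^i$ and has i.i.d. sub-Gaussian entries with parameter $\sigma\ge0$. For $\lambda\ge0$ and a sign vector $s$ let $$\phi_x(D|s)=\inf_{a:\ \mathrm{supp}(a)=\mathrm{supp}(s)}\ \tfrac12\|x-Da\|_2^2+\lambda s^\top a ,$$ which, with $J=\mathrm{supp}(s)$, equals $\frac12\big[\|x\|_2^2-(D_J^\top x-\lambda s_J)^\top(D_J^\top D_J)^{-1}(D_J^\top x-\lambda s_J)\big]$ when $D_J^\top D_J$ is invertible, and $$\Delta\Phi_n(W,v,t)=\frac1n\sum_{i=1}^n\Big[\phi_{x^i}\big(D(W,v,t)\,|\,\mathrm{sign}(\alpha^i)\big)-\phi_{x^i}\big(D_0\,|\,\mathrm{sign}(\alpha^i)\big)\Big].$$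 **Proposition.** Let $t\ge0$ with $k\mu(t)\le\frac12$ and let $n\ge2$ with $\frac n{\log n}\ge mp$. Then, except with probability at most $\left(\frac{mpn}9\right)^{-mp/2}$, $$\inf_{W\in\mathcal W_{D_0},\,v\in\mathcal S^p}\Delta\Phi_n(W,v,t)\ \ge\ (1-\mathcal K^2)\,\frac{\mathbb E[\alpha_0^2]}2\,\frac kp\,t^2-Q_t^2\,t\,\frac kp\,\|D_0\|\,k\mu(t)\,\lambda\big(4Q_t^2\lambda+3\,\mathbb E|\alpha_0|\big)-B\sqrt{mp\,\frac{\log n}n},$$ where $$Q_t=\frac1{\sqrt{1-k\mu(t)}},\quad C_t=\frac1{\sqrt{1-\delta_k(D_0)}-t},\quad \mathcal K=C_t\big(\|D_0\|\sqrt{k/p}+t\big),$$ $$B=3045\big(k\sigma_\alpha^2t+2m\sigma^2+\lambda k\sigma_\alpha+\lambda^2kt\big).$$ -/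

import Mathlib

open MeasureTheory ProbabilityTheory
open scoped Matrix NNReal

noncomputable section

namespace SparseCoding

/-! ### Dictionaries and their constants -/

/-- Dictionaries with atoms (columns) of unit Euclidean norm. -/
def unitDictionaries (m p : ℕ) : Set (Matrix (Fin m) (Fin p) ℝ) :=
  {D | ∀ j, ∑ l, D l j ^ 2 = 1}

/-- The matrices `W` whose columns have unit norm and are orthogonal to the
corresponding columns of `D₀`. -/
def tangentDirections {m p : ℕ} (D₀ : Matrix (Fin m) (Fin p) ℝ) :
    Set (Matrix (Fin m) (Fin p) ℝ) :=
  {W | (∀ j, ∑ l, W l j * D₀ l j = 0) ∧ ∀ j, ∑ l, W l j ^ 2 = 1}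

/-- The Euclidean unit sphere of `ℝᵖ`. -/
def unitSphere (p : ℕ) : Set (Fin p → ℝ) := {v | ∑ j, v j ^ 2 = 1}

/-- `D(W, v, t) = D₀ Diag(cos(v t)) + W Diag(sin(v t))`. -/
def curve {m p : ℕ} (D₀ W : Matrix (Fin m) (Fin p) ℝ) (v : Fin p → ℝ) (t : ℝ) :
    Matrix (Fin m) (Fin p) ℝ :=
  D₀ * Matrix.diagonal (fun j => Real.cos (v j * t)) +
    W * Matrix.diagonal (fun j => Real.sin (v j * t))

/-- Mutual coherence: the maximum of `|⟨dⁱ, dʲ⟩|` over `i ≠ j` (and `0` if there is no such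
pair). -/
def coherence {m p : ℕ} (D : Matrix (Fin m) (Fin p) ℝ) : ℝ :=
  ⨆ q : {q : Fin p × Fin p // q.1 ≠ q.2}, |∑ l, D l q.1.1 * D l q.1.2|

/-- `μ(t) = μ₀ + 3 t`. -/
def coherenceAt {m p : ℕ} (D₀ : Matrix (Fin m) (Fin p) ℝ) (t : ℝ) : ℝ :=
  coherence D₀ + 3 * t

/-- Spectral norm: the operator norm for the Euclidean norms. -/
def spectralNorm {m p : ℕ} (D : Matrix (Fin m) (Fin p) ℝ) : ℝ :=
  ‖(Matrix.toEuclideanLin D).toContinuousLinearMap‖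

/-- Restricted isometry constant of order `k`: the smallest `δ ≥ 0` such that
`(1 - δ) ‖z‖² ≤ ‖D z‖² ≤ (1 + δ) ‖z‖²` for all `z` supported in a set of `k` indices. -/
def ripConstant {m p : ℕ} (k : ℕ) (D : Matrix (Fin m) (Fin p) ℝ) : ℝ :=
  sInf {δ : ℝ | 0 ≤ δ ∧ ∀ J : Finset (Fin p), J.card = k → ∀ z : Fin p → ℝ,
    (∀ j, j ∉ J → z j = 0) →
      (1 - δ) * ∑ j, z j ^ 2 ≤ ∑ l, (D *ᵥ z) l ^ 2 ∧
      ∑ l, (D *ᵥ z) l ^ 2 ≤ (1 + δ) * ∑ j, z j ^ 2}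

/-- `Q_t = 1 / √(1 - k μ(t))`. -/
def constQ {m p : ℕ} (k : ℕ) (D₀ : Matrix (Fin m) (Fin p) ℝ) (t : ℝ) : ℝ :=
  1 / √(1 - k * coherenceAt D₀ t)

/-- `C_t = 1 / (√(1 - δ_k(D₀)) - t)`. -/
def constC {m p : ℕ} (k : ℕ) (D₀ : Matrix (Fin m) (Fin p) ℝ) (t : ℝ) : ℝ :=
  1 / (√(1 - ripConstant k D₀) - t)

/-- `𝒦 = C_t (|||D₀|||₂ √(k / p) + t)`. -/
def constK {m p : ℕ} (k : ℕ) (D₀ : Matrix (Fin m) (Fin p) ℝ) (t : ℝ) : ℝ :=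
  constC k D₀ t * (spectralNorm D₀ * √((k : ℝ) / p) + t)

/-- `B = 3045 (k σ_α² t + 2 m σ² + λ k σ_α + λ² k t)`. -/
def constB (m k : ℕ) (σα σ lam t : ℝ) : ℝ :=
  3045 * (k * σα ^ 2 * t + 2 * m * σ ^ 2 + lam * k * σα + lam ^ 2 * k * t)

/-! ### The surrogate objective -/

/-- `φ_x(D | s)`: the infimum of `½ ‖x - D a‖² + λ sᵀ a` over the vectors `a` whose support is
that of `s`. -/
def phi {m p : ℕ} (lam : ℝ) (x : Fin m → ℝ) (D : Matrix (Fin m) (Fin p) ℝ)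
    (s : Fin p → ℝ) : ℝ :=
  ⨅ a : {a : Fin p → ℝ // Function.support a = Function.support s},
    (1 / 2 * ∑ l, (x l - (D *ᵥ a.1) l) ^ 2 + lam * (s ⬝ᵥ a.1))

/-- The entrywise sign of a vector. -/
def signVec {p : ℕ} (a : Fin p → ℝ) : Fin p → ℝ := fun j => Real.sign (a j)

/-- `Φ_n(D | S)`, the average of `φ_{xⁱ}(D | sⁱ)` over the `n` signals. -/
def Phi {m p n : ℕ} (lam : ℝ) (x : Fin n → Fin m → ℝ) (D : Matrix (Fin m) (Fin p) ℝ)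
    (s : Fin n → Fin p → ℝ) : ℝ :=
  1 / (n : ℝ) * ∑ i, phi lam (x i) D (s i)

/-- `ΔΦ_n(W, v, t) = Φ_n(D(W, v, t) | sign A₀) - Φ_n(D₀ | sign A₀)` for the signals
`xⁱ = D₀ αⁱ + εⁱ`. -/
def deltaPhi {m p n : ℕ} (lam : ℝ) (D₀ : Matrix (Fin m) (Fin p) ℝ)
    (α : Fin n → Fin p → ℝ) (ε : Fin n → Fin m → ℝ)
    (W : Matrix (Fin m) (Fin p) ℝ) (v : Fin p → ℝ) (t : ℝ) : ℝ :=
  Phi lam (fun i => D₀ *ᵥ α i + ε i) (curve D₀ W v t) (fun i => signVec (α i)) -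
    Phi lam (fun i => D₀ *ᵥ α i + ε i) D₀ (fun i => signVec (α i))

/-! ### The signal model -/

/-- A random support of size `k` with the first and second order inclusion probabilities of
uniform sampling without replacement. -/
structure IsSupportScheme {p : ℕ} (k : ℕ) (S : PMF (Finset (Fin p))) : Prop where
  card_eq : ∀ J, S J ≠ 0 → J.card = k
  prob_mem : ∀ j, ∑ J with j ∈ J, (S J).toReal = (k : ℝ) / p
  prob_mem_mem : ∀ i j, i ≠ j →
    ∑ J with i ∈ J ∧ j ∈ J, (S J).toReal = ((k : ℝ) * (k - 1)) / ((p : ℝ) * (p - 1))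

/-- The law `ν` of a nonzero coefficient: sub-Gaussian with parameter `σα`, bounded away from
zero by `αmin > 0`, with centred sign. -/
structure IsCoefficientLaw (αmin : ℝ) (σα : ℝ≥0) (ν : Measure ℝ) : Prop where
  subgaussian : HasSubgaussianMGF id (σα ^ 2) ν
  pos : 0 < αmin
  bounded_away : ν {a | |a| < αmin} = 0
  centred_sign : ∫ a, Real.sign a ∂ν = 0

/-- The law of the coefficient vector: draw the support `J` from `S`; given `J`, the entries
in `J` are i.i.d. with law `ν` and the other entries are zero. -/
def coefficientLaw {p : ℕ} (S : PMF (Finset (Fin p))) (ν : Measure ℝ) :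
    Measure (Fin p → ℝ) :=
  ∑ J, S J • Measure.pi (fun j => if j ∈ J then ν else Measure.dirac 0)

/-- The joint law of (coefficient vector, noise vector): the noise has i.i.d. entries with
law `ρ` and is independent of the coefficients. -/
def sampleLaw {p : ℕ} (m : ℕ) (S : PMF (Finset (Fin p))) (ν ρ : Measure ℝ) :
    Measure ((Fin p → ℝ) × (Fin m → ℝ)) :=
  (coefficientLaw S ν).prod (Measure.pi fun _ => ρ)

/-- The lower bound for `ΔΦ_n`. -/
def lowerBound {m p : ℕ} (k n : ℕ) (D₀ : Matrix (Fin m) (Fin p) ℝ) (ν : Measure ℝ)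
    (σα σ lam t : ℝ) : ℝ :=
  (1 - constK k D₀ t ^ 2) * ((∫ a, a ^ 2 ∂ν) / 2) * ((k : ℝ) / p) * t ^ 2
    - constQ k D₀ t ^ 2 * t * ((k : ℝ) / p) * spectralNorm D₀ * (k * coherenceAt D₀ t) * lam *
        (4 * constQ k D₀ t ^ 2 * lam + 3 * ∫ a, |a| ∂ν)
    - constB m k σα σ lam t * √(m * p * (Real.log n / n))

end SparseCoding

end

/-! Write A₀, A for the columns in a support J of `D₀` and of the perturbed dictionary. The
coherence hypothesis makes both Gram matrices lie within kμ(t) ≤ 1/2 of the identity in Frobenius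
norm (`nearIsometry_cols`, `abs_curve_dot_le`). Hence the surrogate is the minimum of a strictly
convex quadratic with an explicit value (`phi_eq_closedForm`). The bound then splits into a lower
bound on the expected increment and a uniform deviation estimate.

Expectation. Given J, the correlation vector Aᵀx - λs is a sum of functions of independent centred
scalars, so the mean of its quadratic form is a combination of traces (`integral_quadratic`). The
noise contributes the same amount for A and A₀ and cancels, leaving `condIncrement`: residual
energies of the columns of A₀ relative to the range of A, plus two trace terms multiplied by λ and
λ². A column of `D₀` is a multiple of the corresponding column of the curve plus a tangent times the
column of `W`, so its residual is tan² times that of w; orthogonality of w to its own atom, together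
with the pair inclusion probabilities, gives the factor 1 - 𝒦² on average
(`Admissible.le_sum_residual`). In the trace terms, unit norms force the diagonal of A₀ᵀ(A - A₀) to
be of second order, so the first order lies off the diagonal, and its average over supports is at
most (k/p)‖D₀‖t (`sum_offDiag_le`). These pieces are assembled in `Admissible.le_sum_condIncrement`.

Deviation. For one signal the surrogate is Lipschitz in the dictionary, with constant `lipBound`, a
quadratic in the coefficients and the noise (`abs_loss_sub_le`). Sub-Gaussian entries give it an
exponential moment (`exp_lipBound_jointLaw`), hence a Bernstein bound at each point of a net and
control of the average Lipschitz constant (`uniform_deviation`). All curve points lie within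
Frobenius distance t of `D₀`; a net of mesh θt with θ² = mp log n / n has at most (1 + 2/θ)^(mp)
points (`exists_matrix_net`). The Bernstein deviation and the discretization error are both of order
θ, which gives the last term of the bound, and `net_probability_le` balances the net against the
tails. -/

namespace SparseCoding

/-! ### Euclidean and Frobenius norms -/

section Norms

variable {ι κ τ : Type*} [Fintype ι] [Fintype κ] [Fintype τ]

/-- The Euclidean norm of a finite family of reals. -/
noncomputable def l2 (x : ι → ℝ) : ℝ := ‖WithLp.toLp 2 x‖

lemma l2_nonneg (x : ι → ℝ) : 0 ≤ l2 x := norm_nonneg _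

lemma l2_sq (x : ι → ℝ) : l2 x ^ 2 = ∑ i, x i ^ 2 := by
  simp [l2, EuclideanSpace.real_norm_sq_eq]

lemma l2_sq_dot (x : ι → ℝ) : l2 x ^ 2 = x ⬝ᵥ x := by
  rw [l2_sq]
  simp [dotProduct, sq]

lemma l2_add_le (x y : ι → ℝ) : l2 (x + y) ≤ l2 x + l2 y := by
  simpa [l2] using norm_add_le (WithLp.toLp 2 x) (WithLp.toLp 2 y)

lemma l2_sub_le (x y : ι → ℝ) : l2 (x - y) ≤ l2 x + l2 y := by
  simpa [l2] using norm_sub_le (WithLp.toLp 2 x) (WithLp.toLp 2 y)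

lemma l2_neg (x : ι → ℝ) : l2 (-x) = l2 x := by
  simp [l2]

lemma l2_zero : l2 (0 : ι → ℝ) = 0 := by simp [l2]

lemma abs_dotProduct_le (x y : ι → ℝ) : |x ⬝ᵥ y| ≤ l2 x * l2 y := by
  apply abs_le_of_sq_le_sq _ (mul_nonneg (l2_nonneg _) (l2_nonneg _))
  rw [mul_pow, l2_sq, l2_sq]
  exact Finset.sum_mul_sq_le_sq_mul_sq _ _ _

lemma dotProduct_le_l2 (x y : ι → ℝ) : x ⬝ᵥ y ≤ l2 x * l2 y :=
  (le_abs_self _).trans (abs_dotProduct_le x y)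

lemma l2_le_of_sq_le {x : ι → ℝ} {c : ℝ} (hc : 0 ≤ c) (h : ∑ i, x i ^ 2 ≤ c ^ 2) : l2 x ≤ c :=
  le_of_sq_le_sq (by rwa [l2_sq]) hc

/-- The Frobenius norm. -/
noncomputable def frob (M : Matrix ι κ ℝ) : ℝ := l2 fun q : ι × κ => M q.1 q.2

lemma frob_nonneg (M : Matrix ι κ ℝ) : 0 ≤ frob M := norm_nonneg _

lemma frob_sq (M : Matrix ι κ ℝ) : frob M ^ 2 = ∑ i, ∑ j, M i j ^ 2 := by
  rw [frob, l2_sq, Fintype.sum_prod_type]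

lemma frob_sq' (M : Matrix ι κ ℝ) : frob M ^ 2 = ∑ j, ∑ i, M i j ^ 2 := by
  rw [frob_sq, Finset.sum_comm]

lemma frob_sq_rows (M : Matrix ι κ ℝ) : frob M ^ 2 = ∑ i, l2 (M i) ^ 2 := by
  simp [frob_sq, l2_sq]

lemma frob_sq_cols (M : Matrix ι κ ℝ) : frob M ^ 2 = ∑ j, l2 (fun i => M i j) ^ 2 := by
  simp [frob_sq', l2_sq]

lemma frob_add_le (M N : Matrix ι κ ℝ) : frob (M + N) ≤ frob M + frob N :=
  l2_add_le _ _

lemma frob_neg (M : Matrix ι κ ℝ) : frob (-M) = frob M := l2_neg _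

lemma frob_sub_comm (M N : Matrix ι κ ℝ) : frob (M - N) = frob (N - M) := by
  rw [← frob_neg, neg_sub]

lemma frob_transpose (M : Matrix ι κ ℝ) : frob Mᵀ = frob M := by
  refine (sq_eq_sq₀ (frob_nonneg _) (frob_nonneg _)).1 ?_
  rw [frob_sq, frob_sq']
  rfl

lemma frob_le_of_sq_le {M : Matrix ι κ ℝ} {c : ℝ} (hc : 0 ≤ c)
    (h : ∑ i, ∑ j, M i j ^ 2 ≤ c ^ 2) : frob M ≤ c :=
  le_of_sq_le_sq (by rwa [frob_sq]) hc

lemma l2_mulVec_le (M : Matrix ι κ ℝ) (x : κ → ℝ) : l2 (M *ᵥ x) ≤ frob M * l2 x := by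
  apply l2_le_of_sq_le (mul_nonneg (frob_nonneg _) (l2_nonneg _))
  rw [mul_pow, frob_sq_rows, Finset.sum_mul]
  refine Finset.sum_le_sum fun i _ => ?_
  rw [← mul_pow]
  exact sq_le_sq' (abs_le.1 (abs_dotProduct_le (M i) x)).1
    (abs_le.1 (abs_dotProduct_le (M i) x)).2

/-- Multiplying on the left by an operator of norm at most `c`. -/
lemma frob_mul_le_of {N : Matrix ι τ ℝ} {c : ℝ} (hc : 0 ≤ c)
    (hN : ∀ x, l2 (N *ᵥ x) ≤ c * l2 x) (M : Matrix τ κ ℝ) :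
    frob (N * M) ≤ c * frob M := by
  refine le_of_sq_le_sq ?_ (mul_nonneg hc (frob_nonneg _))
  rw [mul_pow, frob_sq_cols, frob_sq_cols, Finset.mul_sum]
  refine Finset.sum_le_sum fun j _ => ?_
  rw [← mul_pow]
  exact pow_le_pow_left₀ (l2_nonneg _) (hN fun i => M i j) 2

lemma frob_mul_le (N : Matrix ι τ ℝ) (M : Matrix τ κ ℝ) : frob (N * M) ≤ frob N * frob M :=
  frob_mul_le_of (frob_nonneg _) (l2_mulVec_le N) M

lemma abs_trace_mul_le (A : Matrix ι κ ℝ) (B : Matrix κ ι ℝ) :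
    |(A * B).trace| ≤ frob A * frob B := by
  rw [← frob_transpose B]
  have h : (A * B).trace = (fun q : ι × κ => A q.1 q.2) ⬝ᵥ fun q : ι × κ => Bᵀ q.1 q.2 := by
    simp [Matrix.trace, Matrix.mul_apply, dotProduct, Fintype.sum_prod_type]
  rw [h]
  exact abs_dotProduct_le _ _

lemma l2_add_sq (x y : ι → ℝ) : l2 (x + y) ^ 2 = l2 x ^ 2 + 2 * (x ⬝ᵥ y) + l2 y ^ 2 := by
  simp only [l2_sq_dot, add_dotProduct, dotProduct_add, dotProduct_comm y x]
  ring

lemma l2_sub_sq (x y : ι → ℝ) : l2 (x - y) ^ 2 = l2 x ^ 2 - 2 * (x ⬝ᵥ y) + l2 y ^ 2 := by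
  simp only [l2_sq_dot, sub_dotProduct, dotProduct_sub, dotProduct_comm y x]
  ring

lemma dotProduct_mulVec_eq (A : Matrix κ ι ℝ) (x : κ → ℝ) (a : ι → ℝ) :
    x ⬝ᵥ (A *ᵥ a) = (Aᵀ *ᵥ x) ⬝ᵥ a := by
  rw [Matrix.dotProduct_mulVec, Matrix.mulVec_transpose]

end Norms

/-! ### The quadratic surrogate for a full-rank matrix -/

section Surrogate

variable {ι κ : Type*} [Fintype ι] [Fintype κ] [DecidableEq ι]

/-- `β ‖z‖² ≤ ‖A z‖²` for all `z`. -/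
def LowerBounded (β : ℝ) (A : Matrix κ ι ℝ) : Prop := ∀ z, β * l2 z ^ 2 ≤ l2 (A *ᵥ z) ^ 2

/-- The correlation vector `Aᵀ x - λ s`. -/
def corr (lam : ℝ) (x : κ → ℝ) (A : Matrix κ ι ℝ) (s : ι → ℝ) : ι → ℝ := Aᵀ *ᵥ x - lam • s

/-- The minimizer of `½ ‖x - A a‖² + λ sᵀ a`. -/
noncomputable def minimizer (lam : ℝ) (x : κ → ℝ) (A : Matrix κ ι ℝ) (s : ι → ℝ) : ι → ℝ :=
  (Aᵀ * A)⁻¹ *ᵥ corr lam x A s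

/-- The penalized least squares objective. -/
noncomputable def objective (lam : ℝ) (x : κ → ℝ) (A : Matrix κ ι ℝ) (s a : ι → ℝ) : ℝ :=
  1 / 2 * l2 (x - A *ᵥ a) ^ 2 + lam * (s ⬝ᵥ a)

/-- The closed form of the minimum of the objective. -/
noncomputable def closedForm (lam : ℝ) (x : κ → ℝ) (A : Matrix κ ι ℝ) (s : ι → ℝ) : ℝ :=
  1 / 2 * (l2 x ^ 2 - corr lam x A s ⬝ᵥ ((Aᵀ * A)⁻¹ *ᵥ corr lam x A s))

lemma LowerBounded.isUnit_det {β : ℝ} {A : Matrix κ ι ℝ} (hβ : 0 < β) (hA : LowerBounded β A) :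
    IsUnit (Aᵀ * A).det := by
  rw [← Matrix.isUnit_iff_isUnit_det, ← Matrix.mulVec_injective_iff_isUnit]
  intro y z hyz
  have h0 : (Aᵀ * A) *ᵥ (y - z) = 0 := by rw [Matrix.mulVec_sub, sub_eq_zero]; exact hyz
  have h1 : l2 (A *ᵥ (y - z)) ^ 2 = 0 := by
    rw [l2_sq_dot, Matrix.dotProduct_mulVec, ← Matrix.mulVec_transpose, Matrix.mulVec_mulVec, h0,
      zero_dotProduct]
  have h2 : l2 (y - z) ^ 2 ≤ 0 := by
    have := hA (y - z)
    rw [h1] at this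
    nlinarith [sq_nonneg (l2 (y - z))]
  rw [l2_sq] at h2
  have h3 := (Finset.sum_eq_zero_iff_of_nonneg (fun i _ => sq_nonneg ((y - z) i))).1
    (le_antisymm h2 (Finset.sum_nonneg fun i _ => sq_nonneg _))
  funext i
  have := h3 i (Finset.mem_univ i)
  simpa [sub_eq_zero] using this

lemma gram_mulVec_minimizer {lam : ℝ} {x : κ → ℝ} {A : Matrix κ ι ℝ} {s : ι → ℝ}
    (hA : IsUnit (Aᵀ * A).det) :
    Aᵀ *ᵥ (A *ᵥ minimizer lam x A s) = corr lam x A s := by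
  rw [Matrix.mulVec_mulVec, minimizer, Matrix.mulVec_mulVec, Matrix.mul_nonsing_inv _ hA,
    Matrix.one_mulVec]

/-- Completing the square. -/
lemma objective_eq {lam : ℝ} {x : κ → ℝ} {A : Matrix κ ι ℝ} {s : ι → ℝ}
    (hA : IsUnit (Aᵀ * A).det) (a : ι → ℝ) :
    objective lam x A s a =
      closedForm lam x A s + 1 / 2 * l2 (A *ᵥ (a - minimizer lam x A s)) ^ 2 := by
  have h1 := gram_mulVec_minimizer (lam := lam) (x := x) (s := s) hA
  have hc : closedForm lam x A s =
      1 / 2 * (l2 x ^ 2 - corr lam x A s ⬝ᵥ minimizer lam x A s) := rfl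
  rw [hc, objective, Matrix.mulVec_sub, l2_sub_sq, l2_sub_sq, dotProduct_mulVec_eq,
    dotProduct_comm (A *ᵥ a), dotProduct_mulVec_eq, h1,
    l2_sq_dot (A *ᵥ minimizer lam x A s), dotProduct_mulVec_eq, h1]
  have h2 : (Aᵀ *ᵥ x) ⬝ᵥ a = corr lam x A s ⬝ᵥ a + lam * (s ⬝ᵥ a) := by
    rw [corr, sub_dotProduct, smul_dotProduct, smul_eq_mul]
    ring
  rw [h2]
  ring

lemma closedForm_le_objective {lam : ℝ} {x : κ → ℝ} {A : Matrix κ ι ℝ} {s : ι → ℝ}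
    (hA : IsUnit (Aᵀ * A).det) (a : ι → ℝ) :
    closedForm lam x A s ≤ objective lam x A s a := by
  rw [objective_eq hA]
  nlinarith [sq_nonneg (l2 (A *ᵥ (a - minimizer lam x A s)))]

lemma objective_minimizer {lam : ℝ} {x : κ → ℝ} {A : Matrix κ ι ℝ} {s : ι → ℝ}
    (hA : IsUnit (Aᵀ * A).det) :
    objective lam x A s (minimizer lam x A s) = closedForm lam x A s := by
  rw [objective_eq hA]
  simp [l2_zero]

/-- Conditioning between `1/2` and `3/2`. -/
structure WellConditioned (A : Matrix κ ι ℝ) : Prop where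
  lower : LowerBounded (1 / 2) A
  upper : ∀ z, l2 (A *ᵥ z) ^ 2 ≤ 3 / 2 * l2 z ^ 2

lemma WellConditioned.isUnit_det {A : Matrix κ ι ℝ} (hA : WellConditioned A) :
    IsUnit (Aᵀ * A).det := hA.lower.isUnit_det (by norm_num)

/-- Testing the normal equations against the minimizer a gives ‖Aa‖² = ⟨x, Aa⟩ - λ⟨s, a⟩; lower
conditioning turns ‖a‖ into ‖Aa‖, and one factor ‖Aa‖ is divided out. -/
lemma WellConditioned.l2_mulVec_minimizer_le {lam : ℝ} {x : κ → ℝ} {A : Matrix κ ι ℝ} {s : ι → ℝ}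
    (hA : WellConditioned A) (hlam : 0 ≤ lam) :
    l2 (A *ᵥ minimizer lam x A s) ≤ l2 x + 3 / 2 * (lam * l2 s) := by
  set a := minimizer lam x A s with ha
  have h1 : l2 (A *ᵥ a) ^ 2 = x ⬝ᵥ (A *ᵥ a) - lam * (s ⬝ᵥ a) := by
    rw [l2_sq_dot, dotProduct_mulVec_eq, gram_mulVec_minimizer hA.isUnit_det, corr,
      sub_dotProduct, smul_dotProduct, dotProduct_mulVec_eq, smul_eq_mul]
  have h2 := dotProduct_le_l2 x (A *ᵥ a)
  have h3 : -(s ⬝ᵥ a) ≤ l2 s * l2 a := (neg_le_abs _).trans (abs_dotProduct_le s a)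
  have h4 : l2 a ≤ 3 / 2 * l2 (A *ᵥ a) := by
    refine le_of_sq_le_sq ?_ (by have := l2_nonneg (A *ᵥ a); positivity)
    have := hA.lower a
    nlinarith [sq_nonneg (l2 (A *ᵥ a))]
  have h5 : lam * (-(s ⬝ᵥ a)) ≤ lam * (l2 s * (3 / 2 * l2 (A *ᵥ a))) :=
    mul_le_mul_of_nonneg_left (h3.trans (mul_le_mul_of_nonneg_left h4 (l2_nonneg _))) hlam
  by_contra! h
  have h6 : 0 < l2 (A *ᵥ a) := lt_of_le_of_lt (by
    have := l2_nonneg x; have := l2_nonneg s; positivity) h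
  nlinarith [mul_lt_mul_of_pos_right h h6]

/-- The closed form is Lipschitz in the matrix. -/
lemma closedForm_sub_le {lam : ℝ} {x : κ → ℝ} {A B : Matrix κ ι ℝ} {s : ι → ℝ}
    (hA : WellConditioned A) (hB : WellConditioned B) (hlam : 0 ≤ lam) :
    closedForm lam x B s - closedForm lam x A s ≤
      frob (B - A) * (8 * l2 x ^ 2 + 18 * (lam * l2 s) ^ 2) := by
  set a := minimizer lam x A s with ha
  have h1 := closedForm_le_objective (lam := lam) (x := x) (s := s) hB.isUnit_det a
  have h2 := objective_minimizer (lam := lam) (x := x) (s := s) hA.isUnit_det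
  have hR := hA.l2_mulVec_minimizer_le (x := x) (s := s) hlam
  rw [← ha] at h2 hR
  set R := l2 x + 3 / 2 * (lam * l2 s) with hRd
  have hx := l2_nonneg x
  have hs : 0 ≤ lam * l2 s := mul_nonneg hlam (l2_nonneg s)
  have hR0 : 0 ≤ R := by positivity
  have h4 : l2 a ≤ 3 / 2 * R := by
    refine le_of_sq_le_sq ?_ (by positivity)
    have := hA.lower a
    have h' : l2 (A *ᵥ a) ^ 2 ≤ R ^ 2 := pow_le_pow_left₀ (l2_nonneg _) hR 2
    nlinarith
  have h5 : l2 (B *ᵥ a) ≤ 2 * R := by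
    refine le_of_sq_le_sq ?_ (by positivity)
    have := hB.upper a
    have := hA.lower a
    have h' : l2 (A *ᵥ a) ^ 2 ≤ R ^ 2 := pow_le_pow_left₀ (l2_nonneg _) hR 2
    nlinarith
  -- The minimizer for A is only a competitor for B. The penalties at this common point cancel,
  -- leaving a difference of two squares that is linear in B - A.
  have h6 : objective lam x B s a - objective lam x A s a =
      -(1 / 2) * (((B - A) *ᵥ a) ⬝ᵥ ((x + x) - (A *ᵥ a + B *ᵥ a))) := by
    have e : x - B *ᵥ a = (x - A *ᵥ a) - (B - A) *ᵥ a := by rw [Matrix.sub_mulVec]; abel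
    have e2 : (x + x) - (A *ᵥ a + B *ᵥ a) =
      ((x - A *ᵥ a) + (x - A *ᵥ a)) - (B - A) *ᵥ a := by rw [Matrix.sub_mulVec]; abel
    rw [objective, objective, e2, e, l2_sub_sq, dotProduct_sub, dotProduct_add, ← l2_sq_dot,
      dotProduct_comm (x - A *ᵥ a)]
    ring
  have h7 : -(((B - A) *ᵥ a) ⬝ᵥ ((x + x) - (A *ᵥ a + B *ᵥ a))) ≤
      (frob (B - A) * (3 / 2 * R)) * (5 * R) := by
    refine (neg_le_abs _).trans ((abs_dotProduct_le _ _).trans ?_)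
    refine mul_le_mul ?_ ?_ (l2_nonneg _) (mul_nonneg (frob_nonneg _) (by positivity))
    · exact (l2_mulVec_le _ _).trans (mul_le_mul_of_nonneg_left h4 (frob_nonneg _))
    · refine (l2_sub_le _ _).trans ?_
      have := l2_add_le x x
      have := l2_add_le (A *ᵥ a) (B *ᵥ a)
      linarith
  -- The constant 15/4 is 1/2 · 3/2 · 5, from the bounds on ‖a‖ and on ‖2x - Aa - Ba‖.
  have h8 : R ^ 2 * (15 / 4) ≤ 8 * l2 x ^ 2 + 18 * (lam * l2 s) ^ 2 := by
    rw [hRd]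
    nlinarith [sq_nonneg (l2 x - 3 / 2 * (lam * l2 s)), sq_nonneg (l2 x), sq_nonneg (lam * l2 s)]
  have h9 := mul_le_mul_of_nonneg_left h8 (frob_nonneg (B - A))
  nlinarith

lemma abs_closedForm_sub_le {lam : ℝ} {x : κ → ℝ} {A B : Matrix κ ι ℝ} {s : ι → ℝ}
    (hA : WellConditioned A) (hB : WellConditioned B) (hlam : 0 ≤ lam) :
    |closedForm lam x B s - closedForm lam x A s| ≤
      frob (B - A) * (8 * l2 x ^ 2 + 18 * (lam * l2 s) ^ 2) := by
  rw [abs_le]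
  have h1 := closedForm_sub_le (x := x) (s := s) hA hB hlam
  have h2 := closedForm_sub_le (x := x) (s := s) hB hA hlam
  rw [frob_sub_comm] at h2
  constructor <;> linarith

end Surrogate

/-! ### The surrogate `phi` -/

section Phi

variable {m p : ℕ}

/-- The submatrix of the columns in `J`. -/
def cols (D : Matrix (Fin m) (Fin p) ℝ) (J : Finset (Fin p)) : Matrix (Fin m) J ℝ :=
  D.submatrix id Subtype.val

lemma mulVec_eq_cols_mulVec (D : Matrix (Fin m) (Fin p) ℝ) {J : Finset (Fin p)} {a : Fin p → ℝ}
    (ha : ∀ j, j ∉ J → a j = 0) : D *ᵥ a = cols D J *ᵥ fun j : J => a j := by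
  funext l
  simp only [Matrix.mulVec, dotProduct, cols, Matrix.submatrix_apply, id]
  rw [Finset.sum_coe_sort J (fun j => D l j * a j)]
  refine (Finset.sum_subset (Finset.subset_univ J) fun j _ hj => ?_).symm
  rw [ha j hj, mul_zero]

lemma dotProduct_eq_restrict {J : Finset (Fin p)} (s : Fin p → ℝ) {a : Fin p → ℝ}
    (ha : ∀ j, j ∉ J → a j = 0) : s ⬝ᵥ a = (fun j : J => s j) ⬝ᵥ fun j : J => a j := by
  simp only [dotProduct]
  rw [Finset.sum_coe_sort J (fun j => s j * a j)]
  refine (Finset.sum_subset (Finset.subset_univ J) fun j _ hj => ?_).symm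
  rw [ha j hj, mul_zero]

/-- `phi` is the minimum over vectors supported in `J`, when `J` is the support of `s`. -/
lemma phi_eq_closedForm {lam : ℝ} {x : Fin m → ℝ} {D : Matrix (Fin m) (Fin p) ℝ}
    {s : Fin p → ℝ} {J : Finset (Fin p)} (hs : Function.support s = J)
    (hD : IsUnit ((cols D J)ᵀ * cols D J).det) :
    phi lam x D s = closedForm lam x (cols D J) (fun j : J => s j) := by
  have key : ∀ a : Fin p → ℝ, (∀ j, j ∉ J → a j = 0) →
      1 / 2 * ∑ l, (x l - (D *ᵥ a) l) ^ 2 + lam * (s ⬝ᵥ a) =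
      objective lam x (cols D J) (fun j : J => s j) (fun j : J => a j) := by
    intro a ha
    rw [objective, l2_sq, ← mulVec_eq_cols_mulVec D ha, ← dotProduct_eq_restrict s ha]
    rfl
  have hsupp : ∀ a : Fin p → ℝ, Function.support a = Function.support s → ∀ j, j ∉ J → a j = 0 := by
    intro a ha j hj
    by_contra h
    have : j ∈ Function.support a := h
    rw [ha, hs] at this
    exact hj this
  apply le_antisymm
  · set b := minimizer lam x (cols D J) (fun j : J => s j) with hb
    rw [← objective_minimizer hD, ← hb]
    -- The minimizer may vanish at some indices of J, whereas the infimum requires support exactly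
    -- J. Adding a small nonzero u to every coordinate restores the support, and continuity lets u
    -- tend to 0.
    let g : ℝ → (J → ℝ) := fun u j => b j + u
    have hcont : Continuous fun u : ℝ => objective lam x (cols D J) (fun j : J => s j) (g u) := by
      simp only [objective, l2_sq, g, dotProduct, Matrix.mulVec, Pi.sub_apply]
      fun_prop
    have ht : Filter.Tendsto (fun u : ℝ => objective lam x (cols D J) (fun j : J => s j) (g u))
        (nhdsWithin 0 {0}ᶜ) (nhds (objective lam x (cols D J) (fun j : J => s j) b)) := by
      have := hcont.tendsto 0
      simp only [g, add_zero] at this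
      exact this.mono_left nhdsWithin_le_nhds
    have hne : ∀ᶠ u in nhdsWithin (0 : ℝ) {0}ᶜ, ∀ j : J, b j + u ≠ 0 := by
      rw [Filter.eventually_all]
      intro j
      by_cases h0 : b j = 0
      · filter_upwards [self_mem_nhdsWithin] with u hu
        simpa [h0] using hu
      · have : ∀ᶠ u in nhds (0 : ℝ), b j + u ≠ 0 := by
          have hc : Filter.Tendsto (fun u : ℝ => b j + u) (nhds 0) (nhds (b j)) := by
            have : Continuous fun u : ℝ => b j + u := by fun_prop
            simpa using this.tendsto 0
          exact hc.eventually_ne h0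
        exact this.filter_mono nhdsWithin_le_nhds
    refine ge_of_tendsto ht ?_
    filter_upwards [hne] with u hu
    let a : Fin p → ℝ := fun j => if h : j ∈ J then b ⟨j, h⟩ + u else 0
    have ha : Function.support a = Function.support s := by
      rw [hs]
      ext j
      by_cases h : j ∈ J
      · simpa [a, h] using hu ⟨j, h⟩
      · simp [a, h]
    have hag : (fun j : J => a j) = g u := by
      funext j
      simp [a, g]
    rw [← hag, ← key a (hsupp a ha), phi]
    refine ciInf_le (f := fun a : {a : Fin p → ℝ // Function.support a = Function.support s} =>
      (1 / 2 * ∑ l, (x l - (D *ᵥ a.1) l) ^ 2 + lam * (s ⬝ᵥ a.1))) ?_ ⟨a, ha⟩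
    refine ⟨closedForm lam x (cols D J) (fun j : J => s j), ?_⟩
    rintro _ ⟨c, rfl⟩
    simp only
    rw [key c.1 (hsupp c.1 c.2)]
    exact closedForm_le_objective hD _
  · have : Nonempty {a : Fin p → ℝ // Function.support a = Function.support s} := ⟨⟨s, rfl⟩⟩
    refine le_ciInf fun c => ?_
    rw [key c.1 (hsupp c.1 c.2)]
    exact closedForm_le_objective hD _

end Phi

/-! ### Covering bounded sets of matrices -/

section Covering

open Metric Module ENNReal in
/-- A volumetric bound for separated sets in a ball. -/
theorem card_le_of_separated {E : Type*} [NormedAddCommGroup E] [NormedSpace ℝ E]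
    [FiniteDimensional ℝ E] (s : Finset E) {R η : ℝ} (hR : 0 ≤ R) (hη : 0 < η)
    (hs : ∀ c ∈ s, ‖c‖ ≤ R) (h : ∀ c ∈ s, ∀ d ∈ s, c ≠ d → η ≤ ‖c - d‖) :
    (s.card : ℝ) ≤ (1 + 2 * R / η) ^ finrank ℝ E := by
  borelize E
  let μ : Measure E := Measure.addHaar
  -- Balls of radius η/2 about separated points are disjoint and all lie in the ball of radius R +
  -- η/2; comparing volumes bounds their number.
  let δ : ℝ := η / 2
  let ρ : ℝ := η / 2 + R
  have δpos : 0 < δ := by positivity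
  have ρpos : 0 < ρ := by positivity
  set A := ⋃ c ∈ s, ball (c : E) δ with hA
  have D : Set.Pairwise (s : Set E) (Function.onFun Disjoint fun c => ball (c : E) δ) := by
    rintro c hc d hd hcd
    apply ball_disjoint_ball
    rw [dist_eq_norm]
    have := h c hc d hd hcd
    simp only [δ]
    linarith
  have A_subset : A ⊆ ball (0 : E) ρ := by
    refine Set.iUnion₂_subset fun x hx => ?_
    apply ball_subset_ball'
    rw [dist_zero_right]
    exact add_le_add le_rfl (hs x hx)
  have I :
    (s.card : ℝ≥0∞) * ENNReal.ofReal (δ ^ finrank ℝ E) * μ (ball 0 1) ≤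
      ENNReal.ofReal (ρ ^ finrank ℝ E) * μ (ball 0 1) :=
    calc
      (s.card : ℝ≥0∞) * ENNReal.ofReal (δ ^ finrank ℝ E) * μ (ball 0 1) = μ A := by
        rw [hA, measure_biUnion_finset D fun c _ => measurableSet_ball]
        simp only [μ.addHaar_ball_of_pos _ δpos]
        simp only [Finset.sum_const, nsmul_eq_mul, mul_assoc]
      _ ≤ μ (ball (0 : E) ρ) := measure_mono A_subset
      _ = ENNReal.ofReal (ρ ^ finrank ℝ E) * μ (ball 0 1) := by
        simp only [μ.addHaar_ball_of_pos _ ρpos]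
  have J : (s.card : ℝ≥0∞) * ENNReal.ofReal (δ ^ finrank ℝ E) ≤ ENNReal.ofReal (ρ ^ finrank ℝ E) :=
    (ENNReal.mul_le_mul_iff_left (measure_ball_pos _ _ zero_lt_one).ne' measure_ball_lt_top.ne).1 I
  have K := ENNReal.toReal_le_of_le_ofReal (pow_nonneg ρpos.le _) J
  rw [ENNReal.toReal_mul, ENNReal.toReal_natCast, ENNReal.toReal_ofReal (by positivity)] at K
  have e : (1 + 2 * R / η) = ρ / δ := by
    simp only [ρ, δ]
    field_simp
  rw [e, div_pow, le_div_iff₀ (by positivity)]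
  exact K

/-- A set contained in a ball has a small finite net consisting of points of the set. -/
theorem exists_finset_cover {E : Type*} [NormedAddCommGroup E] [NormedSpace ℝ E]
    [FiniteDimensional ℝ E] (T : Set E) {R η : ℝ} (hR : 0 ≤ R) (hη : 0 < η)
    (hT : ∀ c ∈ T, ‖c‖ ≤ R) :
    ∃ s : Finset E, ↑s ⊆ T ∧ (s.card : ℝ) ≤ (1 + 2 * R / η) ^ Module.finrank ℝ E ∧
      ∀ c ∈ T, ∃ d ∈ s, ‖c - d‖ ≤ η := by
  classical
  let Good : ℕ → Prop := fun N => ∃ s : Finset E, ↑s ⊆ T ∧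
    (∀ c ∈ s, ∀ d ∈ s, c ≠ d → η ≤ ‖c - d‖) ∧ s.card = N
  have hb : ∀ N, Good N → N ≤ ⌊(1 + 2 * R / η) ^ Module.finrank ℝ E⌋₊ := by
    rintro N ⟨s, hsT, hsep, rfl⟩
    exact Nat.le_floor (card_le_of_separated s hR hη (fun c hc => hT c (hsT hc)) hsep)
  have h0 : Good 0 := ⟨∅, by simp, by simp, by simp⟩
  -- A separated subset of largest cardinality is automatically a net: an uncovered point could be
  -- added to it.
  obtain ⟨s, hsT, hsep, hcard⟩ := Nat.findGreatest_spec (P := Good) (Nat.zero_le _) h0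
  refine ⟨s, hsT, card_le_of_separated s hR hη (fun c hc => hT c (hsT hc)) hsep, fun c hc => ?_⟩
  by_contra! hcon
  have hcs : c ∉ s := fun hcs => by
    have := hcon c hcs
    simp only [sub_self, norm_zero] at this
    linarith
  have hg : Good (s.card + 1) := by
    refine ⟨insert c s, ?_, ?_, Finset.card_insert_of_notMem hcs⟩
    · intro x hx
      rcases Finset.mem_insert.1 (Finset.mem_coe.1 hx) with rfl | hx
      · exact hc
      · exact hsT hx
    · intro a ha b hb' hab
      rcases Finset.mem_insert.1 ha with rfl | ha' <;>
        rcases Finset.mem_insert.1 hb' with rfl | hb'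
      · exact absurd rfl hab
      · exact (hcon b hb').le
      · rw [norm_sub_rev]
        exact (hcon a ha').le
      · exact hsep a ha' b hb' hab
  have := Nat.le_findGreatest (hb _ hg) hg
  rw [← hcard] at this
  omega

/-- Finite nets of sets of matrices in a Frobenius ball. -/
theorem exists_matrix_net {ι κ : Type*} [Fintype ι] [Fintype κ] (T : Set (Matrix ι κ ℝ))
    (M₀ : Matrix ι κ ℝ) {R η : ℝ} (hR : 0 ≤ R) (hη : 0 < η) (hT : ∀ M ∈ T, frob (M - M₀) ≤ R) :
    ∃ F : Finset (Matrix ι κ ℝ), ↑F ⊆ T ∧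
      (F.card : ℝ) ≤ (1 + 2 * R / η) ^ (Fintype.card ι * Fintype.card κ) ∧
      ∀ M ∈ T, ∃ N ∈ F, frob (M - N) ≤ η := by
  classical
  -- Translating by `M₀` centres the ball at the origin, and flattening turns the Frobenius norm
  -- into a Euclidean one.
  let toE : Matrix ι κ ℝ → EuclideanSpace ℝ (ι × κ) := fun M =>
    WithLp.toLp 2 fun q => M q.1 q.2 - M₀ q.1 q.2
  let ofE : EuclideanSpace ℝ (ι × κ) → Matrix ι κ ℝ := fun x =>
    Matrix.of fun i j => x (i, j) + M₀ i j
  have hleft : ∀ M, ofE (toE M) = M := by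
    intro M
    ext i j
    simp [ofE, toE]
  have hnorm : ∀ M, ‖toE M‖ = frob (M - M₀) := fun M => rfl
  have hdist : ∀ M N, ‖toE M - toE N‖ = frob (M - N) := by
    intro M N
    rw [frob, l2]
    congr 1
    ext q
    simp [toE]
  obtain ⟨s, hs, hcard, hcov⟩ := exists_finset_cover (toE '' T) hR hη (by
    rintro _ ⟨M, hM, rfl⟩
    rw [hnorm]
    exact hT M hM)
  refine ⟨s.image ofE, ?_, ?_, ?_⟩
  · intro M hM
    obtain ⟨x, hx, rfl⟩ := Finset.mem_image.1 (Finset.mem_coe.1 hM)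
    obtain ⟨N, hN, rfl⟩ := hs hx
    rwa [hleft]
  · refine le_trans (by exact_mod_cast Finset.card_image_le) (hcard.trans_eq ?_)
    simp
  · intro M hM
    obtain ⟨x, hx, hd⟩ := hcov (toE M) ⟨M, hM, rfl⟩
    obtain ⟨N, hN, rfl⟩ := hs hx
    refine ⟨N, Finset.mem_image.2 ⟨toE N, hx, hleft N⟩, ?_⟩
    rwa [← hdist]

end Covering

/-! ### Near isometries -/

section NearIsometry

/-- The off-diagonal part of a matrix. -/
def offDiag {ι : Type*} [DecidableEq ι] (M : Matrix ι ι ℝ) : Matrix ι ι ℝ := Matrix.of fun i j => if i = j then 0 else M i j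

lemma eq_offDiag_add {ι : Type*} [DecidableEq ι] (M : Matrix ι ι ℝ) : M = offDiag M + Matrix.diagonal fun j => M j j := by
  ext i j
  by_cases h : i = j
  · subst h
    simp [offDiag]
  · simp [offDiag, h]

lemma gram_diag_nonneg {ι κ : Type*} [Fintype κ] (Δ : Matrix κ ι ℝ) (j : ι) : 0 ≤ (Δᵀ * Δ) j j := by
  rw [Matrix.mul_apply]
  exact Finset.sum_nonneg fun l _ => mul_self_nonneg _

variable {ι κ : Type*} [Fintype ι] [Fintype κ]

lemma l2_le_sum (x : ι → ℝ) (hx : ∀ i, 0 ≤ x i) : l2 x ≤ ∑ i, x i := by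
  refine l2_le_of_sq_le (Finset.sum_nonneg fun i _ => hx i) ?_
  exact Finset.sum_sq_le_sq_sum_of_nonneg fun i _ => hx i

lemma gram_diag_sum (Δ : Matrix κ ι ℝ) : ∑ j, (Δᵀ * Δ) j j = frob Δ ^ 2 := by
  rw [frob_sq']
  simp [Matrix.mul_apply, sq]

variable [DecidableEq ι]

/-- A matrix with unit columns whose Gram matrix is within `η` of the identity. -/
structure NearIsometry (η : ℝ) (A : Matrix κ ι ℝ) : Prop where
  unit : ∀ j, (Aᵀ * A) j j = 1
  defect : frob (Aᵀ * A - 1) ≤ η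

lemma NearIsometry.nonneg {η : ℝ} {A : Matrix κ ι ℝ} (hA : NearIsometry η A) : 0 ≤ η :=
  (frob_nonneg _).trans hA.defect

lemma NearIsometry.abs_sub_le {η : ℝ} {A : Matrix κ ι ℝ} (hA : NearIsometry η A) (z : ι → ℝ) :
    |l2 (A *ᵥ z) ^ 2 - l2 z ^ 2| ≤ η * l2 z ^ 2 := by
  have h : l2 (A *ᵥ z) ^ 2 - l2 z ^ 2 = z ⬝ᵥ ((Aᵀ * A - 1) *ᵥ z) := by
    rw [Matrix.sub_mulVec, dotProduct_sub, Matrix.one_mulVec, ← l2_sq_dot, l2_sq_dot (A *ᵥ z),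
      ← Matrix.mulVec_mulVec, dotProduct_mulVec_eq, dotProduct_comm]
  rw [h]
  refine (abs_dotProduct_le _ _).trans ?_
  have h1 := l2_mulVec_le (Aᵀ * A - 1) z
  have h2 := mul_le_mul_of_nonneg_right hA.defect (l2_nonneg z)
  have h3 := mul_le_mul_of_nonneg_left (h1.trans h2) (l2_nonneg z)
  nlinarith

lemma NearIsometry.wellConditioned {η : ℝ} {A : Matrix κ ι ℝ} (hA : NearIsometry η A)
    (hη : η ≤ 1 / 2) : WellConditioned A where
  lower z := by
    have := (abs_le.1 (hA.abs_sub_le z)).1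
    nlinarith [sq_nonneg (l2 z)]
  upper z := by
    have := (abs_le.1 (hA.abs_sub_le z)).2
    nlinarith [sq_nonneg (l2 z)]

/-- With G the Gram matrix, z = G⁻¹y solves z = y - (G - 1)z, so ‖z‖ ≤ ‖y‖ + η‖z‖ can be solved for
‖z‖. -/
lemma NearIsometry.l2_inv_mulVec_le {η : ℝ} {A : Matrix κ ι ℝ} (hA : NearIsometry η A)
    (hη : η ≤ 1 / 2) (y : ι → ℝ) : l2 ((Aᵀ * A)⁻¹ *ᵥ y) ≤ 1 / (1 - η) * l2 y := by
  have hu := (hA.wellConditioned hη).isUnit_det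
  set z := (Aᵀ * A)⁻¹ *ᵥ y with hz
  have hy : (Aᵀ * A) *ᵥ z = y := by
    rw [hz, Matrix.mulVec_mulVec, Matrix.mul_nonsing_inv _ hu, Matrix.one_mulVec]
  have h1 : z = y - (Aᵀ * A - 1) *ᵥ z := by
    rw [Matrix.sub_mulVec, hy, Matrix.one_mulVec]
    abel
  have h2 : l2 z ≤ l2 y + η * l2 z := by
    calc l2 z = l2 (y - (Aᵀ * A - 1) *ᵥ z) := by rw [← h1]
      _ ≤ l2 y + l2 ((Aᵀ * A - 1) *ᵥ z) := l2_sub_le _ _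
      _ ≤ _ := by
        gcongr
        exact (l2_mulVec_le _ _).trans (mul_le_mul_of_nonneg_right hA.defect (l2_nonneg _))
  rw [div_mul_eq_mul_div, one_mul, le_div_iff₀ (by linarith)]
  linarith

lemma NearIsometry.frob_inv_sub_one_le {η : ℝ} {A : Matrix κ ι ℝ} (hA : NearIsometry η A)
    (hη : η ≤ 1 / 2) : frob ((Aᵀ * A)⁻¹ - 1) ≤ 1 / (1 - η) * η := by
  have hu := (hA.wellConditioned hη).isUnit_det
  have h : (Aᵀ * A)⁻¹ - 1 = (Aᵀ * A)⁻¹ * (1 - Aᵀ * A) := by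
    rw [mul_sub, mul_one, Matrix.nonsing_inv_mul _ hu]
  have hq : 0 ≤ 1 / (1 - η) := by
    have : 0 < 1 - η := by linarith
    positivity
  rw [h]
  refine (frob_mul_le_of hq (hA.l2_inv_mulVec_le hη) _).trans ?_
  rw [frob_sub_comm]
  exact mul_le_mul_of_nonneg_left hA.defect hq

lemma frob_offDiag_le (M : Matrix ι ι ℝ) : frob (offDiag M) ≤ frob M := by
  refine frob_le_of_sq_le (frob_nonneg _) ?_
  rw [frob_sq]
  refine Finset.sum_le_sum fun i _ => Finset.sum_le_sum fun j _ => ?_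
  by_cases h : i = j <;> simp [offDiag, h, sq_nonneg]

lemma frob_diagonal (x : ι → ℝ) : frob (Matrix.diagonal x) = l2 x := by
  refine (sq_eq_sq₀ (frob_nonneg _) (l2_nonneg _)).1 ?_
  rw [frob_sq, l2_sq]
  refine Finset.sum_congr rfl fun i _ => ?_
  rw [Finset.sum_eq_single i]
  · simp
  · intro j _ hj
    simp [Matrix.diagonal_apply_ne' _ hj]
  · simp

variable {A₀ A : Matrix κ ι ℝ} {η : ℝ}

/-- For unit vectors a₀ and a, ⟨a₀, a - a₀⟩ = -‖a - a₀‖²/2. This is why diagonal contributions are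
only of second order. -/
lemma NearIsometry.cross_diag (h0 : NearIsometry η A₀) (h : NearIsometry η A) (j : ι) :
    (A₀ᵀ * (A - A₀)) j j = -(1 / 2) * ((A - A₀)ᵀ * (A - A₀)) j j := by
  have e1 := h0.unit j
  have e2 := h.unit j
  have e3 : (Aᵀ * A₀) j j = (A₀ᵀ * A) j j := by
    simp [Matrix.mul_apply, mul_comm]
  simp only [Matrix.transpose_sub, Matrix.sub_mul, Matrix.mul_sub, Matrix.sub_apply, e1, e2, e3]
  ring

/-- In AᵀΔ = A₀ᵀΔ + ΔᵀΔ, everything but the off-diagonal part of A₀ᵀΔ is quadratic in Δ. Keeping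
that part separate matters because its average over supports is small. -/
lemma NearIsometry.frob_cross_le (h0 : NearIsometry η A₀) (h : NearIsometry η A) :
    frob (Aᵀ * (A - A₀)) ≤ frob (offDiag (A₀ᵀ * (A - A₀))) + 3 / 2 * frob (A - A₀) ^ 2 := by
  set Δ := A - A₀ with hΔ
  have e : Aᵀ * Δ = offDiag (A₀ᵀ * Δ) + (Matrix.diagonal (fun j => (A₀ᵀ * Δ) j j) + Δᵀ * Δ) := by
    rw [← add_assoc, ← eq_offDiag_add, ← Matrix.add_mul, ← Matrix.transpose_add, hΔ]
    simp
  have h1 : frob (Matrix.diagonal fun j => (A₀ᵀ * Δ) j j) ≤ 1 / 2 * frob Δ ^ 2 := by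
    rw [frob_diagonal]
    have : (fun j => (A₀ᵀ * Δ) j j) = -(fun j => 1 / 2 * (Δᵀ * Δ) j j) := by
      funext j
      rw [hΔ, h0.cross_diag h j, Pi.neg_apply]
      ring
    rw [this, l2_neg]
    refine (l2_le_sum _ fun j => ?_).trans_eq ?_
    · have := gram_diag_nonneg Δ j
      positivity
    · rw [← Finset.mul_sum, gram_diag_sum]
  have h2 : frob (Δᵀ * Δ) ≤ frob Δ ^ 2 := by
    refine (frob_mul_le _ _).trans_eq ?_
    rw [frob_transpose, sq]
  rw [e]
  have h3 := frob_add_le (offDiag (A₀ᵀ * Δ)) (Matrix.diagonal (fun j => (A₀ᵀ * Δ) j j) + Δᵀ * Δ)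
  have h4 := frob_add_le (Matrix.diagonal fun j => (A₀ᵀ * Δ) j j) (Δᵀ * Δ)
  linarith

/-- Here G⁻¹AᵀA₀ = 1 - AᵀΔ - (G⁻¹ - 1)AᵀΔ. The trace of AᵀΔ is exactly ‖Δ‖²/2 by
`NearIsometry.cross_diag`, so the first-order term appears only multiplied by G⁻¹ - 1, which is of
size η. -/
lemma NearIsometry.abs_trace_pinv_sub_le (h0 : NearIsometry η A₀) (h : NearIsometry η A)
    (hη : η ≤ 1 / 2) :
    |((Aᵀ * A)⁻¹ * (Aᵀ * A₀)).trace - Fintype.card ι| ≤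
      1 / 2 * frob (A - A₀) ^ 2 + 1 / (1 - η) * η *
        (frob (offDiag (A₀ᵀ * (A - A₀))) + 3 / 2 * frob (A - A₀) ^ 2) := by
  have hu := (h.wellConditioned hη).isUnit_det
  set Δ := A - A₀ with hΔ
  have hq : 0 ≤ 1 / (1 - η) * η := by
    have : 0 < 1 - η := by linarith
    have := h.nonneg
    positivity
  have e1 : (Aᵀ * A)⁻¹ * (Aᵀ * A₀) = 1 - (Aᵀ * Δ + ((Aᵀ * A)⁻¹ - 1) * (Aᵀ * Δ)) := by
    have : A₀ = A - Δ := by rw [hΔ]; abel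
    conv_lhs => rw [this, Matrix.mul_sub, Matrix.mul_sub, Matrix.nonsing_inv_mul _ hu]
    rw [sub_mul, one_mul]
    abel
  have e2 : (Aᵀ * Δ).trace = 1 / 2 * frob Δ ^ 2 := by
    rw [← gram_diag_sum, Matrix.trace, Finset.mul_sum]
    refine Finset.sum_congr rfl fun j _ => ?_
    have : Aᵀ * Δ = A₀ᵀ * Δ + Δᵀ * Δ := by
      rw [← Matrix.add_mul, ← Matrix.transpose_add, hΔ]
      simp
    rw [Matrix.diag_apply, this, Matrix.add_apply, hΔ, h0.cross_diag h j]
    ring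
  rw [e1, Matrix.trace_sub, Matrix.trace_one, Matrix.trace_add, e2, abs_le]
  have h1 := abs_trace_mul_le ((Aᵀ * A)⁻¹ - 1) (Aᵀ * Δ)
  have h2 : frob ((Aᵀ * A)⁻¹ - 1) * frob (Aᵀ * Δ) ≤ 1 / (1 - η) * η *
      (frob (offDiag (A₀ᵀ * Δ)) + 3 / 2 * frob Δ ^ 2) :=
    mul_le_mul (h.frob_inv_sub_one_le hη) (h0.frob_cross_le h) (frob_nonneg _) hq
  have h3 := abs_le.1 (h1.trans h2)
  have h4 := sq_nonneg (frob Δ)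
  constructor <;> linarith [h3.1, h3.2]

/-- By the resolvent identity the difference is the trace of G₀⁻¹G⁻¹H with H = G₀ - G. Both Gram
matrices have unit diagonal, so H is traceless and G₀⁻¹G⁻¹ may be replaced by G₀⁻¹G⁻¹ - 1, which
gains the factor η. -/
lemma NearIsometry.abs_trace_inv_sub_le (h0 : NearIsometry η A₀) (h : NearIsometry η A)
    (hη : η ≤ 1 / 2) :
    |((Aᵀ * A)⁻¹).trace - ((A₀ᵀ * A₀)⁻¹).trace| ≤
      2 * (1 / (1 - η)) ^ 2 * η *
        (2 * frob (offDiag (A₀ᵀ * (A - A₀))) + frob (A - A₀) ^ 2) := by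
  have hu := (h.wellConditioned hη).isUnit_det
  have hu0 := (h0.wellConditioned hη).isUnit_det
  set Δ := A - A₀ with hΔ
  set q := 1 / (1 - η) with hq
  have hη0 := h.nonneg
  have hq1 : 1 ≤ q := by
    rw [hq, le_div_iff₀ (by linarith)]
    linarith
  set H := A₀ᵀ * A₀ - Aᵀ * A with hH
  have eH : -H = A₀ᵀ * Δ + (A₀ᵀ * Δ)ᵀ + Δᵀ * Δ := by
    rw [hH, hΔ]
    simp only [Matrix.transpose_mul, Matrix.transpose_transpose, Matrix.transpose_sub,
      Matrix.sub_mul, Matrix.mul_sub]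
    abel
  have hdiag : ∀ j, H j j = 0 := fun j => by
    rw [hH, Matrix.sub_apply, h0.unit, h.unit, sub_self]
  have hfH : frob H ≤ 2 * frob (offDiag (A₀ᵀ * Δ)) + frob Δ ^ 2 := by
    have e : -H = offDiag (A₀ᵀ * Δ) + (offDiag (A₀ᵀ * Δ))ᵀ + offDiag (Δᵀ * Δ) := by
      ext i j
      by_cases hij : i = j
      · subst hij
        simp [offDiag, hdiag]
      · rw [eH]
        simp [offDiag, hij, Ne.symm hij, -Matrix.transpose_mul]
    rw [← frob_neg, e]
    have h1 := frob_add_le (offDiag (A₀ᵀ * Δ) + (offDiag (A₀ᵀ * Δ))ᵀ) (offDiag (Δᵀ * Δ))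
    have h2 := frob_add_le (offDiag (A₀ᵀ * Δ)) (offDiag (A₀ᵀ * Δ))ᵀ
    rw [frob_transpose] at h2
    have h3 : frob (offDiag (Δᵀ * Δ)) ≤ frob Δ ^ 2 := by
      refine (frob_offDiag_le _).trans ((frob_mul_le _ _).trans_eq ?_)
      rw [frob_transpose, sq]
    linarith
  have hfN : frob ((A₀ᵀ * A₀)⁻¹ * (Aᵀ * A)⁻¹ - 1) ≤ 2 * q ^ 2 * η := by
    have e : (A₀ᵀ * A₀)⁻¹ * (Aᵀ * A)⁻¹ - 1 =
        (A₀ᵀ * A₀)⁻¹ * ((Aᵀ * A)⁻¹ - 1) + ((A₀ᵀ * A₀)⁻¹ - 1) := by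
      rw [mul_sub, mul_one]
      abel
    rw [e]
    have h1 := frob_mul_le_of (by positivity) (h0.l2_inv_mulVec_le hη) ((Aᵀ * A)⁻¹ - 1)
    have h2 := mul_le_mul_of_nonneg_left (h.frob_inv_sub_one_le hη) (by positivity : 0 ≤ q)
    have h3 := h0.frob_inv_sub_one_le hη
    rw [← hq] at h1 h2 h3
    have h4 := frob_add_le ((A₀ᵀ * A₀)⁻¹ * ((Aᵀ * A)⁻¹ - 1)) ((A₀ᵀ * A₀)⁻¹ - 1)
    have h5 : q * η ≤ q * (q * η) := le_mul_of_one_le_left (by positivity) hq1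
    nlinarith
  have e1 : ((Aᵀ * A)⁻¹).trace - ((A₀ᵀ * A₀)⁻¹).trace =
      (((A₀ᵀ * A₀)⁻¹ * (Aᵀ * A)⁻¹ - 1) * H).trace := by
    have e2 : (Aᵀ * A)⁻¹ * H * (A₀ᵀ * A₀)⁻¹ = (Aᵀ * A)⁻¹ - (A₀ᵀ * A₀)⁻¹ := by
      rw [hH, mul_sub, sub_mul, Matrix.nonsing_inv_mul _ hu, one_mul, mul_assoc,
        Matrix.mul_nonsing_inv _ hu0, mul_one]
    have e3 : H.trace = 0 := by
      simp [Matrix.trace, hdiag]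
    rw [← Matrix.trace_sub, ← e2, Matrix.trace_mul_comm, ← mul_assoc, sub_mul, one_mul,
      Matrix.trace_sub, e3, sub_zero]
  rw [e1]
  refine (abs_trace_mul_le _ _).trans ?_
  exact mul_le_mul hfN hfH (frob_nonneg _) (by positivity)

end NearIsometry

/-! ### Geometry of dictionaries -/

section Dictionary

variable {m p k : ℕ}

lemma le_coherence (D : Matrix (Fin m) (Fin p) ℝ) {i j : Fin p} (hij : i ≠ j) :
    |∑ l, D l i * D l j| ≤ coherence D :=
  le_ciSup (f := fun q : {q : Fin p × Fin p // q.1 ≠ q.2} => |∑ l, D l q.1.1 * D l q.1.2|)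
    (Set.finite_range _).bddAbove ⟨(i, j), hij⟩

lemma coherence_nonneg (D : Matrix (Fin m) (Fin p) ℝ) : 0 ≤ coherence D :=
  Real.iSup_nonneg fun _ => abs_nonneg _

/-- Subdictionaries of incoherent dictionaries are near isometries. -/
lemma nearIsometry_cols {D : Matrix (Fin m) (Fin p) ℝ} (hD : D ∈ unitDictionaries m p) {μ : ℝ}
    (hμ : 0 ≤ μ) (hcoh : ∀ i j, i ≠ j → |∑ l, D l i * D l j| ≤ μ) {J : Finset (Fin p)}
    (hJ : J.card = k) : NearIsometry (k * μ) (cols D J) where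
  unit j := by
    have := hD j
    simpa [Matrix.mul_apply, cols, sq] using this
  defect := by
    refine frob_le_of_sq_le (by positivity) ?_
    -- The Gram matrix minus the identity has k² entries, each of size at most μ and zero on the
    -- diagonal, so its Frobenius norm is at most kμ.
    have hent : ∀ i j : J, ((cols D J)ᵀ * cols D J - 1 : Matrix J J ℝ) i j ^ 2 ≤ μ ^ 2 := by
      intro i j
      rw [sq_le_sq, abs_of_nonneg hμ]
      by_cases hij : i = j
      · subst hij
        have h1 : ((cols D J)ᵀ * cols D J) i i = 1 := by
          have := hD i
          simpa [Matrix.mul_apply, cols, sq] using this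
        rw [Matrix.sub_apply, h1, Matrix.one_apply_eq, sub_self, abs_zero]
        exact hμ
      · rw [Matrix.sub_apply, Matrix.one_apply_ne hij, sub_zero]
        exact hcoh i j fun h => hij (Subtype.ext h)
    refine (Finset.sum_le_sum fun i _ => Finset.sum_le_sum fun j _ => hent i j).trans_eq ?_
    simp [hJ]
    ring

lemma l2_mulVec_le_spectralNorm (D : Matrix (Fin m) (Fin p) ℝ) (z : Fin p → ℝ) :
    l2 (D *ᵥ z) ≤ spectralNorm D * l2 z := by
  have := (Matrix.toEuclideanLin D).toContinuousLinearMap.le_opNorm (WithLp.toLp 2 z)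
  simpa [l2, spectralNorm] using this

lemma spectralNorm_nonneg (D : Matrix (Fin m) (Fin p) ℝ) : 0 ≤ spectralNorm D := norm_nonneg _

/-- From ‖Dᵀy‖² = ⟨y, DDᵀy⟩ ≤ ‖y‖ ‖D‖ ‖Dᵀy‖, cancel one factor. -/
lemma l2_transpose_mulVec_le_spectralNorm (D : Matrix (Fin m) (Fin p) ℝ) (y : Fin m → ℝ) :
    l2 (Dᵀ *ᵥ y) ≤ spectralNorm D * l2 y := by
  have h1 : l2 (Dᵀ *ᵥ y) ^ 2 = y ⬝ᵥ (D *ᵥ (Dᵀ *ᵥ y)) := by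
    rw [dotProduct_mulVec_eq, l2_sq_dot]
  have h2 := dotProduct_le_l2 y (D *ᵥ (Dᵀ *ᵥ y))
  have h3 := mul_le_mul_of_nonneg_left (l2_mulVec_le_spectralNorm D (Dᵀ *ᵥ y)) (l2_nonneg y)
  rcases (l2_nonneg (Dᵀ *ᵥ y)).eq_or_lt with h0 | h0
  · rw [← h0]
    exact mul_nonneg (spectralNorm_nonneg D) (l2_nonneg y)
  · nlinarith

/-- A coordinate vector is sent to a unit column. The bound later absorbs t² terms into terms
carrying the spectral norm. -/
lemma one_le_spectralNorm {D : Matrix (Fin m) (Fin p) ℝ} (hD : D ∈ unitDictionaries m p)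
    (hp : 0 < p) : 1 ≤ spectralNorm D := by
  have h := l2_mulVec_le_spectralNorm D (Pi.single ⟨0, hp⟩ 1)
  have h1 : l2 (D *ᵥ Pi.single ⟨0, hp⟩ 1) = 1 := by
    refine (sq_eq_sq₀ (l2_nonneg _) zero_le_one).1 ?_
    rw [l2_sq]
    simpa using hD ⟨0, hp⟩
  have h2 : l2 (Pi.single (⟨0, hp⟩ : Fin p) (1 : ℝ)) = 1 := by
    refine (sq_eq_sq₀ (l2_nonneg _) zero_le_one).1 ?_
    rw [l2_sq, Finset.sum_eq_single ⟨0, hp⟩]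
    · simp
    · intro j _ hj
      simp [hj]
    · simp
  rw [h1, h2, mul_one] at h
  exact h

lemma frob_cols_le (D : Matrix (Fin m) (Fin p) ℝ) (J : Finset (Fin p)) :
    frob (cols D J) ≤ frob D := by
  refine frob_le_of_sq_le (frob_nonneg _) ?_
  rw [frob_sq]
  refine Finset.sum_le_sum fun i _ => ?_
  simp only [cols, Matrix.submatrix_apply, id]
  rw [Finset.sum_coe_sort J (fun j => D i j ^ 2)]
  exact Finset.sum_le_univ_sum_of_nonneg fun j => sq_nonneg _

lemma cols_sub (D D' : Matrix (Fin m) (Fin p) ℝ) (J : Finset (Fin p)) :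
    cols (D - D') J = cols D J - cols D' J := rfl

lemma frob_cols_sq (D : Matrix (Fin m) (Fin p) ℝ) (J : Finset (Fin p)) :
    frob (cols D J) ^ 2 = ∑ j ∈ J, l2 (fun l => D l j) ^ 2 := by
  rw [frob_sq_cols]
  exact Finset.sum_coe_sort J (fun j => l2 (fun l => D l j) ^ 2)

/-! ### Restricted isometry -/

/-- Conditions in the definition of the restricted isometry constant. -/
lemma rip_mem_of_nearIsometry {D : Matrix (Fin m) (Fin p) ℝ} {η : ℝ} (hη : 0 ≤ η)
    (hD : ∀ J : Finset (Fin p), J.card = k → NearIsometry η (cols D J)) :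
    η ∈ {δ : ℝ | 0 ≤ δ ∧ ∀ J : Finset (Fin p), J.card = k → ∀ z : Fin p → ℝ,
    (∀ j, j ∉ J → z j = 0) →
      (1 - δ) * ∑ j, z j ^ 2 ≤ ∑ l, (D *ᵥ z) l ^ 2 ∧
      ∑ l, (D *ᵥ z) l ^ 2 ≤ (1 + δ) * ∑ j, z j ^ 2} := by
  refine ⟨hη, fun J hJ z hz => ?_⟩
  have h := abs_le.1 ((hD J hJ).abs_sub_le fun j : J => z j)
  rw [← mulVec_eq_cols_mulVec D hz] at h
  have e : l2 (fun j : J => z j) ^ 2 = ∑ j, z j ^ 2 := by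
    have := dotProduct_eq_restrict z hz
    rw [l2_sq_dot, ← this]
    simp [dotProduct, sq]
  rw [e, l2_sq] at h
  constructor <;> linarith [h.1, h.2]

lemma ripConstant_le {D : Matrix (Fin m) (Fin p) ℝ} {η : ℝ} (hη : 0 ≤ η)
    (hD : ∀ J : Finset (Fin p), J.card = k → NearIsometry η (cols D J)) :
    ripConstant k D ≤ η :=
  csInf_le ⟨0, fun _ h => h.1⟩ (rip_mem_of_nearIsometry hη hD)

/-- The infimum defining the constant still satisfies the lower inequality: for fixed z ≠ 0 the
condition on δ is a closed half-line, and near isometry shows that the set of admissible δ is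
nonempty. -/
lemma ripConstant_lower {D : Matrix (Fin m) (Fin p) ℝ} {η : ℝ} (hη : 0 ≤ η)
    (hD : ∀ J : Finset (Fin p), J.card = k → NearIsometry η (cols D J))
    {J : Finset (Fin p)} (hJ : J.card = k) (z : J → ℝ) :
    (1 - ripConstant k D) * l2 z ^ 2 ≤ l2 (cols D J *ᵥ z) ^ 2 := by
  rcases (sq_nonneg (l2 z)).eq_or_lt with h0 | h0
  · rw [← h0, mul_zero]
    exact sq_nonneg _
  have h : 1 - l2 (cols D J *ᵥ z) ^ 2 / l2 z ^ 2 ≤ ripConstant k D := by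
    refine le_csInf ⟨η, rip_mem_of_nearIsometry hη hD⟩ fun δ hδ => ?_
    let a : Fin p → ℝ := fun j => if h : j ∈ J then z ⟨j, h⟩ else 0
    have ha : ∀ j, j ∉ J → a j = 0 := fun j hj => by simp [a, hj]
    have haz : (fun j : J => a j) = z := by
      funext j
      simp [a]
    have h1 := (hδ.2 J hJ a ha).1
    have e : ∑ j, a j ^ 2 = l2 z ^ 2 := by
      have := dotProduct_eq_restrict a ha
      rw [haz, ← l2_sq_dot, ← l2_sq_dot, l2_sq] at this
      exact this
    rw [e, ← l2_sq, mulVec_eq_cols_mulVec D ha, haz] at h1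
    rw [sub_le_comm, le_div_iff₀ h0]
    exact h1
  rw [sub_le_comm, le_div_iff₀ h0] at h
  exact h

/-! ### The curves of dictionaries -/

variable {D₀ W : Matrix (Fin m) (Fin p) ℝ} {v : Fin p → ℝ} {t : ℝ}

lemma curve_apply (D₀ W : Matrix (Fin m) (Fin p) ℝ) (v : Fin p → ℝ) (t : ℝ) (l : Fin m)
    (j : Fin p) :
    curve D₀ W v t l j = D₀ l j * Real.cos (v j * t) + W l j * Real.sin (v j * t) := by
  simp [curve, Matrix.mul_diagonal]

lemma abs_le_one_of_mem_unitSphere (hv : v ∈ unitSphere p) (j : Fin p) : |v j| ≤ 1 := by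
  rw [← sq_le_one_iff_abs_le_one, ← show ∑ j, v j ^ 2 = 1 from hv]
  exact Finset.single_le_sum (f := fun j => v j ^ 2) (fun i _ => sq_nonneg _) (Finset.mem_univ j)

lemma curve_dot (D₀ W : Matrix (Fin m) (Fin p) ℝ) (v : Fin p → ℝ) (t : ℝ) (i j : Fin p) :
    ∑ l, curve D₀ W v t l i * curve D₀ W v t l j =
      (Real.cos (v i * t) * Real.cos (v j * t)) * ∑ l, D₀ l i * D₀ l j +
      (Real.cos (v i * t) * Real.sin (v j * t)) * ∑ l, D₀ l i * W l j +
      (Real.sin (v i * t) * Real.cos (v j * t)) * ∑ l, W l i * D₀ l j +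
      (Real.sin (v i * t) * Real.sin (v j * t)) * ∑ l, W l i * W l j := by
  simp only [curve_apply, Finset.mul_sum, ← Finset.sum_add_distrib]
  refine Finset.sum_congr rfl fun l _ => ?_
  ring

lemma curve_mem_unitDictionaries (hD₀ : D₀ ∈ unitDictionaries m p)
    (hW : W ∈ tangentDirections D₀) (v : Fin p → ℝ) (t : ℝ) :
    curve D₀ W v t ∈ unitDictionaries m p := by
  intro j
  have h := curve_dot D₀ W v t j j
  have h1 : ∑ l, D₀ l j * D₀ l j = 1 := by simpa [sq] using hD₀ j
  have h2 : ∑ l, W l j * W l j = 1 := by simpa [sq] using hW.2 j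
  have h3 := hW.1 j
  have h4 : ∑ l, D₀ l j * W l j = 0 := by simpa [mul_comm] using h3
  rw [h1, h2, h3, h4] at h
  simp only [sq, h]
  nlinarith [Real.sin_sq_add_cos_sq (v j * t)]

lemma abs_sum_mul_le_one {x y : Fin m → ℝ} (hx : ∑ l, x l ^ 2 = 1) (hy : ∑ l, y l ^ 2 = 1) :
    |∑ l, x l * y l| ≤ 1 := by
  rw [← sq_le_one_iff_abs_le_one]
  have := Finset.sum_mul_sq_le_sq_mul_sq Finset.univ x y
  rwa [hx, hy, mul_one] at this

/-- Expanding the inner product gives four terms, of size at most μ₀, t, t and t² ≤ t; this is the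
origin of 3t in μ(t). -/
lemma abs_curve_dot_le (hD₀ : D₀ ∈ unitDictionaries m p) (hW : W ∈ tangentDirections D₀)
    (hv : v ∈ unitSphere p) (ht : 0 ≤ t) (ht1 : t ≤ 1) {i j : Fin p} (hij : i ≠ j) :
    |∑ l, curve D₀ W v t l i * curve D₀ W v t l j| ≤ coherenceAt D₀ t := by
  have hs : ∀ j, |Real.sin (v j * t)| ≤ t := fun j => by
    refine Real.abs_sin_le_abs.trans ?_
    rw [abs_mul, abs_of_nonneg ht]
    exact mul_le_of_le_one_left ht (abs_le_one_of_mem_unitSphere hv j)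
  have hc : ∀ j, |Real.cos (v j * t)| ≤ 1 := fun j => Real.abs_cos_le_one _
  have key : ∀ {a b c A B C : ℝ}, |a| ≤ A → |b| ≤ B → |c| ≤ C → |a * b * c| ≤ A * B * C := by
    intro a b c A B C ha hb hc
    have hA := (abs_nonneg a).trans ha
    have hB := (abs_nonneg b).trans hb
    rw [abs_mul, abs_mul]
    gcongr
  rw [curve_dot, coherenceAt]
  have h1 := key (hc i) (hc j) (le_coherence D₀ hij)
  have h2 := key (hc i) (hs j) (abs_sum_mul_le_one (hD₀ i) (hW.2 j))
  have h3 := key (hs i) (hc j) (abs_sum_mul_le_one (hW.2 i) (hD₀ j))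
  have h4 := key (hs i) (hs j) (abs_sum_mul_le_one (hW.2 i) (hW.2 j))
  have h5 : t * t * 1 ≤ t := by nlinarith
  refine (abs_add_le _ _).trans ?_
  refine (add_le_add_left ((abs_add_le _ _).trans (add_le_add_left (abs_add_le _ _) _)) _).trans ?_
  linarith

lemma nearIsometry_curve (hD₀ : D₀ ∈ unitDictionaries m p) (hW : W ∈ tangentDirections D₀)
    (hv : v ∈ unitSphere p) (ht : 0 ≤ t) (ht1 : t ≤ 1) {J : Finset (Fin p)} (hJ : J.card = k) :
    NearIsometry (k * coherenceAt D₀ t) (cols (curve D₀ W v t) J) :=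
  nearIsometry_cols (curve_mem_unitDictionaries hD₀ hW v t)
    (add_nonneg (coherence_nonneg D₀) (by positivity))
    (fun _ _ hij => abs_curve_dot_le hD₀ hW hv ht ht1 hij) hJ

lemma nearIsometry_base (hD₀ : D₀ ∈ unitDictionaries m p) (ht : 0 ≤ t)
    {J : Finset (Fin p)} (hJ : J.card = k) :
    NearIsometry (k * coherenceAt D₀ t) (cols D₀ J) :=
  nearIsometry_cols hD₀ (add_nonneg (coherence_nonneg D₀) (by positivity))
    (fun _ _ hij => (le_coherence D₀ hij).trans (le_add_of_nonneg_right (by positivity))) hJ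

/-- Each column moves along a great circle, so the squared chord is 2 - 2cos(v_j t), at most the
squared arc length. -/
lemma l2_curve_sub_col_le (hD₀ : D₀ ∈ unitDictionaries m p) (hW : W ∈ tangentDirections D₀)
    (v : Fin p → ℝ) (t : ℝ) (j : Fin p) :
    l2 (fun l => (curve D₀ W v t - D₀) l j) ^ 2 ≤ v j ^ 2 * t ^ 2 := by
  have h1 : ∑ l, curve D₀ W v t l j ^ 2 = 1 := curve_mem_unitDictionaries hD₀ hW v t j
  have h2 : ∑ l, curve D₀ W v t l j * D₀ l j = Real.cos (v j * t) := by
    have h3 : ∑ l, D₀ l j * D₀ l j = 1 := by simpa [sq] using hD₀ j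
    have : ∑ l, curve D₀ W v t l j * D₀ l j = Real.cos (v j * t) * ∑ l, D₀ l j * D₀ l j +
        Real.sin (v j * t) * ∑ l, W l j * D₀ l j := by
      simp only [curve_apply, Finset.mul_sum, ← Finset.sum_add_distrib]
      refine Finset.sum_congr rfl fun l _ => ?_
      ring
    rw [this, h3, hW.1 j]
    ring
  have h4 : l2 (fun l => (curve D₀ W v t - D₀) l j) ^ 2 = 2 - 2 * Real.cos (v j * t) := by
    rw [l2_sq, ← h2]
    have : ∀ l, (curve D₀ W v t - D₀) l j ^ 2 = curve D₀ W v t l j ^ 2 + D₀ l j ^ 2 -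
        2 * (curve D₀ W v t l j * D₀ l j) := fun l => by
      rw [Matrix.sub_apply]
      ring
    simp only [this, Finset.sum_sub_distrib, Finset.sum_add_distrib, ← Finset.mul_sum, h1, hD₀ j]
    ring
  rw [h4]
  have := Real.one_sub_sq_div_two_le_cos (x := v j * t)
  nlinarith

lemma frob_cols_curve_sub_sq_le (hD₀ : D₀ ∈ unitDictionaries m p)
    (hW : W ∈ tangentDirections D₀) (v : Fin p → ℝ) (t : ℝ) (J : Finset (Fin p)) :
    frob (cols (curve D₀ W v t) J - cols D₀ J) ^ 2 ≤ t ^ 2 * ∑ j ∈ J, v j ^ 2 := by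
  rw [← cols_sub, frob_cols_sq, Finset.mul_sum]
  refine Finset.sum_le_sum fun j _ => ?_
  rw [mul_comm]
  exact l2_curve_sub_col_le hD₀ hW v t j

lemma frob_curve_sub_le (hD₀ : D₀ ∈ unitDictionaries m p)
    (hW : W ∈ tangentDirections D₀) (hv : v ∈ unitSphere p) (ht : 0 ≤ t) :
    frob (curve D₀ W v t - D₀) ≤ t := by
  refine le_of_sq_le_sq ?_ ht
  rw [frob_sq_cols]
  refine (Finset.sum_le_sum fun j _ => l2_curve_sub_col_le hD₀ hW v t j).trans_eq ?_
  rw [← Finset.sum_mul, show ∑ j, v j ^ 2 = 1 from hv, one_mul]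

end Dictionary

/-! ### Averages over random supports -/

section Support

variable {p k : ℕ} {S : PMF (Finset (Fin p))}

lemma sum_toReal_eq_one (S : PMF (Finset (Fin p))) : ∑ J, (S J).toReal = 1 := by
  rw [← ENNReal.toReal_sum fun J _ => S.apply_ne_top J, ← tsum_fintype (L := .unconditional _),
    S.tsum_coe]
  simp

lemma IsSupportScheme.card_of_toReal_ne (hS : IsSupportScheme k S) {J : Finset (Fin p)}
    (h : (S J).toReal ≠ 0) : J.card = k :=
  hS.card_eq J fun h0 => h (by simp [h0])

lemma IsSupportScheme.le (hS : IsSupportScheme k S) : k ≤ p := by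
  by_contra! h
  have h0 : ∀ J, (S J).toReal = 0 := by
    intro J
    by_contra hJ
    have h1 := hS.card_of_toReal_ne hJ
    have h2 := J.card_le_univ
    simp at h2
    omega
  have := sum_toReal_eq_one S
  simp [h0] at this

lemma sum_ite_mul_comm (w : Finset (Fin p) → ℝ) (g : Finset (Fin p) → Fin p → ℝ) :
    ∑ J, w J * ∑ j ∈ J, g J j = ∑ j, ∑ J with j ∈ J, w J * g J j := by
  simp only [Finset.mul_sum, Finset.sum_filter]
  rw [Finset.sum_comm]
  refine Finset.sum_congr rfl fun J _ => ?_
  rw [Finset.sum_ite_mem, Finset.univ_inter]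

lemma IsSupportScheme.sum_sum_mem (hS : IsSupportScheme k S) (f : Fin p → ℝ) :
    ∑ J, (S J).toReal * ∑ j ∈ J, f j = (k : ℝ) / p * ∑ j, f j := by
  rw [sum_ite_mul_comm, Finset.mul_sum]
  refine Finset.sum_congr rfl fun j _ => ?_
  rw [← Finset.sum_mul, hS.prob_mem]

/-- Sampling without replacement is negatively correlated: (k - 1)/(p - 1) ≤ k/p because k ≤ p. -/
lemma IsSupportScheme.prob_pair_le (hS : IsSupportScheme k S) {i j : Fin p} (hij : i ≠ j) :
    ∑ J with i ∈ J ∧ j ∈ J, (S J).toReal ≤ ((k : ℝ) / p) ^ 2 := by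
  rw [hS.prob_mem_mem i j hij]
  have hkp : (k : ℝ) ≤ p := by exact_mod_cast hS.le
  have hp : (2 : ℝ) ≤ p := by
    have : 2 ≤ p := by
      have h1 := i.2
      have h2 := j.2
      have h3 : (i : ℕ) ≠ j := fun h => hij (Fin.ext h)
      omega
    exact_mod_cast this
  have hk : (0 : ℝ) ≤ k := by positivity
  rw [div_pow, div_le_div_iff₀ (by nlinarith) (by positivity)]
  have h1 : (k - 1 : ℝ) * p ≤ k * (p - 1) := by nlinarith
  nlinarith [mul_le_mul_of_nonneg_left h1 (mul_nonneg hk (by linarith : (0 : ℝ) ≤ p))]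

/-- For a nonnegative family vanishing at `j`. -/
lemma IsSupportScheme.sum_mem_sum_le (hS : IsSupportScheme k S) (j : Fin p) {y : Fin p → ℝ}
    (hy : ∀ i, 0 ≤ y i) (hj : y j = 0) :
    ∑ J with j ∈ J, (S J).toReal * ∑ i ∈ J, y i ≤ ((k : ℝ) / p) ^ 2 * ∑ i, y i := by
  have e : ∑ J with j ∈ J, (S J).toReal * ∑ i ∈ J, y i =
      ∑ i, (∑ J with i ∈ J ∧ j ∈ J, (S J).toReal) * y i := by
    have := sum_ite_mul_comm (fun J => if j ∈ J then (S J).toReal else 0) (fun _ i => y i)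
    rw [Finset.sum_filter]
    simp only [ite_mul, zero_mul] at this
    rw [this]
    refine Finset.sum_congr rfl fun i _ => ?_
    rw [Finset.sum_mul, ← Finset.sum_filter, Finset.filter_filter]
  rw [e, Finset.mul_sum]
  refine Finset.sum_le_sum fun i _ => ?_
  by_cases hij : i = j
  · simp [hij, hj]
  · exact mul_le_mul_of_nonneg_right (hS.prob_pair_le hij) (hy i)

/-- Weighted Cauchy–Schwarz, used as Jensen's inequality for averages over supports. -/
lemma sq_sum_mul_le {ι : Type*} (s : Finset ι) {w : ι → ℝ} (hw : ∀ i ∈ s, 0 ≤ w i) (x : ι → ℝ) :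
    (∑ i ∈ s, w i * x i) ^ 2 ≤ (∑ i ∈ s, w i) * ∑ i ∈ s, w i * x i ^ 2 :=
  Finset.sum_sq_le_sum_mul_sum_of_sq_le_mul s hw
    (fun i hi => mul_nonneg (hw i hi) (sq_nonneg _)) fun i _ => (by ring : _ = _).le

end Support

/-! ### Residual energies -/

section Residual

variable {ι κ : Type*} [Fintype ι] [Fintype κ] [DecidableEq ι]

/-- The squared distance from `y` to the range of `A`. -/
noncomputable def residual (A : Matrix κ ι ℝ) (y : κ → ℝ) : ℝ :=
  l2 y ^ 2 - (Aᵀ *ᵥ y) ⬝ᵥ ((Aᵀ * A)⁻¹ *ᵥ (Aᵀ *ᵥ y))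

/-- The residual is twice the optimal value of unpenalized least squares, that is, λ = 0. -/
lemma residual_nonneg {A : Matrix κ ι ℝ} (hA : IsUnit (Aᵀ * A).det) (y : κ → ℝ) :
    0 ≤ residual A y := by
  have h := objective_minimizer (lam := 0) (x := y) (s := 0) hA
  have h1 : objective 0 y A 0 (minimizer 0 y A 0) =
      1 / 2 * l2 (y - A *ᵥ minimizer 0 y A 0) ^ 2 := by simp [objective]
  have h2 : closedForm 0 y A 0 = 1 / 2 * residual A y := by simp [closedForm, corr, residual]
  rw [h1, h2] at h
  nlinarith [sq_nonneg (l2 (y - A *ᵥ minimizer 0 y A 0))]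

lemma residual_smul (A : Matrix κ ι ℝ) (c : ℝ) (y : κ → ℝ) :
    residual A (c • y) = c ^ 2 * residual A y := by
  simp only [residual, l2_sq_dot, Matrix.mulVec_smul, dotProduct_smul, smul_dotProduct, smul_eq_mul]
  ring

lemma inv_gram_transpose (A : Matrix κ ι ℝ) : ((Aᵀ * A)⁻¹)ᵀ = (Aᵀ * A)⁻¹ := by
  rw [Matrix.transpose_nonsing_inv, Matrix.transpose_mul, Matrix.transpose_transpose]

/-- The residual sees only the component orthogonal to the range of A. It allows the part of an atom
already in the span of the perturbed columns to be dropped. -/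
lemma residual_add_mulVec {A : Matrix κ ι ℝ} (hA : IsUnit (Aᵀ * A).det) (z : ι → ℝ) (y : κ → ℝ) :
    residual A (A *ᵥ z + y) = residual A y := by
  have h1 : (Aᵀ * A)⁻¹ *ᵥ (Aᵀ *ᵥ (A *ᵥ z)) = z := by
    rw [Matrix.mulVec_mulVec, Matrix.mulVec_mulVec, Matrix.mul_assoc, Matrix.nonsing_inv_mul _ hA,
      Matrix.one_mulVec]
  have h2 : (Aᵀ *ᵥ (A *ᵥ z)) ⬝ᵥ ((Aᵀ * A)⁻¹ *ᵥ (Aᵀ *ᵥ y)) = z ⬝ᵥ (Aᵀ *ᵥ y) := by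
    rw [dotProduct_mulVec_eq, inv_gram_transpose, h1]
  have h3 : l2 (A *ᵥ z) ^ 2 = (Aᵀ *ᵥ (A *ᵥ z)) ⬝ᵥ z := by
    rw [← dotProduct_mulVec_eq, l2_sq_dot]
  have h4 : (A *ᵥ z) ⬝ᵥ y = z ⬝ᵥ (Aᵀ *ᵥ y) := by
    rw [dotProduct_comm, dotProduct_mulVec_eq, dotProduct_comm]
  rw [residual, residual, l2_add_sq, Matrix.mulVec_add, Matrix.mulVec_add, h1, add_dotProduct,
    dotProduct_add, dotProduct_add, h2, h3, h4, dotProduct_comm (Aᵀ *ᵥ y) z]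
  ring

/-- A lower bound for residuals by the correlation with the columns. -/
lemma le_residual {A : Matrix κ ι ℝ} {c : ℝ} (hc : 0 < c) (hA : ∀ z, c * l2 z ≤ l2 (A *ᵥ z))
    (y : κ → ℝ) : l2 y ^ 2 - (1 / c * l2 (Aᵀ *ᵥ y)) ^ 2 ≤ residual A y := by
  have hu : IsUnit (Aᵀ * A).det := by
    refine LowerBounded.isUnit_det (β := c ^ 2) (by positivity) fun z => ?_
    rw [← mul_pow]
    exact pow_le_pow_left₀ (mul_nonneg hc.le (l2_nonneg z)) (hA z) 2
  set u := Aᵀ *ᵥ y with hu'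
  set z := (Aᵀ * A)⁻¹ *ᵥ u with hz
  -- The vector Az is the orthogonal projection of y, so this is the energy that the residual loses.
  have h1 : l2 (A *ᵥ z) ^ 2 = u ⬝ᵥ z := by
    rw [l2_sq_dot, dotProduct_mulVec_eq, Matrix.mulVec_mulVec, hz, Matrix.mulVec_mulVec,
      Matrix.mul_nonsing_inv _ hu, Matrix.one_mulVec]
  have h2 := dotProduct_le_l2 u z
  have h3 := hA z
  have h4 : l2 z ≤ 1 / c * l2 (A *ᵥ z) := by
    rw [div_mul_eq_mul_div, one_mul, le_div_iff₀ hc]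
    linarith
  have h5 : l2 (A *ᵥ z) ≤ 1 / c * l2 u := by
    by_contra! h
    have h0 : 0 < l2 (A *ᵥ z) := lt_of_le_of_lt (mul_nonneg (by positivity) (l2_nonneg u)) h
    have h6 := mul_le_mul_of_nonneg_left h4 (l2_nonneg u)
    nlinarith [mul_lt_mul_of_pos_right h h0]
  have h6 := pow_le_pow_left₀ (l2_nonneg _) h5 2
  rw [residual, ← hu', ← hz, ← h1]
  linarith

end Residual

/-! ### Averages of the trace terms -/

section Averages

variable {m p k : ℕ} {D₀ W : Matrix (Fin m) (Fin p) ℝ} {v : Fin p → ℝ} {t : ℝ}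
  {S : PMF (Finset (Fin p))}

/-- By Jensen it suffices to average the squared norm. An off-diagonal entry of D₀ᵀΔ is kept with
probability at most (k/p)², so the root mean square is k/p times the full norm, and that is at most
‖D₀‖ ‖Δ‖. -/
lemma sum_offDiag_le (hS : IsSupportScheme k S) (D₀ Δ : Matrix (Fin m) (Fin p) ℝ) :
    ∑ J, (S J).toReal * frob (offDiag ((cols D₀ J)ᵀ * cols Δ J)) ≤
      (k : ℝ) / p * (spectralNorm D₀ * frob Δ) := by
  have hX : frob (D₀ᵀ * Δ) ≤ spectralNorm D₀ * frob Δ :=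
    frob_mul_le_of (spectralNorm_nonneg D₀) (l2_transpose_mulVec_le_spectralNorm D₀) Δ
  refine le_of_sq_le_sq ?_ (mul_nonneg (by positivity)
    (mul_nonneg (spectralNorm_nonneg D₀) (frob_nonneg Δ)))
  refine (sq_sum_mul_le Finset.univ (fun J _ => ENNReal.toReal_nonneg) _).trans ?_
  rw [sum_toReal_eq_one, one_mul]
  let y : Fin p → Fin p → ℝ := fun j i => if i = j then 0 else (D₀ᵀ * Δ) i j ^ 2
  have e : ∀ J : Finset (Fin p), frob (offDiag ((cols D₀ J)ᵀ * cols Δ J)) ^ 2 =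
      ∑ j ∈ J, ∑ i ∈ J, y j i := by
    intro J
    rw [frob_sq', ← Finset.sum_coe_sort J (fun j => ∑ i ∈ J, y j i)]
    refine Finset.sum_congr rfl fun j _ => ?_
    rw [← Finset.sum_coe_sort J (fun i => y j i)]
    refine Finset.sum_congr rfl fun i _ => ?_
    by_cases h : i = j
    · simp [offDiag, y, h]
    · have h' : (i : Fin p) ≠ j := fun h' => h (Subtype.ext h')
      simp only [offDiag, y, h, h', if_false, Matrix.of_apply]
      rfl
  simp only [e]
  rw [sum_ite_mul_comm (fun J => (S J).toReal) (fun J j => ∑ i ∈ J, y j i)]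
  have h1 : ∀ j, ∑ J with j ∈ J, (S J).toReal * ∑ i ∈ J, y j i ≤
      ((k : ℝ) / p) ^ 2 * ∑ i, (D₀ᵀ * Δ) i j ^ 2 := by
    intro j
    refine (hS.sum_mem_sum_le j (fun i => ?_) (by simp [y])).trans ?_
    · by_cases h : i = j <;> simp [y, h, sq_nonneg]
    · refine mul_le_mul_of_nonneg_left (Finset.sum_le_sum fun i _ => ?_) (by positivity)
      by_cases h : i = j <;> simp [y, h, sq_nonneg]
  refine (Finset.sum_le_sum fun j _ => h1 j).trans ?_
  rw [← Finset.mul_sum, ← frob_sq', mul_pow]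
  exact mul_le_mul_of_nonneg_left (pow_le_pow_left₀ (frob_nonneg _) hX 2) (by positivity)

/-- Columns of the base dictionary, seen from the curve. -/
lemma residual_curve (W : Matrix (Fin m) (Fin p) ℝ) {J : Finset (Fin p)}
    (hu : IsUnit ((cols (curve D₀ W v t) J)ᵀ * cols (curve D₀ W v t) J).det) {j : Fin p}
    (hj : j ∈ J) (hc : Real.cos (v j * t) ≠ 0) :
    residual (cols (curve D₀ W v t) J) (fun l => D₀ l j) =
      Real.tan (v j * t) ^ 2 * residual (cols (curve D₀ W v t) J) fun l => W l j := by
  set A := cols (curve D₀ W v t) J with hA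
  -- The definition of the curve, column = cos · d + sin · w, solved for d; the first term lies in
  -- the range of A.
  have e : (fun l => D₀ l j) =
      A *ᵥ ((1 / Real.cos (v j * t)) • Pi.single ⟨j, hj⟩ 1) +
        (-Real.tan (v j * t)) • fun l => W l j := by
    funext l
    rw [Matrix.mulVec_smul]
    simp only [Matrix.mulVec_single, Pi.add_apply, Pi.smul_apply, hA, cols, curve_apply,
      Matrix.col, Matrix.submatrix_apply, Matrix.transpose_apply, id, smul_eq_mul,
      Real.tan_eq_sin_div_cos, MulOpposite.smul_eq_mul_unop, MulOpposite.unop_op, mul_one]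
    field_simp
    ring
  rw [e, residual_add_mulVec hu, residual_smul]
  ring

lemma sq_le_tan_sq {x : ℝ} (hx : |x| < Real.pi / 2) : x ^ 2 ≤ Real.tan x ^ 2 := by
  have h : |x| ≤ Real.tan |x| := Real.le_tan (abs_nonneg x) hx
  have h2 : Real.tan |x| ^ 2 = Real.tan x ^ 2 := by
    rcases abs_choice x with h | h <;> rw [h]
    rw [Real.tan_neg]
    ring
  rw [← h2, ← sq_abs]
  exact pow_le_pow_left₀ (abs_nonneg x) h 2

/-- Average over the supports containing `j` of the correlation of `w` with the other atoms. -/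
lemma sum_mem_corr_le (hS : IsSupportScheme k S) (D₀ : Matrix (Fin m) (Fin p) ℝ) (j : Fin p)
    {w : Fin m → ℝ} (hw : ∑ l, w l ^ 2 = 1) (hwj : ∑ l, w l * D₀ l j = 0) (ht : 0 ≤ t) :
    ∑ J with j ∈ J, (S J).toReal * (l2 ((cols D₀ J)ᵀ *ᵥ w) + t) ^ 2 ≤
      (k : ℝ) / p * (spectralNorm D₀ * √((k : ℝ) / p) + t) ^ 2 := by
  set P : ℝ := (k : ℝ) / p with hP
  have hP0 : 0 ≤ P := by positivity
  have hw1 : l2 w = 1 := (sq_eq_sq₀ (l2_nonneg _) zero_le_one).1 (by rw [l2_sq, hw, one_pow])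
  have hn := spectralNorm_nonneg D₀
  let x : Finset (Fin p) → ℝ := fun J => l2 ((cols D₀ J)ᵀ *ᵥ w)
  have hx2 : ∑ J with j ∈ J, (S J).toReal * x J ^ 2 ≤ P * (spectralNorm D₀ * √P) ^ 2 := by
    have e : ∀ J, x J ^ 2 = ∑ i ∈ J, (D₀ᵀ *ᵥ w) i ^ 2 := by
      intro J
      simp only [x]
      rw [l2_sq, ← Finset.sum_coe_sort J (fun i => (D₀ᵀ *ᵥ w) i ^ 2)]
      rfl
    simp only [e]
    -- Orthogonality of w to atom j removes the index i = j, whose inclusion probability given j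
    -- would be 1; the other pairs have probability at most (k/p)².
    refine (hS.sum_mem_sum_le j (fun i => sq_nonneg _) ?_).trans ?_
    · have : (D₀ᵀ *ᵥ w) j = ∑ l, w l * D₀ l j := by
        simp [Matrix.mulVec, dotProduct, mul_comm]
      rw [this, hwj]
      simp
    · rw [← l2_sq, mul_pow, Real.sq_sqrt hP0, ← hP, mul_comm (_ ^ 2) P, ← mul_assoc, ← sq]
      refine mul_le_mul_of_nonneg_left ?_ (by positivity)
      have := l2_transpose_mulVec_le_spectralNorm D₀ w
      rw [hw1, mul_one] at this
      exact pow_le_pow_left₀ (l2_nonneg _) this 2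
  have hx1 : ∑ J with j ∈ J, (S J).toReal * x J ≤ P * (spectralNorm D₀ * √P) := by
    refine le_of_sq_le_sq ?_ (by positivity)
    refine (sq_sum_mul_le _ (fun J _ => ENNReal.toReal_nonneg) _).trans ?_
    rw [hS.prob_mem j, ← hP]
    refine (mul_le_mul_of_nonneg_left hx2 hP0).trans_eq ?_
    ring
  have e2 : ∑ J with j ∈ J, (S J).toReal * (x J + t) ^ 2 =
      ∑ J with j ∈ J, (S J).toReal * x J ^ 2 + 2 * t * ∑ J with j ∈ J, (S J).toReal * x J +
        t ^ 2 * ∑ J with j ∈ J, (S J).toReal := by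
    rw [Finset.mul_sum, Finset.mul_sum, ← Finset.sum_add_distrib, ← Finset.sum_add_distrib]
    refine Finset.sum_congr rfl fun J _ => ?_
    ring
  change ∑ J with j ∈ J, (S J).toReal * (x J + t) ^ 2 ≤ _
  rw [e2, hS.prob_mem j, ← hP]
  nlinarith [mul_le_mul_of_nonneg_left hx1 ht]

/-! ### Lower bound for the expected increment -/

/-- The standing assumptions on the parameters. -/
structure Admissible (k : ℕ) (D₀ : Matrix (Fin m) (Fin p) ℝ) (t : ℝ) : Prop where
  unit : D₀ ∈ unitDictionaries m p
  k_pos : 0 < k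
  nonneg : 0 ≤ t
  small : k * coherenceAt D₀ t ≤ 1 / 2

lemma Admissible.one_le_k (h : Admissible k D₀ t) : (1 : ℝ) ≤ k := by exact_mod_cast h.k_pos

lemma Admissible.k_mul_t_le (_h : Admissible k D₀ t) : 3 * (k * t) ≤ k * coherenceAt D₀ t := by
  rw [coherenceAt]
  have := mul_nonneg k.cast_nonneg (coherence_nonneg D₀)
  linarith

lemma Admissible.t_le (h : Admissible k D₀ t) : t ≤ 1 / 6 := by
  have h1 := h.k_mul_t_le
  have h2 := h.small
  nlinarith [h.one_le_k, h.nonneg]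

lemma Admissible.near_base (h : Admissible k D₀ t) {J : Finset (Fin p)} (hJ : J.card = k) :
    NearIsometry (k * coherenceAt D₀ t) (cols D₀ J) :=
  nearIsometry_base h.unit h.nonneg hJ

lemma Admissible.near_curve (h : Admissible k D₀ t) (hW : W ∈ tangentDirections D₀)
    (hv : v ∈ unitSphere p) {J : Finset (Fin p)} (hJ : J.card = k) :
    NearIsometry (k * coherenceAt D₀ t) (cols (curve D₀ W v t) J) :=
  nearIsometry_curve h.unit hW hv h.nonneg (by linarith [h.t_le]) hJ

/-- Since δ_k ≤ kμ(t) ≤ 1/2, the root is at least 1/2, while t ≤ 1/6. Thus C_t is a genuine positive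
constant. -/
lemma Admissible.sqrt_rip_sub_pos (h : Admissible k D₀ t) :
    0 < √(1 - ripConstant k D₀) - t := by
  have h1 : ripConstant k D₀ ≤ k * coherenceAt D₀ t :=
    ripConstant_le (by nlinarith [h.k_mul_t_le, h.nonneg, h.one_le_k]) fun J hJ => h.near_base hJ
  have h2 : (1 / 2 : ℝ) ≤ √(1 - ripConstant k D₀) := by
    refine Real.le_sqrt_of_sq_le ?_
    linarith [h.small]
  linarith [h.t_le]

/-- The restricted isometry bound for `D₀`, perturbed by a matrix of Frobenius norm at most t. -/
lemma Admissible.curve_lower (h : Admissible k D₀ t) (hW : W ∈ tangentDirections D₀)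
    (hv : v ∈ unitSphere p) {J : Finset (Fin p)} (hJ : J.card = k) (z : J → ℝ) :
    (√(1 - ripConstant k D₀) - t) * l2 z ≤ l2 (cols (curve D₀ W v t) J *ᵥ z) := by
  have hη : 0 ≤ k * coherenceAt D₀ t := by nlinarith [h.k_mul_t_le, h.nonneg, h.one_le_k]
  have h1 := ripConstant_lower hη (fun J hJ => h.near_base hJ) hJ z
  have h2 : √(1 - ripConstant k D₀) * l2 z ≤ l2 (cols D₀ J *ᵥ z) := by
    refine le_of_sq_le_sq ?_ (l2_nonneg _)
    have : 0 ≤ 1 - ripConstant k D₀ := by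
      have := ripConstant_le hη fun J hJ => h.near_base hJ
      linarith [h.small]
    rw [mul_pow, Real.sq_sqrt this]
    exact h1
  have h3 : l2 ((cols (curve D₀ W v t) J - cols D₀ J) *ᵥ z) ≤ t * l2 z := by
    refine (l2_mulVec_le _ _).trans (mul_le_mul_of_nonneg_right ?_ (l2_nonneg z))
    rw [← cols_sub]
    exact (frob_cols_le _ _).trans (frob_curve_sub_le h.unit hW hv h.nonneg)
  have h4 : cols D₀ J *ᵥ z = cols (curve D₀ W v t) J *ᵥ z -
      (cols (curve D₀ W v t) J - cols D₀ J) *ᵥ z := by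
    rw [Matrix.sub_mulVec]
    abel
  have h5 := l2_sub_le (cols (curve D₀ W v t) J *ᵥ z) ((cols (curve D₀ W v t) J - cols D₀ J) *ᵥ z)
  rw [← h4] at h5
  linarith

/-- The residual energy of the base dictionary, on average over the supports. -/
lemma Admissible.le_sum_residual (h : Admissible k D₀ t) (hS : IsSupportScheme k S)
    (hW : W ∈ tangentDirections D₀) (hv : v ∈ unitSphere p) :
    (1 - constK k D₀ t ^ 2) * ((k : ℝ) / p) * t ^ 2 ≤
      ∑ J, (S J).toReal * ∑ j ∈ J, residual (cols (curve D₀ W v t) J) fun l => D₀ l j := by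
  set P : ℝ := (k : ℝ) / p with hP
  have hP0 : 0 ≤ P := by positivity
  have hnn : ∀ J j, 0 ≤ (S J).toReal * residual (cols (curve D₀ W v t) J) fun l => D₀ l j := by
    intro J j
    by_cases hJ : (S J).toReal = 0
    · rw [hJ, zero_mul]
    · refine mul_nonneg ENNReal.toReal_nonneg (residual_nonneg ?_ _)
      exact ((h.near_curve hW hv (hS.card_of_toReal_ne hJ)).wellConditioned h.small).isUnit_det
  -- If 1 - 𝒦² ≤ 0 the claim follows from nonnegativity of residuals. Otherwise the factor is
  -- positive, as needed to replace tan² by the smaller square of its argument.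
  by_cases hK : 1 - constK k D₀ t ^ 2 ≤ 0
  · refine le_trans (mul_nonpos_of_nonpos_of_nonneg
      (mul_nonpos_of_nonpos_of_nonneg hK hP0) (sq_nonneg t)) (Finset.sum_nonneg fun J _ => ?_)
    rw [Finset.mul_sum]
    exact Finset.sum_nonneg fun j _ => hnn J j
  push Not at hK
  set c := √(1 - ripConstant k D₀) - t with hc
  have hc0 : 0 < c := h.sqrt_rip_sub_pos
  have hvt : ∀ j, |v j * t| ≤ t := fun j => by
    rw [abs_mul, abs_of_nonneg h.nonneg]
    exact mul_le_of_le_one_left h.nonneg (abs_le_one_of_mem_unitSphere hv j)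
  have hpi : ∀ j, |v j * t| < Real.pi / 2 := fun j => by
    linarith [hvt j, h.t_le, Real.pi_gt_three]
  have key : ∀ j, (1 - constK k D₀ t ^ 2) * P * (v j ^ 2 * t ^ 2) ≤
      ∑ J with j ∈ J, (S J).toReal * residual (cols (curve D₀ W v t) J) fun l => D₀ l j := by
    intro j
    have hcos : Real.cos (v j * t) ≠ 0 :=
      (Real.cos_pos_of_mem_Ioo (abs_lt.1 (hpi j))).ne'
    have hw1 : l2 (fun l => W l j) = 1 :=
      (sq_eq_sq₀ (l2_nonneg _) zero_le_one).1 (by rw [l2_sq, hW.2 j, one_pow])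
    have h1 : ∀ J ∈ Finset.univ.filter (fun J : Finset (Fin p) => j ∈ J),
        Real.tan (v j * t) ^ 2 * ((S J).toReal - (1 / c) ^ 2 *
          ((S J).toReal * (l2 ((cols D₀ J)ᵀ *ᵥ fun l => W l j) + t) ^ 2)) ≤
        (S J).toReal * residual (cols (curve D₀ W v t) J) fun l => D₀ l j := by
      intro J hJ
      have hjJ : j ∈ J := (Finset.mem_filter.1 hJ).2
      by_cases h0 : (S J).toReal = 0
      · simp [h0]
      have hcard := hS.card_of_toReal_ne h0
      have hu := ((h.near_curve hW hv hcard).wellConditioned h.small).isUnit_det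
      have h2 := le_residual hc0 (h.curve_lower hW hv hcard) fun l => W l j
      rw [hw1, one_pow] at h2
      have h3 : l2 ((cols (curve D₀ W v t) J)ᵀ *ᵥ fun l => W l j) ≤
          l2 ((cols D₀ J)ᵀ *ᵥ fun l => W l j) + t := by
        have e : (cols (curve D₀ W v t) J)ᵀ *ᵥ (fun l => W l j) =
            (cols D₀ J)ᵀ *ᵥ (fun l => W l j) +
              (cols (curve D₀ W v t - D₀) J)ᵀ *ᵥ fun l => W l j := by
          rw [← Matrix.add_mulVec, ← Matrix.transpose_add, cols_sub]
          congr 2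
          abel
        rw [e]
        refine (l2_add_le _ _).trans (add_le_add le_rfl ?_)
        refine (l2_mulVec_le _ _).trans ?_
        rw [hw1, mul_one, frob_transpose]
        exact (frob_cols_le _ _).trans (frob_curve_sub_le h.unit hW hv h.nonneg)
      have h4 : (1 / c * l2 ((cols (curve D₀ W v t) J)ᵀ *ᵥ fun l => W l j)) ^ 2 ≤
          (1 / c) ^ 2 * (l2 ((cols D₀ J)ᵀ *ᵥ fun l => W l j) + t) ^ 2 := by
        rw [mul_pow]
        exact mul_le_mul_of_nonneg_left (pow_le_pow_left₀ (l2_nonneg _) h3 2) (by positivity)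
      rw [residual_curve W hu hjJ hcos]
      have h5 : 1 - (1 / c) ^ 2 * (l2 ((cols D₀ J)ᵀ *ᵥ fun l => W l j) + t) ^ 2 ≤
        residual (cols (curve D₀ W v t) J) fun l => W l j := by linarith
      have h6 := mul_le_mul_of_nonneg_left h5
        (mul_nonneg (sq_nonneg (Real.tan (v j * t))) (ENNReal.toReal_nonneg (a := S J)))
      linarith
    refine le_trans ?_ (Finset.sum_le_sum h1)
    rw [← Finset.mul_sum, Finset.sum_sub_distrib, ← Finset.mul_sum, hS.prob_mem j, ← hP]
    have h7 := sum_mem_corr_le hS D₀ j (hW.2 j) (hW.1 j) h.nonneg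
    rw [← hP] at h7
    have h8 : (1 - constK k D₀ t ^ 2) * P ≤ P - (1 / c) ^ 2 *
        ∑ J with j ∈ J, (S J).toReal * (l2 ((cols D₀ J)ᵀ *ᵥ fun l => W l j) + t) ^ 2 := by
      have e : constK k D₀ t ^ 2 * P =
          (1 / c) ^ 2 * (P * (spectralNorm D₀ * √P + t) ^ 2) := by
        rw [constK, constC, mul_pow]
        ring
      have := mul_le_mul_of_nonneg_left h7 (sq_nonneg (1 / c))
      linarith
    have h9 := sq_le_tan_sq (hpi j)
    rw [mul_pow] at h9
    rw [mul_comm]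
    exact mul_le_mul h9 h8 (mul_nonneg hK.le hP0) (sq_nonneg _)
  rw [sum_ite_mul_comm (fun J => (S J).toReal)
    (fun J j => residual (cols (curve D₀ W v t) J) fun l => D₀ l j)]
  refine le_trans (le_of_eq ?_) (Finset.sum_le_sum fun j _ => key j)
  rw [← Finset.mul_sum, ← Finset.sum_mul, show ∑ j, v j ^ 2 = 1 from hv, one_mul]

/-- The conditional expectation, given the support `J`, of the increment of the surrogate. -/
noncomputable def condIncrement (lam a₁ a₂ : ℝ) (D₀ D : Matrix (Fin m) (Fin p) ℝ)
    (J : Finset (Fin p)) : ℝ :=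
  1 / 2 * (a₂ * ∑ j ∈ J, residual (cols D J) (fun l => D₀ l j) +
    2 * lam * a₁ * ((((cols D J)ᵀ * cols D J)⁻¹ * ((cols D J)ᵀ * cols D₀ J)).trace - J.card) -
    lam ^ 2 * ((((cols D J)ᵀ * cols D J)⁻¹).trace - (((cols D₀ J)ᵀ * cols D₀ J)⁻¹).trace))

lemma Admissible.constQ_sq (h : Admissible k D₀ t) :
    constQ k D₀ t ^ 2 = 1 / (1 - k * coherenceAt D₀ t) := by
  rw [constQ, div_pow, one_pow, Real.sq_sqrt]
  linarith [h.small]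

/-- The expected increment along a curve. -/
theorem Admissible.le_sum_condIncrement (h : Admissible k D₀ t) (hS : IsSupportScheme k S)
    (hW : W ∈ tangentDirections D₀) (hv : v ∈ unitSphere p) {lam a₁ a₂ : ℝ} (hlam : 0 ≤ lam)
    (ha₁ : 0 ≤ a₁) (ha₂ : 0 ≤ a₂) :
    (1 - constK k D₀ t ^ 2) * (a₂ / 2) * ((k : ℝ) / p) * t ^ 2
    - constQ k D₀ t ^ 2 * t * ((k : ℝ) / p) * spectralNorm D₀ * (k * coherenceAt D₀ t) * lam *
        (4 * constQ k D₀ t ^ 2 * lam + 3 * a₁) ≤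
      ∑ J, (S J).toReal * condIncrement lam a₁ a₂ D₀ (curve D₀ W v t) J := by
  set D := curve D₀ W v t with hD
  set P : ℝ := (k : ℝ) / p with hP
  have hP0 : 0 ≤ P := by positivity
  rw [h.constQ_sq]
  set η := k * coherenceAt D₀ t with hη
  set q := 1 / (1 - η) with hq
  set V : Finset (Fin p) → ℝ := fun J => ∑ j ∈ J, v j ^ 2 with hV
  set N : Finset (Fin p) → ℝ := fun J => frob (offDiag ((cols D₀ J)ᵀ * cols (D - D₀) J)) with hN
  have hη0 : 0 ≤ η := by nlinarith [h.k_mul_t_le, h.nonneg, h.one_le_k]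
  have hηt : 3 * t ≤ η := by nlinarith [h.k_mul_t_le, h.nonneg, h.one_le_k]
  have hηs : η ≤ 1 / 2 := h.small
  have hq1 : 1 ≤ q := by
    rw [hq, le_div_iff₀ (by linarith)]
    linarith
  have ht := h.nonneg
  -- For each support, the trace terms are replaced by bounds linear in V (the mass of v² on J) and
  -- N (the off-diagonal norm), whose averages are known.
  have hJ : ∀ J, (S J).toReal * (1 / 2 * (a₂ * ∑ j ∈ J, residual (cols D J) (fun l => D₀ l j) -
      2 * lam * a₁ * (1 / 2 * (t ^ 2 * V J) + q * η * (N J + 3 / 2 * (t ^ 2 * V J))) -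
      lam ^ 2 * (2 * q ^ 2 * η * (2 * N J + t ^ 2 * V J)))) ≤
      (S J).toReal * condIncrement lam a₁ a₂ D₀ D J := by
    intro J
    by_cases h0 : (S J).toReal = 0
    · simp [h0]
    have hcard := hS.card_of_toReal_ne h0
    have hA₀ := h.near_base hcard
    have hA := h.near_curve hW hv hcard
    have hF := frob_cols_curve_sub_sq_le h.unit hW v t J
    have h1 := (abs_le.1 (hA₀.abs_trace_pinv_sub_le hA hηs)).1
    have h2 := (abs_le.1 (hA₀.abs_trace_inv_sub_le hA hηs)).2
    rw [Fintype.card_coe, ← hη, ← hq, ← hD] at h1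
    rw [← hη, ← hq, ← hD] at h2
    rw [← hD] at hF
    have hNe : frob (offDiag ((cols D₀ J)ᵀ * (cols D J - cols D₀ J))) = N J := rfl
    rw [hNe] at h1 h2
    refine mul_le_mul_of_nonneg_left ?_ ENNReal.toReal_nonneg
    rw [condIncrement]
    have hqη : 0 ≤ q * η := by positivity
    have h3 : -(1 / 2 * (t ^ 2 * V J) + q * η * (N J + 3 / 2 * (t ^ 2 * V J))) ≤
        (((cols D J)ᵀ * cols D J)⁻¹ * ((cols D J)ᵀ * cols D₀ J)).trace - J.card := by
      refine le_trans ?_ h1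
      have := mul_le_mul_of_nonneg_left hF hqη
      linarith
    have h4 : (((cols D J)ᵀ * cols D J)⁻¹).trace - (((cols D₀ J)ᵀ * cols D₀ J)⁻¹).trace ≤
        2 * q ^ 2 * η * (2 * N J + t ^ 2 * V J) := by
      refine h2.trans (mul_le_mul_of_nonneg_left ?_ (by positivity))
      linarith
    have h5 := mul_le_mul_of_nonneg_left h3 (by positivity : 0 ≤ 2 * lam * a₁)
    have h6 := mul_le_mul_of_nonneg_left h4 (sq_nonneg lam)
    linarith
  refine le_trans ?_ (Finset.sum_le_sum fun J _ => hJ J)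
  have sV : ∑ J, (S J).toReal * V J = P := by
    rw [hV, hS.sum_sum_mem, show ∑ j, v j ^ 2 = 1 from hv, mul_one]
  have hp : 0 < p := h.k_pos.trans_le hS.le
  have hn1 : 1 ≤ spectralNorm D₀ := one_le_spectralNorm h.unit hp
  set n0 := spectralNorm D₀ with hn0
  have sN : ∑ J, (S J).toReal * N J ≤ P * (n0 * t) := by
    refine (sum_offDiag_le hS D₀ (D - D₀)).trans (mul_le_mul_of_nonneg_left ?_ hP0)
    exact mul_le_mul_of_nonneg_left (frob_curve_sub_le h.unit hW hv ht) (by linarith)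
  have sR := h.le_sum_residual hS hW hv
  rw [← hP, ← hD] at sR
  have expand : ∑ J, (S J).toReal *
      (1 / 2 * (a₂ * ∑ j ∈ J, residual (cols D J) (fun l => D₀ l j) -
      2 * lam * a₁ * (1 / 2 * (t ^ 2 * V J) + q * η * (N J + 3 / 2 * (t ^ 2 * V J))) -
      lam ^ 2 * (2 * q ^ 2 * η * (2 * N J + t ^ 2 * V J)))) =
      a₂ / 2 * ∑ J, (S J).toReal * ∑ j ∈ J, residual (cols D J) (fun l => D₀ l j) -
      lam * a₁ * (1 / 2 * (t ^ 2 * ∑ J, (S J).toReal * V J) + q * η *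
        (∑ J, (S J).toReal * N J + 3 / 2 * (t ^ 2 * ∑ J, (S J).toReal * V J))) -
      lam ^ 2 * (q ^ 2 * η * (2 * ∑ J, (S J).toReal * N J +
        t ^ 2 * ∑ J, (S J).toReal * V J)) := by
    simp only [Finset.mul_sum (s := (Finset.univ : Finset (Finset (Fin p)))),
      ← Finset.sum_add_distrib, ← Finset.sum_sub_distrib]
    refine Finset.sum_congr rfl fun J _ => ?_
    ring
  rw [expand, sV]
  have hPn : P * t ^ 2 ≤ P * (n0 * t) * (1 / 6) := by
    have : t ^ 2 ≤ n0 * t * (1 / 6) := by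
      have := h.t_le
      nlinarith
    have := mul_le_mul_of_nonneg_left this hP0
    linarith
  -- The term t²/2 carries no factor η of its own; it is supplied by 3t ≤ η.
  have hPη : P * t ^ 2 ≤ P * (n0 * t) * (q * η) := by
    have h1 : t ≤ n0 * (q * η) := by
      have : η ≤ q * η := le_mul_of_one_le_left hη0 hq1
      have : q * η ≤ n0 * (q * η) := le_mul_of_one_le_left (by positivity) hn1
      linarith
    have := mul_le_mul_of_nonneg_left h1 (mul_nonneg hP0 ht)
    nlinarith
  -- In units of q t P n₀ η the three contributions are at most 1/2, 1 and 1/4, below 3; in the next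
  -- bound they total 2 + 1/6, below 4.
  have hb1 : 1 / 2 * (t ^ 2 * P) + q * η *
        (∑ J, (S J).toReal * N J + 3 / 2 * (t ^ 2 * P)) ≤ 3 * (q * t * P * n0 * η) := by
    have := mul_le_mul_of_nonneg_left
      (add_le_add sN (mul_le_mul_of_nonneg_left hPn (by norm_num : (0 : ℝ) ≤ 3 / 2)))
      (by positivity : 0 ≤ q * η)
    have h0 : 0 ≤ q * t * P * n0 * η := by positivity
    nlinarith
  have hb2 : q ^ 2 * η * (2 * ∑ J, (S J).toReal * N J + t ^ 2 * P) ≤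
      4 * (q ^ 2 * t * P * n0 * η) := by
    have := mul_le_mul_of_nonneg_left
      (add_le_add (mul_le_mul_of_nonneg_left sN (by norm_num : (0 : ℝ) ≤ 2)) hPn)
      (by positivity : 0 ≤ q ^ 2 * η)
    have h0 : 0 ≤ q ^ 2 * t * P * n0 * η := by positivity
    nlinarith
  have hc1 := mul_le_mul_of_nonneg_left hb1 (by positivity : 0 ≤ lam * a₁)
  have hc2 := mul_le_mul_of_nonneg_left hb2 (sq_nonneg lam)
  have hc3 := mul_le_mul_of_nonneg_left sR (by positivity : 0 ≤ a₂ / 2)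
  linarith

end Averages

/-! ### Sub-Gaussian and sub-exponential variables -/

section Concentration

/-- The moment generating function and its Gaussian bound agree at 0, so their difference has a
minimum there and the derivatives coincide; that of the bound vanishes. -/
lemma _root_.ProbabilityTheory.HasSubgaussianMGF.integral_eq_zero {Ω : Type*} [MeasurableSpace Ω]
    {μ : Measure Ω} [IsProbabilityMeasure μ] {X : Ω → ℝ} {c : ℝ≥0} (h : HasSubgaussianMGF X c μ) :
    ∫ ω, X ω ∂μ = 0 := by
  have h1 : HasDerivAt (mgf X μ) (∫ ω, X ω ∂μ) 0 := by
    have := hasDerivAt_mgf (X := X) (μ := μ) (t := 0) (by simp [h.integrableExpSet_eq_univ])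
    simpa using this
  have h2 : HasDerivAt (fun u : ℝ => Real.exp (c * u ^ 2 / 2)) 0 0 := by
    have : HasDerivAt (fun u : ℝ => (c : ℝ) * u ^ 2 / 2) 0 0 := by
      have := ((hasDerivAt_id (0 : ℝ)).pow 2).const_mul (c : ℝ) |>.div_const 2
      simpa using this
    simpa using this.exp
  have h3 : IsLocalMin (fun u : ℝ => Real.exp (c * u ^ 2 / 2) - mgf X μ u) 0 := by
    refine Filter.Eventually.of_forall fun u => ?_
    have := h.mgf_le u
    simp
    linarith
  have := h3.hasDerivAt_eq_zero (h2.sub h1)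
  linarith

lemma lintegral_exp_sq_div_four_gaussian :
    ∫⁻ y, ENNReal.ofReal (Real.exp (y ^ 2 / 4)) ∂(gaussianReal 0 1) = ENNReal.ofReal √2 := by
  rw [gaussianReal_of_var_ne_zero 0 one_ne_zero,
    lintegral_withDensity_eq_lintegral_mul _ (measurable_gaussianPDF 0 1) (by fun_prop)]
  have e : ∀ y : ℝ, (gaussianPDF 0 1 * fun y => ENNReal.ofReal (Real.exp (y ^ 2 / 4))) y =
      ENNReal.ofReal ((√(2 * Real.pi))⁻¹ * Real.exp (-(1 / 4) * y ^ 2)) := by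
    intro y
    rw [Pi.mul_apply, gaussianPDF, ← ENNReal.ofReal_mul (gaussianPDFReal_nonneg _ _ _),
      gaussianPDFReal, mul_assoc, ← Real.exp_add]
    congr 2
    · simp
    · congr 1
      simp
      ring
  simp only [e]
  rw [← ofReal_integral_eq_lintegral_ofReal
    ((integrable_exp_neg_mul_sq (by norm_num : (0 : ℝ) < 1 / 4)).const_mul _)
    (Filter.Eventually.of_forall fun y => by positivity), integral_const_mul, integral_gaussian]
  congr 1
  rw [inv_mul_eq_div, ← Real.sqrt_div (by positivity)]
  congr 1
  field_simp
  norm_num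

/-- Exponential square moment of a sub-Gaussian law. -/
lemma exp_sq_of_subgaussian {ν : Measure ℝ} [IsProbabilityMeasure ν] {c : ℝ≥0}
    (h : HasSubgaussianMGF id c ν) :
    Integrable (fun x => Real.exp (x ^ 2 / (4 * c))) ν ∧
      ∫ x, Real.exp (x ^ 2 / (4 * c)) ∂ν ≤ √2 := by
  -- For c = 0 division by zero makes the exponent 0, so the integral is 1.
  rcases eq_or_ne c 0 with rfl | hc
  · simp only [NNReal.coe_zero, mul_zero, div_zero, Real.exp_zero, integrable_const,
      integral_const, probReal_univ, smul_eq_mul, mul_one, true_and]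
    exact Real.one_le_sqrt.2 (by norm_num)
  have hc' : (0 : ℝ) < c := by positivity
  set r : ℝ := √(2 * c) with hr
  have hr2 : r ^ 2 = 2 * c := Real.sq_sqrt (by positivity)
  have hr0 : 0 < r := Real.sqrt_pos.2 (by positivity)
  -- Gaussian linearization: exp(x²/(4c)) is the mean of exp(xy/r) over a standard Gaussian y, with
  -- r² = 2c. After Tonelli, the sub-Gaussian bound in x leaves the Gaussian mean of exp(y²/4),
  -- equal to √2.
  have h1 : ∀ x : ℝ, ENNReal.ofReal (Real.exp (x ^ 2 / (4 * c))) =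
      ∫⁻ y, ENNReal.ofReal (Real.exp (x / r * y)) ∂(gaussianReal 0 1) := by
    intro x
    rw [← ofReal_integral_eq_lintegral_ofReal (integrable_exp_mul_gaussianReal (x / r))
      (Filter.Eventually.of_forall fun y => (Real.exp_pos _).le)]
    have := congrFun (mgf_id_gaussianReal (μ := 0) (v := 1)) (x / r)
    simp only [mgf, id] at this
    rw [this, div_pow, hr2]
    congr 2
    simp
    field_simp
    norm_num
  have h2 : ∀ y : ℝ, ∫⁻ x, ENNReal.ofReal (Real.exp (x / r * y)) ∂ν ≤
      ENNReal.ofReal (Real.exp (y ^ 2 / 4)) := by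
    intro y
    have e : ∀ x : ℝ, x / r * y = y / r * id x := fun x => by
      simp only [id]
      ring
    simp only [e]
    rw [← ofReal_integral_eq_lintegral_ofReal (h.integrable_exp_mul (y / r))
      (Filter.Eventually.of_forall fun y => (Real.exp_pos _).le)]
    refine ENNReal.ofReal_le_ofReal ((h.mgf_le (y / r)).trans_eq ?_)
    rw [div_pow, hr2]
    congr 1
    field_simp
    norm_num
  have h3 : ∫⁻ x, ENNReal.ofReal (Real.exp (x ^ 2 / (4 * c))) ∂ν ≤ ENNReal.ofReal √2 := by
    simp only [h1]
    rw [lintegral_lintegral_swap (by fun_prop)]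
    exact (lintegral_mono h2).trans_eq lintegral_exp_sq_div_four_gaussian
  have h4 : Integrable (fun x => Real.exp (x ^ 2 / (4 * c))) ν := by
    refine ⟨by fun_prop, ?_⟩
    rw [hasFiniteIntegral_iff_ofReal (Filter.Eventually.of_forall fun y => (Real.exp_pos _).le)]
    exact h3.trans_lt ENNReal.ofReal_lt_top
  refine ⟨h4, ?_⟩
  rw [← ofReal_integral_eq_lintegral_ofReal h4
    (Filter.Eventually.of_forall fun y => (Real.exp_pos _).le)] at h3
  exact (ENNReal.ofReal_le_ofReal_iff (by positivity)).1 h3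

/-- Exponential moments of convex combinations. -/
lemma exp_convex_combination {Ω κ : Type*} [MeasurableSpace Ω] {Q : Measure Ω} [Fintype κ]
    {w : κ → ℝ} (hw : ∀ q, 0 ≤ w q) (hw1 : ∑ q, w q = 1) {X : κ → Ω → ℝ} {M : ℝ}
    (hX : ∀ q, Integrable (fun ω => Real.exp (X q ω)) Q) (hM : ∀ q, ∫ ω, Real.exp (X q ω) ∂Q ≤ M) :
    Integrable (fun ω => Real.exp (∑ q, w q * X q ω)) Q ∧
      ∫ ω, Real.exp (∑ q, w q * X q ω) ∂Q ≤ M := by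
  have hle : ∀ ω, Real.exp (∑ q, w q * X q ω) ≤ ∑ q, w q * Real.exp (X q ω) := by
    intro ω
    have := convexOn_exp.map_sum_le (t := Finset.univ) (w := w) (p := fun q => X q ω)
      (fun q _ => hw q) hw1 (fun q _ => Set.mem_univ _)
    simpa using this
  have hint : Integrable (fun ω => ∑ q, w q * Real.exp (X q ω)) Q :=
    integrable_finsetSum _ fun q _ => (hX q).const_mul (w q)
  have hmeas : AEMeasurable (fun ω => Real.exp (∑ q, w q * X q ω)) Q := by
    refine Real.measurable_exp.comp_aemeasurable (Finset.aemeasurable_fun_sum _ fun q _ => ?_)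
    exact (Real.aemeasurable_of_aemeasurable_exp (hX q).aestronglyMeasurable.aemeasurable).const_mul _
  have hI : Integrable (fun ω => Real.exp (∑ q, w q * X q ω)) Q := by
    refine hint.mono' hmeas.aestronglyMeasurable (Filter.Eventually.of_forall fun ω => ?_)
    rw [Real.norm_of_nonneg (Real.exp_pos _).le]
    exact hle ω
  refine ⟨hI, (integral_mono hI hint hle).trans ?_⟩
  rw [integral_finsetSum _ fun q _ => (hX q).const_mul (w q)]
  simp only [integral_const_mul]
  refine (Finset.sum_le_sum fun q _ => mul_le_mul_of_nonneg_left (hM q) (hw q)).trans_eq ?_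
  rw [← Finset.sum_mul, hw1, one_mul]

/-- A Taylor estimate for |x| ≤ 1. For x > 1 the last term dominates the exponential; for x < -1 it
compensates the negative x. -/
lemma exp_le_one_add_add_sq_mul_exp_abs (x : ℝ) :
    Real.exp x ≤ 1 + x + x ^ 2 * Real.exp |x| := by
  rcases le_or_gt |x| 1 with h | h
  · have h1 := (abs_le.1 (Real.abs_exp_sub_one_sub_id_le h)).2
    have h2 : 1 ≤ Real.exp |x| := Real.one_le_exp (abs_nonneg x)
    nlinarith [sq_nonneg x]
  · have h1 : 1 < x ^ 2 := by
      rw [← sq_abs]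
      nlinarith
    rcases abs_cases x with ⟨h2, h3⟩ | ⟨h2, h3⟩
    · rw [h2]
      nlinarith [Real.exp_pos x]
    · have h4 : Real.exp x ≤ 1 := Real.exp_le_one_iff.2 h3.le
      have h5 := Real.add_one_le_exp |x|
      rw [h2] at h5 h ⊢
      nlinarith

lemma integrable_of_exp_div {𝓧 : Type*} [MeasurableSpace 𝓧] {μ : Measure 𝓧} {f V : 𝓧 → ℝ} {τ : ℝ} (hτ : 0 < τ) (hf : AEMeasurable f μ) (hfV : ∀ᵐ x ∂μ, |f x| ≤ V x)
    (hV : Integrable (fun x => Real.exp (V x / τ)) μ) : Integrable f μ := by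
  refine (hV.const_mul τ).mono' hf.aestronglyMeasurable ?_
  filter_upwards [hfV] with x hx
  rw [Real.norm_eq_abs]
  refine hx.trans ?_
  have := Real.add_one_le_exp (V x / τ)
  have h2 := mul_le_mul_of_nonneg_left this hτ.le
  rw [mul_add, mul_div_cancel₀ _ hτ.ne'] at h2
  linarith

variable {𝓧 : Type*} [MeasurableSpace 𝓧] {μ : Measure 𝓧} [IsProbabilityMeasure μ]
  {f V : 𝓧 → ℝ} {τ : ℝ}

lemma sqrt_two_le : √(2 : ℝ) ≤ 3 / 2 := by
  rw [Real.sqrt_le_left (by norm_num)]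
  norm_num

/-- A Bernstein type bound for the moment generating function. -/
lemma mgf_neg_le (hτ : 0 < τ) (hf : AEMeasurable f μ) (hfV : ∀ᵐ x ∂μ, |f x| ≤ V x)
    (hV : Integrable (fun x => Real.exp (V x / τ)) μ) (hV2 : ∫ x, Real.exp (V x / τ) ∂μ ≤ √2)
    {θ : ℝ} (hθ : 0 ≤ θ) (hθ1 : θ ≤ 1) :
    Integrable (fun x => Real.exp (θ / (2 * τ) * -f x)) μ ∧
    mgf (fun x => -f x) μ (θ / (2 * τ)) ≤
      Real.exp (-(θ / (2 * τ)) * ∫ x, f x ∂μ + 3 * θ ^ 2) := by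
  have hfi := integrable_of_exp_div hτ hf hfV hV
  set u := θ / (2 * τ) with hu
  have hu0 : 0 ≤ u := by positivity
  have hpt : ∀ᵐ x ∂μ, Real.exp (u * -f x) ≤ 1 - u * f x + 2 * θ ^ 2 * Real.exp (V x / τ) := by
    filter_upwards [hfV] with x hx
    have h1 := exp_le_one_add_add_sq_mul_exp_abs (u * -f x)
    set y := V x / τ with hy
    have hVy : V x = τ * y := by rw [hy]; field_simp
    have hy0 : 0 ≤ y := div_nonneg ((abs_nonneg _).trans hx) hτ.le
    have h2 : |u * -f x| ≤ θ / 2 * y := by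
      rw [abs_mul, abs_neg, abs_of_nonneg hu0]
      refine (mul_le_mul_of_nonneg_left hx hu0).trans_eq ?_
      rw [hVy, hu]
      field_simp
    have h3 : |u * -f x| ≤ y / 2 := h2.trans (by nlinarith)
    have h4 : (u * -f x) ^ 2 ≤ θ ^ 2 / 4 * y ^ 2 := by
      rw [← sq_abs]
      refine (pow_le_pow_left₀ (abs_nonneg _) h2 2).trans_eq ?_
      ring
    -- Because θ ≤ 1, only half of the exponential moment is spent on exp|·|; the other half absorbs
    -- y².
    have h5 : y ^ 2 ≤ 8 * Real.exp (y / 2) := by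
      have := Real.quadratic_le_exp_of_nonneg (by positivity : 0 ≤ y / 2)
      nlinarith
    have h6 : Real.exp |u * -f x| ≤ Real.exp (y / 2) := Real.exp_le_exp.2 h3
    have h7 : Real.exp y = Real.exp (y / 2) * Real.exp (y / 2) := by
      rw [← Real.exp_add]
      congr 1
      ring
    have h8 : (u * -f x) ^ 2 * Real.exp |u * -f x| ≤
        θ ^ 2 / 4 * (8 * Real.exp (y / 2)) * Real.exp (y / 2) :=
      mul_le_mul (h4.trans (mul_le_mul_of_nonneg_left h5 (by positivity))) h6
        (Real.exp_pos _).le (by positivity)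
    rw [h7]
    linarith
  have hdom : Integrable (fun x => 1 - u * f x + 2 * θ ^ 2 * Real.exp (V x / τ)) μ :=
    ((integrable_const _).sub (hfi.const_mul u)).add (hV.const_mul _)
  have hI : Integrable (fun x => Real.exp (u * -f x)) μ := by
    refine hdom.mono' (Real.measurable_exp.comp_aemeasurable
      (hf.neg.const_mul u)).aestronglyMeasurable ?_
    filter_upwards [hpt] with x hx
    rwa [Real.norm_of_nonneg (Real.exp_pos _).le]
  refine ⟨hI, ?_⟩
  have h1 : mgf (fun x => -f x) μ u ≤ 1 - u * ∫ x, f x ∂μ + 3 * θ ^ 2 := by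
    refine (integral_mono_ae hI hdom hpt).trans ?_
    rw [integral_add (f := fun x => 1 - u * f x) ((integrable_const _).sub (hfi.const_mul u))
      (hV.const_mul _), integral_sub (integrable_const _) (hfi.const_mul u), integral_const_mul,
      integral_const_mul]
    simp only [integral_const, probReal_univ, smul_eq_mul, mul_one]
    have := mul_le_mul_of_nonneg_left (hV2.trans sqrt_two_le) (by positivity : 0 ≤ 2 * θ ^ 2)
    linarith
  refine h1.trans ?_
  have := Real.add_one_le_exp (-u * ∫ x, f x ∂μ + 3 * θ ^ 2)
  linarith

variable {Ω : Type*} [MeasurableSpace Ω] {P : Measure Ω} {n : ℕ}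
  {X : Fin n → Ω → 𝓧}

lemma mgf_sum_comp (hindep : iIndepFun X P) (hlaw : ∀ i, HasLaw (X i) μ P) (hf : Measurable f)
    (u : ℝ) (hI : Integrable (fun x => Real.exp (u * f x)) μ) :
    Integrable (fun ω => Real.exp (u * ∑ i, f (X i ω))) P ∧
      mgf (fun ω => ∑ i, f (X i ω)) P u = mgf f μ u ^ n := by
  have hind : iIndepFun (fun i ω => f (X i ω)) P := hindep.comp (fun _ => f) fun _ => hf
  have hm : ∀ i, AEMeasurable (fun ω => f (X i ω)) P := fun i =>
    hf.comp_aemeasurable (hlaw i).aemeasurable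
  have hmgf : ∀ i, mgf (fun ω => f (X i ω)) P u = mgf f μ u := fun i =>
    (hlaw i).integral_comp (f := fun x => Real.exp (u * f x)) hI.aestronglyMeasurable
  have hsum : mgf (fun ω => ∑ i, f (X i ω)) P u = mgf f μ u ^ n := by
    have e : (fun ω => ∑ i, f (X i ω)) = ∑ i, fun ω => f (X i ω) := by
      funext ω
      simp
    rw [e, hind.mgf_sum₀ hm]
    simp [hmgf]
  refine ⟨?_, hsum⟩
  -- A non-integrable exponential would have moment generating function 0 by convention, whereas the
  -- product formula makes it positive.
  by_contra hcon
  have h0 : mgf (fun ω => ∑ i, f (X i ω)) P u = 0 := integral_undef hcon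
  rw [hsum] at h0
  exact (pow_pos (mgf_pos hI) n).ne' h0

variable [IsProbabilityMeasure P]

/-- Lower deviations of empirical sums. -/
lemma measure_sum_le_of_exp_bound (hindep : iIndepFun X P) (hlaw : ∀ i, HasLaw (X i) μ P)
    (hτ : 0 < τ) (hf : Measurable f) (hfV : ∀ᵐ x ∂μ, |f x| ≤ V x)
    (hV : Integrable (fun x => Real.exp (V x / τ)) μ) (hV2 : ∫ x, Real.exp (V x / τ) ∂μ ≤ √2)
    {θ : ℝ} (hθ : 0 ≤ θ) (hθ1 : θ ≤ 1) :
    P.real {ω | ∑ i, f (X i ω) ≤ n * (∫ x, f x ∂μ - 15 * τ * θ)} ≤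
      Real.exp (-(9 / 2 * (n * θ ^ 2))) := by
  obtain ⟨hI, hmgf⟩ := mgf_neg_le hτ hf.aemeasurable hfV hV hV2 hθ hθ1
  obtain ⟨hI2, hmgf2⟩ := mgf_sum_comp hindep hlaw hf.neg (θ / (2 * τ)) hI
  have h1 := measure_ge_le_exp_mul_mgf (μ := P) (X := fun ω => ∑ i, -f (X i ω))
    (-(n * (∫ x, f x ∂μ - 15 * τ * θ))) (by positivity : 0 ≤ θ / (2 * τ)) hI2
  have e : {ω | ∑ i, f (X i ω) ≤ n * (∫ x, f x ∂μ - 15 * τ * θ)} =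
      {ω | -(n * (∫ x, f x ∂μ - 15 * τ * θ)) ≤ ∑ i, -f (X i ω)} := by
    ext ω
    simp only [Set.mem_ofPred_eq, Finset.sum_neg_distrib, neg_le_neg_iff]
  rw [e]
  refine h1.trans ?_
  change mgf (fun ω => ∑ i, -f (X i ω)) P _ = mgf (fun x => -f x) μ _ ^ n at hmgf2
  rw [hmgf2]
  refine (mul_le_mul_of_nonneg_left (pow_le_pow_left₀ mgf_nonneg hmgf n)
    (Real.exp_pos _).le).trans_eq ?_
  -- With parameter θ/(2τ), the deviation 15τθ gains 15/2 · θ² per sample and the Bernstein term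
  -- costs 3θ², leaving 9/2.
  rw [← Real.exp_nat_mul, ← Real.exp_add]
  congr 1
  field_simp
  ring

/-- Upper deviations of the dominating empirical sum. -/
lemma measure_le_sum_of_exp_bound (hindep : iIndepFun X P) (hlaw : ∀ i, HasLaw (X i) μ P)
    (hτ : 0 < τ) (hVm : Measurable V)
    (hV : Integrable (fun x => Real.exp (V x / τ)) μ) (hV2 : ∫ x, Real.exp (V x / τ) ∂μ ≤ √2) :
    P.real {ω | n * (5 / 2 * τ) ≤ ∑ i, V (X i ω)} ≤ Real.exp (-(2 * n)) := by
  have hV' : Integrable (fun x => Real.exp (1 / τ * V x)) μ := by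
    simpa only [one_div_mul_eq_div] using hV
  obtain ⟨hI2, hmgf2⟩ := mgf_sum_comp hindep hlaw hVm (1 / τ) hV'
  have h1 := measure_ge_le_exp_mul_mgf (μ := P) (X := fun ω => ∑ i, V (X i ω))
    (n * (5 / 2 * τ)) (by positivity : 0 ≤ 1 / τ) hI2
  refine h1.trans ?_
  rw [hmgf2]
  -- The threshold 5/2 less this 1/2 gives the rate 2.
  have h3 : mgf V μ (1 / τ) ≤ Real.exp (1 / 2) := by
    have : mgf V μ (1 / τ) = ∫ x, Real.exp (V x / τ) ∂μ := by
      simp only [mgf, one_div_mul_eq_div]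
    rw [this]
    refine hV2.trans (sqrt_two_le.trans ?_)
    have := Real.add_one_le_exp (1 / 2 : ℝ)
    linarith
  refine (mul_le_mul_of_nonneg_left (pow_le_pow_left₀ mgf_nonneg h3 n)
    (Real.exp_pos _).le).trans_eq ?_
  rw [← Real.exp_nat_mul, ← Real.exp_add]
  congr 1
  field_simp
  ring

/-- Simultaneous lower deviations over a finite class dominated by `V`. -/
theorem uniform_deviation {I : Type*} (hindep : iIndepFun X P) (hlaw : ∀ i, HasLaw (X i) μ P)
    (hτ : 0 < τ) (F : Finset I) {f : I → 𝓧 → ℝ} (hf : ∀ d ∈ F, AEMeasurable (f d) μ)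
    (hfV : ∀ d ∈ F, ∀ᵐ x ∂μ, |f d x| ≤ V x) (hVm : Measurable V)
    (hV : Integrable (fun x => Real.exp (V x / τ)) μ) (hV2 : ∫ x, Real.exp (V x / τ) ∂μ ≤ √2)
    {θ : ℝ} (hθ : 0 ≤ θ) (hθ1 : θ ≤ 1) :
    P {ω | ¬ ((∀ d ∈ F, n * (∫ x, f d x ∂μ - 15 * τ * θ) ≤ ∑ i, f d (X i ω)) ∧
        ∑ i, V (X i ω) ≤ n * (5 / 2 * τ))} ≤
      ENNReal.ofReal (F.card * Real.exp (-(9 / 2 * (n * θ ^ 2))) + Real.exp (-(2 * n))) := by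
  classical
  -- The functions are only almost everywhere measurable, so measurable representatives are used to
  -- compose with the independent samples.
  have hae : ∀ᵐ ω ∂P, ∀ d : F, ∀ i, f d (X i ω) = (hf d d.2).mk (f d) (X i ω) := by
    rw [ae_all_iff]
    intro d
    rw [ae_all_iff]
    intro i
    have h : ∀ᵐ x ∂(P.map (X i)), f d x = (hf d d.2).mk (f d) x :=
      (hlaw i).map_eq.symm ▸ (hf d d.2).ae_eq_mk
    exact ae_of_ae_map (hlaw i).aemeasurable h
  let g : F → 𝓧 → ℝ := fun d => (hf d d.2).mk (f d)
  let E : F → Set Ω := fun d => {ω | ∑ i, g d (X i ω) ≤ n * (∫ x, g d x ∂μ - 15 * τ * θ)}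
  let E' : Set Ω := {ω | n * (5 / 2 * τ) ≤ ∑ i, V (X i ω)}
  have hgi : ∀ d : F, ∫ x, f d x ∂μ = ∫ x, g d x ∂μ := fun d =>
    integral_congr_ae (hf d d.2).ae_eq_mk
  have hsub : {ω | ¬ ((∀ d ∈ F, n * (∫ x, f d x ∂μ - 15 * τ * θ) ≤ ∑ i, f d (X i ω)) ∧
        ∑ i, V (X i ω) ≤ n * (5 / 2 * τ))} ≤ᵐ[P] ((⋃ d, E d) ∪ E' : Set Ω) := by
    filter_upwards [hae] with ω hω h
    by_contra hcon
    refine h ⟨fun d hd => ?_, ?_⟩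
    · by_contra! hlt
      refine hcon (Or.inl (Set.mem_iUnion.2 ⟨⟨d, hd⟩, ?_⟩))
      rw [hgi ⟨d, hd⟩, Finset.sum_congr rfl fun i _ => hω ⟨d, hd⟩ i] at hlt
      exact hlt.le
    · by_contra! hlt
      exact hcon (Or.inr hlt.le)
  refine (measure_mono_ae hsub).trans ((measure_union_le _ _).trans ?_)
  have hE : ∀ d, P (E d) ≤ ENNReal.ofReal (Real.exp (-(9 / 2 * (n * θ ^ 2)))) := by
    intro d
    rw [← ofReal_measureReal]
    refine ENNReal.ofReal_le_ofReal ?_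
    refine measure_sum_le_of_exp_bound hindep hlaw hτ (hf d d.2).measurable_mk ?_ hV hV2 hθ hθ1
    filter_upwards [hfV d d.2, (hf d d.2).ae_eq_mk] with x h1 h2
    rwa [← h2]
  have hE' : P E' ≤ ENNReal.ofReal (Real.exp (-(2 * n))) := by
    rw [← ofReal_measureReal]
    exact ENNReal.ofReal_le_ofReal (measure_le_sum_of_exp_bound hindep hlaw hτ hVm hV hV2)
  rw [ENNReal.ofReal_add (by positivity) (by positivity), ENNReal.ofReal_mul (by positivity)]
  refine add_le_add ?_ hE'
  refine (measure_iUnion_le _).trans ?_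
  rw [tsum_fintype]
  refine (Finset.sum_le_sum fun d _ => hE d).trans_eq ?_
  simp

end Concentration

/-! ### Second moments of sums of independent variables -/

section Moments

/-- Second moments of sums of independent centred variables. -/
lemma integral_sum_mul_sum {Ω κ : Type*} [MeasurableSpace Ω] {Q : Measure Ω}
    [IsProbabilityMeasure Q] [Fintype κ] {Y : κ → Ω → ℝ} (hY : iIndepFun Y Q) {f g : κ → ℝ → ℝ}
    (hf : ∀ q, Measurable (f q)) (hg : ∀ q, Measurable (g q))
    (hf2 : ∀ q, MemLp (fun ω => f q (Y q ω)) 2 Q) (hg2 : ∀ q, MemLp (fun ω => g q (Y q ω)) 2 Q)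
    (hf0 : ∀ q, ∫ ω, f q (Y q ω) ∂Q = 0) :
    Integrable (fun ω => (∑ q, f q (Y q ω)) * ∑ q, g q (Y q ω)) Q ∧
      ∫ ω, (∑ q, f q (Y q ω)) * ∑ q, g q (Y q ω) ∂Q = ∑ q, ∫ ω, f q (Y q ω) * g q (Y q ω) ∂Q := by
  have hint : ∀ q r, Integrable (fun ω => f q (Y q ω) * g r (Y r ω)) Q := fun q r =>
    (hf2 q).integrable_mul (hg2 r)
  have e : (fun ω => (∑ q, f q (Y q ω)) * ∑ q, g q (Y q ω)) =
      fun ω => ∑ q, ∑ r, f q (Y q ω) * g r (Y r ω) := by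
    funext ω
    rw [Finset.sum_mul_sum]
  rw [e]
  refine ⟨integrable_finsetSum _ fun q _ => integrable_finsetSum _ fun r _ => hint q r, ?_⟩
  rw [integral_finsetSum _ fun q _ => integrable_finsetSum _ fun r _ => hint q r]
  refine Finset.sum_congr rfl fun q _ => ?_
  rw [integral_finsetSum _ fun r _ => hint q r]
  -- Off-diagonal products vanish by independence as soon as the first factor is centred; the second
  -- need not be.
  refine Finset.sum_eq_single q (fun r _ hr => ?_) (by simp)
  have hind : IndepFun (fun ω => f q (Y q ω)) (fun ω => g r (Y r ω)) Q :=
    (hY.indepFun hr.symm).comp (hf q) (hg r)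
  rw [hind.integral_fun_mul_eq_mul_integral (hf2 q).aestronglyMeasurable
    (hg2 r).aestronglyMeasurable, hf0 q, zero_mul]

end Moments

/-! ### The law of a signal, given its support -/

section Model

variable {m p k : ℕ}

/-- The law of an entry of the coefficient vector, given the support. -/
noncomputable def entryLaw (ν : Measure ℝ) (J : Finset (Fin p)) (j : Fin p) : Measure ℝ :=
  if j ∈ J then ν else Measure.dirac 0

instance (ν : Measure ℝ) [IsProbabilityMeasure ν] (J : Finset (Fin p)) (j : Fin p) :
    IsProbabilityMeasure (entryLaw ν J j) := by
  unfold entryLaw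
  split_ifs <;> infer_instance

/-- The law of the pair of coefficients and noise, given the support. -/
noncomputable def jointLaw (m : ℕ) (ν ρ : Measure ℝ) (J : Finset (Fin p)) :
    Measure ((Fin p → ℝ) × (Fin m → ℝ)) :=
  (Measure.pi (entryLaw ν J)).prod (Measure.pi fun _ => ρ)

lemma IsCoefficientLaw.ae_ne_zero {ν : Measure ℝ} {αmin : ℝ} {σα : ℝ≥0}
    (hν : IsCoefficientLaw αmin σα ν) : ∀ᵐ a ∂ν, a ≠ 0 := by
  have h : ∀ᵐ a ∂ν, ¬ |a| < αmin := by
    rw [ae_iff]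
    simpa using hν.bounded_away
  filter_upwards [h] with a ha h0
  rw [h0, abs_zero] at ha
  exact ha hν.pos

lemma IsCoefficientLaw.memLp_id {ν : Measure ℝ} {αmin : ℝ} {σα : ℝ≥0}
    (hν : IsCoefficientLaw αmin σα ν) : MemLp (fun a => a) 2 ν :=
  hν.subgaussian.memLp 2

variable {ν ρ : Measure ℝ} [IsProbabilityMeasure ρ]

/-- The law is a finite mixture over supports, which reduces expectations and null sets to a fixed
J. -/
lemma sampleLaw_eq_sum (S : PMF (Finset (Fin p))) :
    sampleLaw m S ν ρ = ∑ J, S J • jointLaw m ν ρ J := by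
  rw [sampleLaw, coefficientLaw, ← Measure.sum_fintype, Measure.prod_sum_left,
    Measure.sum_fintype]
  refine Finset.sum_congr rfl fun J _ => ?_
  rw [Measure.prod_smul_left]
  rfl

lemma ae_sampleLaw {S : PMF (Finset (Fin p))} {q : (Fin p → ℝ) × (Fin m → ℝ) → Prop}
    (h : ∀ J, S J ≠ 0 → ∀ᵐ z ∂(jointLaw m ν ρ J), q z) : ∀ᵐ z ∂(sampleLaw m S ν ρ), q z := by
  rw [sampleLaw_eq_sum, ae_iff, Measure.finsetSum_apply]
  refine Finset.sum_eq_zero fun J _ => ?_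
  rw [Measure.smul_apply, smul_eq_mul]
  by_cases h0 : S J = 0
  · rw [h0, zero_mul]
  · rw [ae_iff.1 (h J h0), mul_zero]

lemma integrable_sampleLaw {S : PMF (Finset (Fin p))} {f : (Fin p → ℝ) × (Fin m → ℝ) → ℝ}
    (h : ∀ J, S J ≠ 0 → Integrable f (jointLaw m ν ρ J)) : Integrable f (sampleLaw m S ν ρ) := by
  rw [sampleLaw_eq_sum, integrable_finsetSum_measure]
  intro J _
  by_cases h0 : S J = 0
  · rw [h0, zero_smul]
    exact integrable_zero_measure
  · exact (h J h0).smul_measure (S.apply_ne_top J)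

lemma integral_sampleLaw {S : PMF (Finset (Fin p))} {f : (Fin p → ℝ) × (Fin m → ℝ) → ℝ}
    (h : ∀ J, S J ≠ 0 → Integrable f (jointLaw m ν ρ J)) :
    ∫ z, f z ∂(sampleLaw m S ν ρ) = ∑ J, (S J).toReal * ∫ z, f z ∂(jointLaw m ν ρ J) := by
  rw [sampleLaw_eq_sum, integral_finsetSum_measure]
  · simp only [integral_smul_measure, smul_eq_mul]
  · intro J _
    by_cases h0 : S J = 0
    · rw [h0, zero_smul]
      exact integrable_zero_measure
    · exact (h J h0).smul_measure (S.apply_ne_top J)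

variable [IsProbabilityMeasure ν]

instance (J : Finset (Fin p)) : IsProbabilityMeasure (jointLaw m ν ρ J) := by
  unfold jointLaw
  infer_instance

lemma isProbabilityMeasure_sampleLaw (S : PMF (Finset (Fin p))) :
    IsProbabilityMeasure (sampleLaw m S ν ρ) := by
  constructor
  rw [sampleLaw_eq_sum, Measure.finsetSum_apply]
  simp only [Measure.smul_apply, measure_univ, smul_eq_mul, mul_one]
  rw [← tsum_fintype (L := .unconditional _), S.tsum_coe]

/-- All the scalar coordinates of a pair. -/
def coord (q : Fin p ⊕ Fin m) (z : (Fin p → ℝ) × (Fin m → ℝ)) : ℝ := Sum.elim z.1 z.2 q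

/-- Merging the two index sets identifies the conditional law with one product measure, so
coefficients and noise entries are jointly independent. -/
lemma iIndepFun_coord (J : Finset (Fin p)) : iIndepFun coord (jointLaw m ν ρ J) := by
  let law : Fin p ⊕ Fin m → Measure ℝ := Sum.elim (entryLaw ν J) fun _ => ρ
  have hlaw : ∀ q, IsProbabilityMeasure (law q) := by
    rintro (j | l) <;> simp only [law, Sum.elim_inl, Sum.elim_inr] <;> infer_instance
  have hmp := measurePreserving_sumPiEquivProdPi_symm (X := fun _ : Fin p ⊕ Fin m => ℝ) law
  have h2 : (jointLaw m ν ρ J).map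
      (MeasurableEquiv.sumPiEquivProdPi fun _ : Fin p ⊕ Fin m => ℝ).symm = Measure.pi law :=
    hmp.map_eq
  have e : ∀ q (z : (Fin p → ℝ) × (Fin m → ℝ)),
      coord q z = (MeasurableEquiv.sumPiEquivProdPi fun _ : Fin p ⊕ Fin m => ℝ).symm z q := by
    rintro (j | l) z <;> rfl
  have e2 : coord = fun (q : Fin p ⊕ Fin m) (z : (Fin p → ℝ) × (Fin m → ℝ)) =>
      (MeasurableEquiv.sumPiEquivProdPi fun _ : Fin p ⊕ Fin m => ℝ).symm z q := by
    funext q z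
    exact e q z
  have hq : ∀ q, (jointLaw m ν ρ J).map (coord q) = law q := fun q => by
    rw [e2]
    exact ((measurePreserving_eval law q).comp hmp).map_eq
  have hm : ∀ q, Measurable (coord q : (Fin p → ℝ) × (Fin m → ℝ) → ℝ) := fun q => by
    rw [e2]
    fun_prop
  rw [iIndepFun_iff_map_fun_eq_pi_map fun q => (hm q).aemeasurable]
  simp only [hq]
  rw [← h2, e2]

lemma measurePreserving_entry {J : Finset (Fin p)} {j : Fin p} (hj : j ∈ J) :
    MeasurePreserving (fun z : (Fin p → ℝ) × (Fin m → ℝ) => z.1 j) (jointLaw m ν ρ J) ν := by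
  have h := (measurePreserving_eval (entryLaw ν J) j).comp
    (measurePreserving_fst (μ := Measure.pi (entryLaw ν J))
      (ν := Measure.pi fun _ : Fin m => ρ))
  have e : entryLaw ν J j = ν := if_pos hj
  rw [e] at h
  exact h

lemma measurePreserving_entry_of_notMem {J : Finset (Fin p)} {j : Fin p} (hj : j ∉ J) :
    MeasurePreserving (fun z : (Fin p → ℝ) × (Fin m → ℝ) => z.1 j) (jointLaw m ν ρ J)
      (Measure.dirac 0) := by
  have h := (measurePreserving_eval (entryLaw ν J) j).comp
    (measurePreserving_fst (μ := Measure.pi (entryLaw ν J))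
      (ν := Measure.pi fun _ : Fin m => ρ))
  have e : entryLaw ν J j = Measure.dirac 0 := if_neg hj
  rw [e] at h
  exact h

lemma measurePreserving_noise (J : Finset (Fin p)) (l : Fin m) :
    MeasurePreserving (fun z : (Fin p → ℝ) × (Fin m → ℝ) => z.2 l) (jointLaw m ν ρ J) ρ :=
  (measurePreserving_eval (fun _ : Fin m => ρ) l).comp
    (measurePreserving_snd (μ := Measure.pi (entryLaw ν J)) (ν := Measure.pi fun _ : Fin m => ρ))

variable {αmin : ℝ} {σα σ : ℝ≥0}

/-- The support of the coefficients is almost surely the drawn support. -/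
lemma ae_support_eq (hν : IsCoefficientLaw αmin σα ν) (J : Finset (Fin p)) :
    ∀ᵐ z ∂(jointLaw m ν ρ J), Function.support z.1 = J := by
  have h : ∀ᵐ z ∂(jointLaw m ν ρ J), ∀ j, z.1 j ≠ 0 ↔ j ∈ J := by
    rw [ae_all_iff]
    intro j
    by_cases hj : j ∈ J
    · have := (measurePreserving_entry (m := m) (ν := ν) (ρ := ρ) hj).quasiMeasurePreserving.ae
        hν.ae_ne_zero
      filter_upwards [this] with z hz
      exact ⟨fun _ => hj, fun _ => hz⟩
    · have h0 : ∀ᵐ a ∂(Measure.dirac (0 : ℝ)), a = 0 := by simp [ae_dirac_eq]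
      have := (measurePreserving_entry_of_notMem (m := m) (ν := ν) (ρ := ρ)
        hj).quasiMeasurePreserving.ae h0
      filter_upwards [this] with z hz
      exact ⟨fun h => absurd hz h, fun h => absurd h hj⟩
  filter_upwards [h] with z hz
  ext j
  exact hz j

/-! ### Signs of the coefficients -/

lemma sign_ne_zero_iff {a : ℝ} : Real.sign a ≠ 0 ↔ a ≠ 0 := by
  rcases lt_trichotomy a 0 with h | h | h
  · simp [Real.sign_of_neg h, h.ne]
  · simp [h]
  · simp [Real.sign_of_pos h, h.ne']

lemma support_signVec (a : Fin p → ℝ) : Function.support (signVec a) = Function.support a := by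
  ext j
  exact sign_ne_zero_iff

lemma measurable_sign : Measurable Real.sign := by
  unfold Real.sign
  exact Measurable.ite measurableSet_Iio measurable_const
    (Measurable.ite measurableSet_Ioi measurable_const measurable_const)

lemma abs_sign_le (a : ℝ) : |Real.sign a| ≤ 1 := by
  rcases Real.sign_apply_eq a with h | h | h <;> simp [h]

lemma sign_sq_eq_one {a : ℝ} (ha : a ≠ 0) : Real.sign a * Real.sign a = 1 := by
  rcases Real.sign_apply_eq_of_ne_zero a ha with h | h <;> simp [h]

lemma self_mul_sign (a : ℝ) : a * Real.sign a = |a| := by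
  rcases lt_trichotomy a 0 with h | h | h
  · simp [Real.sign_of_neg h, abs_of_neg h]
  · simp [h]
  · simp [Real.sign_of_pos h, abs_of_pos h]

lemma l2_sign_sq {J : Finset (Fin p)} {a : Fin p → ℝ} (ha : Function.support a = J) :
    l2 (fun j : J => signVec a j) ^ 2 = J.card := by
  rw [l2_sq]
  have : ∀ j : J, signVec a j ^ 2 = 1 := fun j => by
    rw [sq]
    refine sign_sq_eq_one ?_
    have : (j : Fin p) ∈ Function.support a := by rw [ha]; exact j.2
    exact this
  simp [this]

/-! ### Second moments of the correlation vector -/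

/-- The summands of the correlation vector. -/
noncomputable def corrTerm {J : Finset (Fin p)} (lam : ℝ) (A₀ A : Matrix (Fin m) J ℝ) (r : J) :
    J ⊕ Fin m → ℝ → ℝ :=
  Sum.elim (fun j a => (Aᵀ * A₀) r j * a - lam * (1 : Matrix J J ℝ) r j * Real.sign a)
    fun l e => A l r * e

/-- The coordinates which matter given the support `J`. -/
def subcoord (J : Finset (Fin p)) (q : J ⊕ Fin m) : (Fin p → ℝ) × (Fin m → ℝ) → ℝ :=
  coord (Sum.map Subtype.val id q)

lemma iIndepFun_subcoord (J : Finset (Fin p)) : iIndepFun (subcoord J) (jointLaw m ν ρ J) :=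
  iIndepFun.precomp (g := (Sum.map Subtype.val id : J ⊕ Fin m → Fin p ⊕ Fin m)) (Sum.map_injective.2 ⟨Subtype.val_injective, Function.injective_id⟩)
    (iIndepFun_coord J)

lemma corr_eq_sum {J : Finset (Fin p)} (lam : ℝ) (A₀ A : Matrix (Fin m) J ℝ) (r : J)
    (z : (Fin p → ℝ) × (Fin m → ℝ)) :
    corr lam (A₀ *ᵥ (fun j : J => z.1 j) + z.2) A (fun j : J => signVec z.1 j) r =
      ∑ q, corrTerm lam A₀ A r q (subcoord J q z) := by
  rw [Fintype.sum_sum_type]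
  simp only [corrTerm, subcoord, coord, Sum.elim_inl, Sum.elim_inr, Sum.map_inl, Sum.map_inr, id,
    Finset.sum_sub_distrib]
  rw [corr, Matrix.mulVec_add, Matrix.mulVec_mulVec]
  simp only [Pi.sub_apply, Pi.add_apply, Pi.smul_apply, smul_eq_mul, Matrix.mulVec, dotProduct,
    signVec, Matrix.transpose_apply]
  have : ∑ j : J, lam * (1 : Matrix J J ℝ) r j * Real.sign (z.1 j) = lam * Real.sign (z.1 r) := by
    rw [Finset.sum_eq_single r]
    · simp
    · intro j _ hj
      simp [Matrix.one_apply_ne' hj]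
    · simp
  rw [this]
  ring

lemma measurable_corrTerm {J : Finset (Fin p)} (lam : ℝ) (A₀ A : Matrix (Fin m) J ℝ) (r : J)
    (q : J ⊕ Fin m) : Measurable (corrTerm lam A₀ A r q) := by
  have := measurable_sign
  rcases q with j | l <;> simp only [corrTerm, Sum.elim_inl, Sum.elim_inr] <;> fun_prop

lemma IsCoefficientLaw.memLp_sign (_hν : IsCoefficientLaw αmin σα ν) : MemLp Real.sign 2 ν :=
  MemLp.of_bound measurable_sign.aestronglyMeasurable 1
    (Filter.Eventually.of_forall fun a => by rw [Real.norm_eq_abs]; exact abs_sign_le a)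

lemma IsCoefficientLaw.memLp_corrTerm (hν : IsCoefficientLaw αmin σα ν)
    (hρ : HasSubgaussianMGF id (σ ^ 2) ρ) {J : Finset (Fin p)} (lam : ℝ)
    (A₀ A : Matrix (Fin m) J ℝ) (r : J) (q : J ⊕ Fin m) :
    MemLp (fun z => corrTerm lam A₀ A r q (subcoord J q z)) 2 (jointLaw m ν ρ J) := by
  rcases q with j | l
  · have h : MemLp (corrTerm lam A₀ A r (.inl j)) 2 ν :=
      (hν.memLp_id.const_mul _).sub (hν.memLp_sign.const_mul _)
    exact h.comp_measurePreserving (measurePreserving_entry j.2)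
  · have h : MemLp (corrTerm lam A₀ A r (.inr l)) 2 ρ := (hρ.memLp 2).const_mul _
    exact h.comp_measurePreserving (measurePreserving_noise J l)

lemma integral_entry {J : Finset (Fin p)} (j : J) {f : ℝ → ℝ} (hf : AEStronglyMeasurable f ν) :
    ∫ z : (Fin p → ℝ) × (Fin m → ℝ), f (z.1 j) ∂(jointLaw m ν ρ J) = ∫ a, f a ∂ν := by
  have h := measurePreserving_entry (m := m) (ν := ν) (ρ := ρ) j.2
  exact (integral_map h.measurable.aemeasurable (by rwa [h.map_eq])).symm.trans (by rw [h.map_eq])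

lemma integral_noise (J : Finset (Fin p)) (l : Fin m) {f : ℝ → ℝ}
    (hf : AEStronglyMeasurable f ρ) :
    ∫ z : (Fin p → ℝ) × (Fin m → ℝ), f (z.2 l) ∂(jointLaw m ν ρ J) = ∫ a, f a ∂ρ := by
  have h := measurePreserving_noise (m := m) (ν := ν) (ρ := ρ) J l
  exact (integral_map h.measurable.aemeasurable (by rwa [h.map_eq])).symm.trans (by rw [h.map_eq])

/-- Coefficients and noise are centred because they are sub-Gaussian; the sign is centred by
assumption. -/
lemma IsCoefficientLaw.integral_corrTerm (hν : IsCoefficientLaw αmin σα ν)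
    (hρ : HasSubgaussianMGF id (σ ^ 2) ρ) {J : Finset (Fin p)} (lam : ℝ)
    (A₀ A : Matrix (Fin m) J ℝ) (r : J) (q : J ⊕ Fin m) :
    ∫ z, corrTerm lam A₀ A r q (subcoord J q z) ∂(jointLaw m ν ρ J) = 0 := by
  have hm := measurable_corrTerm lam A₀ A r q
  rcases q with j | l
  · refine (integral_entry j hm.aestronglyMeasurable).trans ?_
    simp only [corrTerm, Sum.elim_inl]
    rw [integral_sub ((hν.memLp_id.integrable (by norm_num)).const_mul _)
      ((hν.memLp_sign.integrable (by norm_num)).const_mul _), integral_const_mul,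
      integral_const_mul, hν.centred_sign]
    have := hν.subgaussian.integral_eq_zero
    simp only [id] at this
    rw [this]
    ring
  · refine (integral_noise J l hm.aestronglyMeasurable).trans ?_
    simp only [corrTerm, Sum.elim_inr]
    rw [integral_const_mul]
    have := hρ.integral_eq_zero
    simp only [id] at this
    rw [this, mul_zero]

/-- The second moment matrix of the correlation vector. -/
noncomputable def corrMoment {J : Finset (Fin p)} (lam a₁ a₂ b₂ : ℝ) (A₀ A : Matrix (Fin m) J ℝ) :
    Matrix J J ℝ :=
  a₂ • ((Aᵀ * A₀) * (Aᵀ * A₀)ᵀ) - (lam * a₁) • ((Aᵀ * A₀) + (Aᵀ * A₀)ᵀ) +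
    lam ^ 2 • (1 : Matrix J J ℝ) + b₂ • (Aᵀ * A)

lemma IsCoefficientLaw.integral_corr_mul_corr (hν : IsCoefficientLaw αmin σα ν)
    (hρ : HasSubgaussianMGF id (σ ^ 2) ρ) {J : Finset (Fin p)} (lam : ℝ)
    (A₀ A : Matrix (Fin m) J ℝ) (r r' : J) :
    Integrable (fun z => corr lam (A₀ *ᵥ (fun j : J => z.1 j) + z.2) A
      (fun j : J => signVec z.1 j) r * corr lam (A₀ *ᵥ (fun j : J => z.1 j) + z.2) A
      (fun j : J => signVec z.1 j) r') (jointLaw m ν ρ J) ∧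
    ∫ z, corr lam (A₀ *ᵥ (fun j : J => z.1 j) + z.2) A
      (fun j : J => signVec z.1 j) r * corr lam (A₀ *ᵥ (fun j : J => z.1 j) + z.2) A
      (fun j : J => signVec z.1 j) r' ∂(jointLaw m ν ρ J) =
      corrMoment lam (∫ a, |a| ∂ν) (∫ a, a ^ 2 ∂ν) (∫ e, e ^ 2 ∂ρ) A₀ A r r' := by
  have h := integral_sum_mul_sum (iIndepFun_subcoord (m := m) (ν := ν) (ρ := ρ) J)
    (measurable_corrTerm lam A₀ A r) (measurable_corrTerm lam A₀ A r')
    (hν.memLp_corrTerm hρ lam A₀ A r) (hν.memLp_corrTerm hρ lam A₀ A r')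
    (hν.integral_corrTerm hρ lam A₀ A r)
  simp only [corr_eq_sum]
  refine ⟨h.1, h.2.trans ?_⟩
  rw [Fintype.sum_sum_type]
  have h1 : ∀ j : J, ∫ z, corrTerm lam A₀ A r (.inl j) (subcoord J (.inl j) z) *
      corrTerm lam A₀ A r' (.inl j) (subcoord J (.inl j) z) ∂(jointLaw m ν ρ J) =
      (Aᵀ * A₀) r j * (Aᵀ * A₀) r' j * ∫ a, a ^ 2 ∂ν -
      lam * (∫ a, |a| ∂ν) * ((1 : Matrix J J ℝ) r' j * (Aᵀ * A₀) r j +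
        (1 : Matrix J J ℝ) r j * (Aᵀ * A₀) r' j) +
      lam ^ 2 * ((1 : Matrix J J ℝ) r j * (1 : Matrix J J ℝ) r' j) := by
    intro j
    refine (integral_entry j ((measurable_corrTerm lam A₀ A r (.inl j)).mul
      (measurable_corrTerm lam A₀ A r' (.inl j))).aestronglyMeasurable).trans ?_
    -- Since a ≠ 0 almost surely, the squared sign is 1 and a · sign a = |a|; this produces the λ²
    -- term and the first absolute moment.
    have hae : ∀ᵐ a ∂ν, (corrTerm lam A₀ A r (.inl j) * corrTerm lam A₀ A r' (.inl j)) a =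
        (Aᵀ * A₀) r j * (Aᵀ * A₀) r' j * a ^ 2 -
        lam * ((1 : Matrix J J ℝ) r' j * (Aᵀ * A₀) r j +
          (1 : Matrix J J ℝ) r j * (Aᵀ * A₀) r' j) * |a| +
        lam ^ 2 * ((1 : Matrix J J ℝ) r j * (1 : Matrix J J ℝ) r' j) := by
      filter_upwards [hν.ae_ne_zero] with a ha
      have e1 := sign_sq_eq_one ha
      have e2 := self_mul_sign a
      simp only [corrTerm, Sum.elim_inl, Pi.mul_apply]
      linear_combination lam ^ 2 * ((1 : Matrix J J ℝ) r j * (1 : Matrix J J ℝ) r' j) * e1 -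
        lam * ((1 : Matrix J J ℝ) r' j * (Aᵀ * A₀) r j +
          (1 : Matrix J J ℝ) r j * (Aᵀ * A₀) r' j) * e2
    rw [integral_congr_ae hae]
    have i1 : Integrable (fun a : ℝ => (Aᵀ * A₀) r j * (Aᵀ * A₀) r' j * a ^ 2) ν :=
      hν.memLp_id.integrable_sq.const_mul _
    have i2 : Integrable (fun a : ℝ => lam * ((1 : Matrix J J ℝ) r' j * (Aᵀ * A₀) r j +
          (1 : Matrix J J ℝ) r j * (Aᵀ * A₀) r' j) * |a|) ν :=
      ((hν.memLp_id.integrable (by norm_num)).abs).const_mul _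
    rw [integral_add (f := fun a : ℝ => (Aᵀ * A₀) r j * (Aᵀ * A₀) r' j * a ^ 2 -
        lam * ((1 : Matrix J J ℝ) r' j * (Aᵀ * A₀) r j +
          (1 : Matrix J J ℝ) r j * (Aᵀ * A₀) r' j) * |a|) (i1.sub i2) (integrable_const _),
      integral_sub i1 i2, integral_const_mul, integral_const_mul]
    simp only [integral_const, probReal_univ, smul_eq_mul, one_mul]
    ring
  have h2 : ∀ l : Fin m, ∫ z, corrTerm lam A₀ A r (.inr l) (subcoord J (.inr l) z) *
      corrTerm lam A₀ A r' (.inr l) (subcoord J (.inr l) z) ∂(jointLaw m ν ρ J) =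
      A l r * A l r' * ∫ e, e ^ 2 ∂ρ := by
    intro l
    refine (integral_noise J l ((measurable_corrTerm lam A₀ A r (.inr l)).mul
      (measurable_corrTerm lam A₀ A r' (.inr l))).aestronglyMeasurable).trans ?_
    rw [← integral_const_mul]
    refine integral_congr_ae (Filter.Eventually.of_forall fun e => ?_)
    simp only [corrTerm, Sum.elim_inr, Pi.mul_apply]
    ring
  simp only [h1, h2]
  rw [Finset.sum_add_distrib, Finset.sum_sub_distrib, ← Finset.sum_mul, ← Finset.sum_mul,
    ← Finset.mul_sum, ← Finset.mul_sum, Finset.sum_add_distrib]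
  have s1 : ∑ j, (1 : Matrix J J ℝ) r' j * (Aᵀ * A₀) r j = (Aᵀ * A₀) r r' := by
    simp [Matrix.one_apply]
  have s2 : ∑ j, (1 : Matrix J J ℝ) r j * (Aᵀ * A₀) r' j = (Aᵀ * A₀) r' r := by
    simp [Matrix.one_apply]
  have s3 : ∑ j, (1 : Matrix J J ℝ) r j * (1 : Matrix J J ℝ) r' j = (1 : Matrix J J ℝ) r r' := by
    simp [Matrix.one_apply]
  rw [s1, s2, s3, corrMoment]
  simp only [Matrix.add_apply, Matrix.sub_apply, Matrix.smul_apply, smul_eq_mul,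
    Matrix.transpose_apply, Matrix.mul_apply (M := Aᵀ * A₀), Matrix.mul_apply (M := Aᵀ) (N := A)]
  ring

/-- The expectation of the quadratic form in the correlation vector. -/
lemma IsCoefficientLaw.integral_quadratic (hν : IsCoefficientLaw αmin σα ν)
    (hρ : HasSubgaussianMGF id (σ ^ 2) ρ) {J : Finset (Fin p)} (lam : ℝ)
    (A₀ A : Matrix (Fin m) J ℝ) (hA : IsUnit (Aᵀ * A).det) :
    Integrable (fun z => corr lam (A₀ *ᵥ (fun j : J => z.1 j) + z.2) A
      (fun j : J => signVec z.1 j) ⬝ᵥ ((Aᵀ * A)⁻¹ *ᵥ corr lam (A₀ *ᵥ (fun j : J => z.1 j) + z.2) A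
      (fun j : J => signVec z.1 j))) (jointLaw m ν ρ J) ∧
    ∫ z, corr lam (A₀ *ᵥ (fun j : J => z.1 j) + z.2) A
      (fun j : J => signVec z.1 j) ⬝ᵥ ((Aᵀ * A)⁻¹ *ᵥ corr lam (A₀ *ᵥ (fun j : J => z.1 j) + z.2) A
      (fun j : J => signVec z.1 j)) ∂(jointLaw m ν ρ J) =
      (∫ a, a ^ 2 ∂ν) * ((Aᵀ * A)⁻¹ * ((Aᵀ * A₀) * (Aᵀ * A₀)ᵀ)).trace -
      2 * lam * (∫ a, |a| ∂ν) * ((Aᵀ * A)⁻¹ * (Aᵀ * A₀)).trace +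
      lam ^ 2 * ((Aᵀ * A)⁻¹).trace + (∫ e, e ^ 2 ∂ρ) * J.card := by
  set M := corrMoment lam (∫ a, |a| ∂ν) (∫ a, a ^ 2 ∂ν) (∫ e, e ^ 2 ∂ρ) A₀ A with hM
  set N := (Aᵀ * A)⁻¹ with hN
  set b : (Fin p → ℝ) × (Fin m → ℝ) → J → ℝ := fun z =>
    corr lam (A₀ *ᵥ (fun j : J => z.1 j) + z.2) A (fun j : J => signVec z.1 j) with hb
  have hmom : ∀ r r', Integrable (fun z => b z r * b z r') (jointLaw m ν ρ J) ∧
      ∫ z, b z r * b z r' ∂(jointLaw m ν ρ J) = M r r' := fun r r' =>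
    hν.integral_corr_mul_corr hρ lam A₀ A r r'
  have e : (fun z => b z ⬝ᵥ (N *ᵥ b z)) = fun z => ∑ r, ∑ r', N r r' * (b z r * b z r') := by
    funext z
    simp only [dotProduct, Matrix.mulVec, Finset.mul_sum]
    refine Finset.sum_congr rfl fun r _ => Finset.sum_congr rfl fun r' _ => ?_
    ring
  have hint : ∀ r r', Integrable (fun z => N r r' * (b z r * b z r')) (jointLaw m ν ρ J) :=
    fun r r' => (hmom r r').1.const_mul _
  change Integrable (fun z => b z ⬝ᵥ (N *ᵥ b z)) (jointLaw m ν ρ J) ∧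
    ∫ z, (fun z => b z ⬝ᵥ (N *ᵥ b z)) z ∂(jointLaw m ν ρ J) = _
  rw [e]
  refine ⟨integrable_finsetSum _ fun r _ => integrable_finsetSum _ fun r' _ => hint r r', ?_⟩
  rw [integral_finsetSum _ fun r _ => integrable_finsetSum _ fun r' _ => hint r r']
  have e2 : ∑ r, ∫ z, ∑ r', N r r' * (b z r * b z r') ∂(jointLaw m ν ρ J) = (N * Mᵀ).trace := by
    simp only [Matrix.trace, Matrix.diag_apply, Matrix.mul_apply, Matrix.transpose_apply]
    refine Finset.sum_congr rfl fun r _ => ?_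
    rw [integral_finsetSum _ fun r' _ => hint r r']
    refine Finset.sum_congr rfl fun r' _ => ?_
    rw [integral_const_mul, (hmom r r').2]
  have hNt : Nᵀ = N := inv_gram_transpose A
  have e3 : (N * (Aᵀ * A₀)ᵀ).trace = (N * (Aᵀ * A₀)).trace := by
    rw [← Matrix.trace_transpose, Matrix.transpose_mul, Matrix.transpose_transpose, hNt,
      Matrix.trace_mul_comm]
  -- The noise contribution depends on A only through the size of J, so it cancels in increments.
  have e4 : (N * (Aᵀ * A)ᵀ).trace = J.card := by
    rw [Matrix.transpose_mul, Matrix.transpose_transpose, hN, Matrix.nonsing_inv_mul _ hA,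
      Matrix.trace_one, Fintype.card_coe]
  rw [e2, hM, corrMoment]
  simp only [Matrix.transpose_add, Matrix.transpose_sub, Matrix.transpose_smul,
    Matrix.transpose_one, Matrix.mul_add, Matrix.mul_sub, Matrix.mul_smul, Matrix.trace_add,
    Matrix.trace_sub, Matrix.trace_smul, smul_eq_mul, mul_one, e4]
  rw [Matrix.transpose_transpose, e3, Matrix.transpose_mul (Aᵀ * A₀), Matrix.transpose_transpose]
  ring

end Model

/-! ### Increments of the surrogate for one signal -/

section Increment

variable {m p k : ℕ} {D₀ D D' W : Matrix (Fin m) (Fin p) ℝ} {v : Fin p → ℝ} {t lam : ℝ}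
  {ν ρ : Measure ℝ} [IsProbabilityMeasure ν] [IsProbabilityMeasure ρ]
  {αmin : ℝ} {σα σ : ℝ≥0} {S : PMF (Finset (Fin p))}

/-- The surrogate at `D` for the signal with the given coefficients and noise. -/
noncomputable def loss (lam : ℝ) (D₀ D : Matrix (Fin m) (Fin p) ℝ)
    (z : (Fin p → ℝ) × (Fin m → ℝ)) : ℝ :=
  phi lam (D₀ *ᵥ z.1 + z.2) D (signVec z.1)

lemma loss_eq_closedForm {J : Finset (Fin p)} (hD : IsUnit ((cols D J)ᵀ * cols D J).det)
    {z : (Fin p → ℝ) × (Fin m → ℝ)} (hz : Function.support z.1 = J) :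
    loss lam D₀ D z = closedForm lam (cols D₀ J *ᵥ (fun j : J => z.1 j) + z.2) (cols D J)
      (fun j : J => signVec z.1 j) := by
  rw [loss, phi_eq_closedForm ((support_signVec _).trans hz) hD, mulVec_eq_cols_mulVec D₀]
  intro j hj
  by_contra h
  have : j ∈ Function.support z.1 := h
  rw [hz] at this
  exact hj this

/-- Bounds the Lipschitz constant of the surrogate in the dictionary. -/
noncomputable def lipBound (k : ℕ) (lam : ℝ) (z : (Fin p → ℝ) × (Fin m → ℝ)) : ℝ :=
  24 * ∑ j, z.1 j ^ 2 + 16 * ∑ l, z.2 l ^ 2 + 18 * lam ^ 2 * k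

lemma measurable_lipBound (k : ℕ) (lam : ℝ) :
    Measurable (lipBound k lam : (Fin p → ℝ) × (Fin m → ℝ) → ℝ) := by
  unfold lipBound
  fun_prop

lemma lipBound_nonneg (k : ℕ) (lam : ℝ) (z : (Fin p → ℝ) × (Fin m → ℝ)) :
    0 ≤ lipBound k lam z := by
  have h1 : 0 ≤ ∑ j, z.1 j ^ 2 := Finset.sum_nonneg fun _ _ => sq_nonneg _
  have h2 : 0 ≤ ∑ j, z.2 j ^ 2 := Finset.sum_nonneg fun _ _ => sq_nonneg _
  unfold lipBound
  positivity

/-- The factor 8‖x‖² of the Lipschitz bound is split by ‖x‖² ≤ 2‖A₀α‖² + 2‖ε‖² ≤ 3‖α‖² + 2‖ε‖²,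
whence 24 and 16; the sign vector has squared norm k, whence 18λ²k. -/
lemma abs_loss_sub_le (hlam : 0 ≤ lam)
    (h0 : ∀ J : Finset (Fin p), J.card = k → WellConditioned (cols D₀ J))
    (h : ∀ J : Finset (Fin p), J.card = k → WellConditioned (cols D J))
    (h' : ∀ J : Finset (Fin p), J.card = k → WellConditioned (cols D' J))
    {z : (Fin p → ℝ) × (Fin m → ℝ)} {J : Finset (Fin p)} (hz : Function.support z.1 = J)
    (hJ : J.card = k) :
    |loss lam D₀ D z - loss lam D₀ D' z| ≤ frob (D - D') * lipBound k lam z := by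
  rw [loss_eq_closedForm (h J hJ).isUnit_det hz, loss_eq_closedForm (h' J hJ).isUnit_det hz]
  refine (abs_closedForm_sub_le (h' J hJ) (h J hJ) hlam).trans ?_
  rw [← cols_sub, mul_pow, l2_sign_sq hz, hJ]
  have hx := l2_add_le (cols D₀ J *ᵥ fun j : J => z.1 j) z.2
  have hx2 := pow_le_pow_left₀ (l2_nonneg _) hx 2
  have hu := (h0 J hJ).upper fun j : J => z.1 j
  have he := l2_sq z.2
  have ha : l2 (fun j : J => z.1 j) ^ 2 ≤ ∑ j, z.1 j ^ 2 := by
    rw [l2_sq, Finset.sum_coe_sort J (fun j => z.1 j ^ 2)]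
    exact Finset.sum_le_univ_sum_of_nonneg fun j => sq_nonneg _
  have hb : 8 * l2 (cols D₀ J *ᵥ (fun j : J => z.1 j) + z.2) ^ 2 + 18 * (lam ^ 2 * k) ≤
      lipBound k lam z := by
    rw [lipBound]
    nlinarith [sq_nonneg (l2 (cols D₀ J *ᵥ fun j : J => z.1 j) - l2 z.2)]
  exact mul_le_mul (frob_cols_le _ _) hb (by positivity) (frob_nonneg _)

/-- The expected increment, given the support. -/
lemma IsCoefficientLaw.integral_loss_sub (hν : IsCoefficientLaw αmin σα ν)
    (hρ : HasSubgaussianMGF id (σ ^ 2) ρ) {J : Finset (Fin p)} (lam : ℝ)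
    (h0 : IsUnit ((cols D₀ J)ᵀ * cols D₀ J).det) (h : IsUnit ((cols D J)ᵀ * cols D J).det) :
    Integrable (fun z => loss lam D₀ D z - loss lam D₀ D₀ z) (jointLaw m ν ρ J) ∧
    ∫ z, (loss lam D₀ D z - loss lam D₀ D₀ z) ∂(jointLaw m ν ρ J) =
      condIncrement lam (∫ a, |a| ∂ν) (∫ a, a ^ 2 ∂ν) D₀ D J := by
  set A₀ := cols D₀ J with hA₀
  set A := cols D J with hA
  obtain ⟨i0, e0⟩ := hν.integral_quadratic hρ lam A₀ A₀ h0
  obtain ⟨i1, e1⟩ := hν.integral_quadratic hρ lam A₀ A h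
  have hae : (fun z => loss lam D₀ D z - loss lam D₀ D₀ z) =ᵐ[jointLaw m ν ρ J] fun z =>
      1 / 2 * ((corr lam (A₀ *ᵥ (fun j : J => z.1 j) + z.2) A₀
      (fun j : J => signVec z.1 j) ⬝ᵥ ((A₀ᵀ * A₀)⁻¹ *ᵥ corr lam (A₀ *ᵥ (fun j : J => z.1 j) + z.2) A₀
      (fun j : J => signVec z.1 j))) - (corr lam (A₀ *ᵥ (fun j : J => z.1 j) + z.2) A
      (fun j : J => signVec z.1 j) ⬝ᵥ ((Aᵀ * A)⁻¹ *ᵥ corr lam (A₀ *ᵥ (fun j : J => z.1 j) + z.2) A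
      (fun j : J => signVec z.1 j)))) := by
    filter_upwards [ae_support_eq hν J] with z hz
    rw [loss_eq_closedForm h hz, loss_eq_closedForm h0 hz, closedForm, closedForm]
    ring
  refine ⟨((i0.sub i1).const_mul _).congr hae.symm, ?_⟩
  rw [integral_congr_ae hae, integral_const_mul, integral_sub i0 i1, e0, e1, condIncrement,
    ← hA, ← hA₀]
  have t0 : ((A₀ᵀ * A₀)⁻¹ * (A₀ᵀ * A₀)).trace = J.card := by
    rw [Matrix.nonsing_inv_mul _ h0, Matrix.trace_one, Fintype.card_coe]
  have t1 : ((A₀ᵀ * A₀)⁻¹ * ((A₀ᵀ * A₀) * (A₀ᵀ * A₀)ᵀ)).trace = (A₀ᵀ * A₀).trace := by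
    rw [← Matrix.mul_assoc, Matrix.nonsing_inv_mul _ h0, Matrix.one_mul, Matrix.trace_transpose]
  -- Summing projections column by column gives a trace, so the coefficient-energy part of the
  -- increment becomes a sum of residuals.
  have t2 : ∑ j ∈ J, residual A (fun l => D₀ l j) =
      (A₀ᵀ * A₀).trace - ((Aᵀ * A)⁻¹ * ((Aᵀ * A₀) * (Aᵀ * A₀)ᵀ)).trace := by
    have e : ((Aᵀ * A)⁻¹ * ((Aᵀ * A₀) * (Aᵀ * A₀)ᵀ)).trace =
        ((Aᵀ * A₀)ᵀ * ((Aᵀ * A)⁻¹ * (Aᵀ * A₀))).trace := by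
      rw [← Matrix.mul_assoc, Matrix.trace_mul_comm]
    rw [e, ← Matrix.trace_sub, Matrix.trace, ← Finset.sum_coe_sort J (fun j => residual A fun l => D₀ l j)]
    refine Finset.sum_congr rfl fun j _ => ?_
    rw [residual, l2_sq_dot]
    rfl
  rw [t0, t1, t2]
  ring

/-- An exponential moment of the Lipschitz bound. -/
lemma exp_lipBound_jointLaw (hν : IsCoefficientLaw αmin σα ν)
    (hρ : HasSubgaussianMGF id (σ ^ 2) ρ) {J : Finset (Fin p)} (hJ : J.card = k) {K : ℝ}
    (hK : K = 24 * (k * σα ^ 2) + 16 * (m * σ ^ 2) + 18 * lam ^ 2 * k) (hK0 : 0 < K) :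
    Integrable (fun z => Real.exp (lipBound k lam z / (4 * K))) (jointLaw m ν ρ J) ∧
      ∫ z, Real.exp (lipBound k lam z / (4 * K)) ∂(jointLaw m ν ρ J) ≤ √2 := by
  -- The exponent is a convex combination of α_j²/(4σ_α²), ε_l²/(4σ²) and the constant 1/4 for the
  -- λ² term, so convexity suffices and K is the normalizing sum of the weights.
  let w : Option (J ⊕ Fin m) → ℝ := fun q => q.elim (18 * lam ^ 2 * k / K)
    (Sum.elim (fun _ => 24 * (σα : ℝ) ^ 2 / K) fun _ => 16 * (σ : ℝ) ^ 2 / K)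
  let X : Option (J ⊕ Fin m) → (Fin p → ℝ) × (Fin m → ℝ) → ℝ := fun q z => q.elim (1 / 4)
    (Sum.elim (fun j => z.1 j ^ 2 / (4 * (σα : ℝ) ^ 2)) fun l => z.2 l ^ 2 / (4 * (σ : ℝ) ^ 2))
  have hw : ∀ q, 0 ≤ w q := by
    rintro (_ | j | l) <;> simp only [w, Option.elim, Sum.elim_inl, Sum.elim_inr] <;> positivity
  have hw1 : ∑ q, w q = 1 := by
    rw [Fintype.sum_option, Fintype.sum_sum_type]
    simp only [w, Option.elim, Sum.elim_inl, Sum.elim_inr, Finset.sum_const, Finset.card_univ,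
      Fintype.card_coe, hJ, Fintype.card_fin, nsmul_eq_mul]
    field_simp
    rw [hK]
    ring
  have eα := exp_sq_of_subgaussian hν.subgaussian
  have eρ := exp_sq_of_subgaussian hρ
  simp only [NNReal.coe_pow] at eα eρ
  have hX : ∀ q, Integrable (fun z => Real.exp (X q z)) (jointLaw m ν ρ J) ∧
      ∫ z, Real.exp (X q z) ∂(jointLaw m ν ρ J) ≤ √2 := by
    rintro (_ | j | l)
    · simp only [X, Option.elim, integrable_const, integral_const, probReal_univ, smul_eq_mul,
        one_mul, true_and]
      refine Real.le_sqrt_of_sq_le ?_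
      rw [← Real.exp_nat_mul]
      have h1 : Real.exp (((2 : ℕ) : ℝ) * (1 / 4)) ^ 2 ≤ 2 ^ 2 := by
        rw [← Real.exp_nat_mul]
        norm_num
        linarith [Real.exp_one_lt_d9]
      exact le_of_sq_le_sq h1 (by norm_num)
    · refine ⟨?_, (integral_entry j eα.1.aestronglyMeasurable).trans_le eα.2⟩
      exact (measurePreserving_entry (m := m) (ν := ν) (ρ := ρ) j.2).integrable_comp_of_integrable
        eα.1
    · refine ⟨?_, (integral_noise J l eρ.1.aestronglyMeasurable).trans_le eρ.2⟩
      exact (measurePreserving_noise (m := m) (ν := ν) (ρ := ρ) J l).integrable_comp_of_integrable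
        eρ.1
  have hcomb := exp_convex_combination hw hw1 (fun q => (hX q).1) (fun q => (hX q).2)
  have hzα : ∀ᵐ a ∂ν, (σα : ℝ) = 0 → a = 0 := by
    by_cases h : σα = 0
    · have hs := hν.subgaussian
      rw [h, zero_pow two_ne_zero] at hs
      filter_upwards [hs.ae_eq_zero_of_hasSubgaussianMGF_zero] with a ha _ using ha
    · exact Filter.Eventually.of_forall fun a ha => absurd (by exact_mod_cast ha) h
  have hzρ : ∀ᵐ a ∂ρ, (σ : ℝ) = 0 → a = 0 := by
    by_cases h : σ = 0
    · have hs := hρ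
      rw [h, zero_pow two_ne_zero] at hs
      filter_upwards [hs.ae_eq_zero_of_hasSubgaussianMGF_zero] with a ha _ using ha
    · exact Filter.Eventually.of_forall fun a ha => absurd (by exact_mod_cast ha) h
  have hzα' : ∀ᵐ z ∂(jointLaw m ν ρ J), ∀ j : J, (σα : ℝ) = 0 → z.1 j = 0 :=
    ae_all_iff.2 fun j => (measurePreserving_entry j.2).quasiMeasurePreserving.ae hzα
  have hzρ' : ∀ᵐ z ∂(jointLaw m ν ρ J), ∀ l : Fin m, (σ : ℝ) = 0 → z.2 l = 0 :=
    ae_all_iff.2 fun l => (measurePreserving_noise J l).quasiMeasurePreserving.ae hzρ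
  -- When a sub-Gaussian parameter is 0 the quotient x²/(4c²) is 0 by convention; the identity
  -- survives because the variable then vanishes almost surely.
  have scale : ∀ {c x b : ℝ}, (c = 0 → x = 0) →
      b * c ^ 2 / K * (x ^ 2 / (4 * c ^ 2)) = b * x ^ 2 / (4 * K) := by
    intro c x b hx
    by_cases hc : c = 0
    · rw [hx hc, hc]
      simp
    · field_simp
  have hae : (fun z => Real.exp (∑ q, w q * X q z)) =ᵐ[jointLaw m ν ρ J]
      fun z => Real.exp (lipBound k lam z / (4 * K)) := by
    filter_upwards [ae_support_eq hν J, hzα', hzρ'] with z hz ha he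
    congr 1
    rw [Fintype.sum_option, Fintype.sum_sum_type]
    simp only [w, X, Option.elim, Sum.elim_inl, Sum.elim_inr]
    rw [Finset.sum_congr rfl fun j _ => scale (ha j), Finset.sum_congr rfl fun l _ => scale (he l)]
    have hs : ∑ j : J, 24 * z.1 j ^ 2 / (4 * K) = 24 * (∑ j, z.1 j ^ 2) / (4 * K) := by
      rw [Finset.mul_sum, Finset.sum_div,
        Finset.sum_coe_sort J (fun j => 24 * z.1 j ^ 2 / (4 * K))]
      refine Finset.sum_subset (Finset.subset_univ J) fun j _ hj => ?_
      have : z.1 j = 0 := by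
        by_contra h
        have : j ∈ Function.support z.1 := h
        rw [hz] at this
        exact hj this
      simp [this]
    rw [hs, ← Finset.sum_div, ← Finset.mul_sum, lipBound]
    field_simp
    ring
  exact ⟨hcomb.1.congr hae, (integral_congr_ae hae).symm.trans_le hcomb.2⟩

lemma exp_lipBound_sampleLaw (hS : IsSupportScheme k S) (hν : IsCoefficientLaw αmin σα ν)
    (hρ : HasSubgaussianMGF id (σ ^ 2) ρ) {K : ℝ}
    (hK : K = 24 * (k * σα ^ 2) + 16 * (m * σ ^ 2) + 18 * lam ^ 2 * k) (hK0 : 0 < K) :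
    Integrable (fun z => Real.exp (lipBound k lam z / (4 * K))) (sampleLaw m S ν ρ) ∧
      ∫ z, Real.exp (lipBound k lam z / (4 * K)) ∂(sampleLaw m S ν ρ) ≤ √2 := by
  have h := fun J (hJ : S J ≠ 0) =>
    exp_lipBound_jointLaw (m := m) (lam := lam) hν hρ (hS.card_eq J hJ) hK hK0
  refine ⟨integrable_sampleLaw fun J hJ => (h J hJ).1, ?_⟩
  rw [integral_sampleLaw fun J hJ => (h J hJ).1]
  refine (Finset.sum_le_sum (g := fun J => (S J).toReal * √2) fun J _ => ?_).trans_eq ?_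
  · by_cases h0 : S J = 0
    · simp [h0]
    · exact mul_le_mul_of_nonneg_left (h J h0).2 ENNReal.toReal_nonneg
  · rw [← Finset.sum_mul, sum_toReal_eq_one, one_mul]

lemma ae_card_support (hS : IsSupportScheme k S) (hν : IsCoefficientLaw αmin σα ν) :
    ∀ᵐ z ∂(sampleLaw m S ν ρ), ∃ J : Finset (Fin p), Function.support z.1 = J ∧ J.card = k :=
  ae_sampleLaw fun J hJ => by
    filter_upwards [ae_support_eq hν J] with z hz
    exact ⟨J, hz, hS.card_eq J hJ⟩

/-- The expected increment along a curve is bounded below. -/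
lemma Admissible.le_integral_loss_sub (h : Admissible k D₀ t) (hS : IsSupportScheme k S)
    (hν : IsCoefficientLaw αmin σα ν) (hρ : HasSubgaussianMGF id (σ ^ 2) ρ)
    (hW : W ∈ tangentDirections D₀) (hv : v ∈ unitSphere p) (hlam : 0 ≤ lam) :
    Integrable (fun z => loss lam D₀ (curve D₀ W v t) z - loss lam D₀ D₀ z)
      (sampleLaw m S ν ρ) ∧
    (1 - constK k D₀ t ^ 2) * ((∫ a, a ^ 2 ∂ν) / 2) * ((k : ℝ) / p) * t ^ 2
    - constQ k D₀ t ^ 2 * t * ((k : ℝ) / p) * spectralNorm D₀ * (k * coherenceAt D₀ t) * lam *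
        (4 * constQ k D₀ t ^ 2 * lam + 3 * ∫ a, |a| ∂ν) ≤
      ∫ z, (loss lam D₀ (curve D₀ W v t) z - loss lam D₀ D₀ z) ∂(sampleLaw m S ν ρ) := by
  have hJ : ∀ J, S J ≠ 0 → _ := fun J hJ => hν.integral_loss_sub (D₀ := D₀)
    (D := curve D₀ W v t) hρ lam
    ((h.near_base (hS.card_eq J hJ)).wellConditioned h.small).isUnit_det
    ((h.near_curve hW hv (hS.card_eq J hJ)).wellConditioned h.small).isUnit_det
  refine ⟨integrable_sampleLaw fun J h0 => (hJ J h0).1, ?_⟩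
  rw [integral_sampleLaw fun J h0 => (hJ J h0).1]
  refine (h.le_sum_condIncrement hS hW hv hlam (integral_nonneg fun a => abs_nonneg a)
    (integral_nonneg fun a => sq_nonneg a)).trans_eq ?_
  refine Finset.sum_congr rfl fun J _ => ?_
  by_cases h0 : S J = 0
  · simp [h0]
  · rw [(hJ J h0).2]

end Increment

/-! ### The uniform lower bound -/

section Main

variable {m p n k : ℕ} {D₀ : Matrix (Fin m) (Fin p) ℝ} {t lam : ℝ}

lemma deltaPhi_eq (lam : ℝ) (D₀ : Matrix (Fin m) (Fin p) ℝ) (α : Fin n → Fin p → ℝ)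
    (ε : Fin n → Fin m → ℝ) (W : Matrix (Fin m) (Fin p) ℝ) (v : Fin p → ℝ) (t : ℝ) :
    deltaPhi lam D₀ α ε W v t =
      1 / (n : ℝ) * ∑ i, (loss lam D₀ (curve D₀ W v t) (α i, ε i) - loss lam D₀ D₀ (α i, ε i)) := by
  rw [Finset.sum_sub_distrib, mul_sub]
  rfl

lemma curve_zero (D₀ W : Matrix (Fin m) (Fin p) ℝ) (v : Fin p → ℝ) : curve D₀ W v 0 = D₀ := by
  ext l j
  simp [curve_apply]

lemma constB_nonneg (m k : ℕ) (σα σ : ℝ≥0) (hlam : 0 ≤ lam) (ht : 0 ≤ t) :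
    0 ≤ constB m k σα σ lam t := by
  unfold constB
  positivity

/-- Every main term has a factor t or k, so only the nonpositive deviation term can remain. -/
lemma lowerBound_nonpos_of_eq_zero (n : ℕ) (D₀ : Matrix (Fin m) (Fin p) ℝ) (ν : Measure ℝ)
    (σα σ : ℝ≥0) (hlam : 0 ≤ lam) (ht : 0 ≤ t) (h : t = 0 ∨ k = 0) :
    lowerBound k n D₀ ν σα σ lam t ≤ 0 := by
  have hB := mul_nonneg (constB_nonneg m k σα σ hlam ht) (Real.sqrt_nonneg (m * p * (Real.log n / n)))
  rcases h with rfl | rfl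
  · simp only [lowerBound]
    simp only [ne_eq, OfNat.ofNat_ne_zero, not_false_eq_true, zero_pow, mul_zero, zero_mul]
    linarith
  · simp only [lowerBound]
    simp only [Nat.cast_zero, zero_div, mul_zero, zero_mul] at hB ⊢
    linarith

/-- Without coefficients the surrogate does not depend on the dictionary. -/
lemma loss_eq_of_support_eq_empty (D D' : Matrix (Fin m) (Fin p) ℝ)
    {z : (Fin p → ℝ) × (Fin m → ℝ)} (hz : Function.support z.1 = ∅) :
    loss lam D₀ D z = loss lam D₀ D' z := by
  have hz' : Function.support z.1 = (∅ : Finset (Fin p)) := by simpa using hz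
  rw [loss_eq_closedForm (J := ∅) (by simp) hz', loss_eq_closedForm (J := ∅) (by simp) hz',
    closedForm, closedForm]
  simp [dotProduct]

/-- The size of the net and the deviation probabilities balance. -/
lemma net_probability_le {N n : ℕ} (hN : 1 ≤ N) (hn : 2 ≤ n) (hnN : (N : ℝ) ≤ n / Real.log n)
    {θ c : ℝ} (hθ0 : 0 < θ) (hθ1 : θ ≤ 1) (hθ : n * θ ^ 2 = N * Real.log n)
    (hc : c ≤ (1 + 2 / θ) ^ N) :
    c * Real.exp (-(9 / 2 * (n * θ ^ 2))) + Real.exp (-(2 * n)) ≤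
      ((N : ℝ) * n / 9) ^ (-(N : ℝ) / 2) := by
  have hn2 : (2 : ℝ) ≤ n := by exact_mod_cast hn
  have hN1 : (1 : ℝ) ≤ N := by exact_mod_cast hN
  have hlog : 0.69 < Real.log n := by
    refine lt_of_lt_of_le ?_ (Real.log_le_log (by norm_num) hn2)
    linarith [Real.log_two_gt_d9]
  have hlog0 : 0 < Real.log n := by linarith
  set L := (N : ℝ) * Real.log n with hL
  have hLn : L ≤ n := by
    rw [le_div_iff₀ hlog0] at hnN
    exact hnN
  have hexp : Real.exp (Real.log n) = n := Real.exp_log (by linarith)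
  -- This is 3/θ ≤ n^(5/2): squared, it asks for 9 ≤ n⁴L, and n⁴ ≥ 16 with L ≥ 0.69 is enough.
  have h1 : 1 + 2 / θ ≤ Real.exp (5 / 2 * Real.log n) := by
    have h2 : 1 + 2 / θ ≤ 3 / θ := by
      rw [← sub_nonneg]
      have : 3 / θ - (1 + 2 / θ) = (1 - θ) / θ := by
        field_simp
        ring
      rw [this]
      exact div_nonneg (by linarith) hθ0.le
    refine h2.trans (le_of_sq_le_sq ?_ (Real.exp_pos _).le)
    have h3 : Real.exp (5 / 2 * Real.log n) ^ 2 = (n : ℝ) ^ 5 := by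
      rw [← Real.exp_nat_mul, ← hexp, ← Real.exp_nat_mul, Real.log_exp]
      congr 1
      push_cast
      ring
    rw [h3, div_pow, div_le_iff₀ (by positivity)]
    have h4 : (n : ℝ) ^ 5 * θ ^ 2 = n ^ 4 * (n * θ ^ 2) := by ring
    rw [h4, hθ]
    have h5 : (0.69 : ℝ) ≤ L := by nlinarith
    have h6 : (16 : ℝ) ≤ (n : ℝ) ^ 4 := by
      calc (16 : ℝ) = 2 ^ 4 := by norm_num
        _ ≤ (n : ℝ) ^ 4 := pow_le_pow_left₀ (by norm_num) hn2 4
    nlinarith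
  have h2 : c * Real.exp (-(9 / 2 * (n * θ ^ 2))) ≤ Real.exp (-(2 * L)) := by
    -- The net costs exp(5L/2) against the tail exp(-9L/2), leaving exp(-2L).
    have h3 : c ≤ Real.exp (5 / 2 * L) := by
      refine hc.trans ((pow_le_pow_left₀ (by positivity) h1 N).trans_eq ?_)
      rw [← Real.exp_nat_mul]
      congr 1
      ring
    refine (mul_le_mul_of_nonneg_right h3 (Real.exp_pos _).le).trans_eq ?_
    rw [← Real.exp_add, hθ]
    congr 1
    ring
  have h3 : Real.exp (-(2 * n)) ≤ Real.exp (-(2 * L)) := Real.exp_le_exp.2 (by linarith)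
  have h4 : 2 * Real.exp (-(2 * L)) ≤ Real.exp (-L) := by
    have e : Real.exp (-L) = Real.exp L * Real.exp (-(2 * L)) := by
      rw [← Real.exp_add]
      congr 1
      ring
    rw [e]
    refine mul_le_mul_of_nonneg_right ?_ (Real.exp_pos _).le
    refine hn2.trans ?_
    rw [← hexp]
    exact Real.exp_le_exp.2 (by nlinarith)
  have h5 : Real.exp (-L) ≤ ((N : ℝ) * n / 9) ^ (-(N : ℝ) / 2) := by
    have hpos : (0 : ℝ) < (N : ℝ) * n / 9 := by positivity
    rw [Real.rpow_def_of_pos hpos]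
    refine Real.exp_le_exp.2 ?_
    -- From 0.69 N ≤ n follows Nn/9 ≤ n², so exp(-L) = (n²)^(-N/2) is at most the stated power.
    have h6 : Real.log ((N : ℝ) * n / 9) ≤ 2 * Real.log n := by
      have : 2 * Real.log n = Real.log ((n : ℝ) ^ 2) := by
        rw [Real.log_pow]
        norm_num
      rw [this]
      refine Real.log_le_log hpos ?_
      have : (N : ℝ) * 0.69 ≤ n := by nlinarith
      nlinarith
    have := mul_le_mul_of_nonneg_right h6 (by positivity : (0 : ℝ) ≤ (N : ℝ) / 2)
    rw [hL]
    linarith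
  linarith

variable {ν ρ : Measure ℝ} [IsProbabilityMeasure ν] [IsProbabilityMeasure ρ]
  {αmin : ℝ} {σα σ : ℝ≥0} {S : PMF (Finset (Fin p))}
  {Ω : Type*} [MeasurableSpace Ω] {P : Measure Ω}
  {α : Fin n → Ω → Fin p → ℝ} {ε : Fin n → Ω → Fin m → ℝ}

lemma ae_forall_card_support (hS : IsSupportScheme k S) (hν : IsCoefficientLaw αmin σα ν)
    (hlaw : ∀ i, HasLaw (fun ω => (α i ω, ε i ω)) (sampleLaw m S ν ρ) P) :
    ∀ᵐ ω ∂P, ∀ i, ∃ J : Finset (Fin p), Function.support (α i ω) = J ∧ J.card = k := by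
  rw [ae_all_iff]
  intro i
  have h : ∀ᵐ z ∂(P.map fun ω => (α i ω, ε i ω)), ∃ J : Finset (Fin p),
      Function.support z.1 = J ∧ J.card = k := (hlaw i).map_eq.symm ▸ ae_card_support hS hν
  exact ae_of_ae_map (hlaw i).aemeasurable h

/-- Parameter 0 would force the coefficient to vanish almost surely. This ensures K > 0 even without
noise and with λ = 0. -/
lemma IsCoefficientLaw.param_ne_zero (hν : IsCoefficientLaw αmin σα ν) : σα ≠ 0 := by
  intro h
  have hs := hν.subgaussian
  rw [h, zero_pow two_ne_zero] at hs
  have : ∀ᵐ a ∂ν, False := by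
    filter_upwards [hs.ae_eq_zero_of_hasSubgaussianMGF_zero, hν.ae_ne_zero] with a h1 h2
      using h2 h1
  obtain ⟨_, ha⟩ := this.exists
  exact ha

/-- The nondegenerate case of the uniform lower bound. -/
theorem Admissible.measure_not_lowerBound_le [IsProbabilityMeasure P] (h : Admissible k D₀ t) (ht : 0 < t)
    (hS : IsSupportScheme k S) (hν : IsCoefficientLaw αmin σα ν)
    (hρ : HasSubgaussianMGF id (σ ^ 2) ρ)
    (hindep : iIndepFun (fun i ω => (α i ω, ε i ω)) P)
    (hlaw : ∀ i, HasLaw (fun ω => (α i ω, ε i ω)) (sampleLaw m S ν ρ) P)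
    (hlam : 0 ≤ lam) (hn : 2 ≤ n) (hnmp : (m : ℝ) * p ≤ n / Real.log n) :
    P {ω | ¬ ∀ W ∈ tangentDirections D₀, ∀ v ∈ unitSphere p,
        lowerBound k n D₀ ν σα σ lam t ≤
          deltaPhi lam D₀ (fun i => α i ω) (fun i => ε i ω) W v t} ≤
      ENNReal.ofReal (((m : ℝ) * p * n / 9) ^ (-((m : ℝ) * p) / 2)) := by
  have hp : 0 < p := h.k_pos.trans_le hS.le
  have hm : 0 < m := by
    rcases Nat.eq_zero_or_pos m with rfl | hm
    · have := h.unit ⟨0, hp⟩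
      simp at this
    · exact hm
  have hn2 : (2 : ℝ) ≤ n := by exact_mod_cast hn
  have hn0 : (0 : ℝ) < n := by linarith
  have hlog : 0 < Real.log n := Real.log_pos (by linarith)
  have hmp : (0 : ℝ) < (m : ℝ) * p := by positivity
  set θ := √(m * p * (Real.log n / n)) with hθ
  have hθ2 : n * θ ^ 2 = (m : ℝ) * p * Real.log n := by
    rw [hθ, Real.sq_sqrt (by positivity)]
    field_simp
  have hθ0 : 0 < θ := Real.sqrt_pos.2 (by positivity)
  have hθ1 : θ ≤ 1 := by
    rw [hθ, Real.sqrt_le_left zero_le_one, one_pow, ← mul_div_assoc, div_le_one hn0]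
    rwa [le_div_iff₀ hlog] at hnmp
  set K : ℝ := 24 * (k * σα ^ 2) + 16 * (m * σ ^ 2) + 18 * lam ^ 2 * k with hK
  have hσα : (0 : ℝ) < σα := by
    have := hν.param_ne_zero
    positivity
  have hk : (0 : ℝ) < k := by exact_mod_cast h.k_pos
  have hK0 : 0 < K := by positivity
  obtain ⟨hexp, hexp2⟩ := exp_lipBound_sampleLaw (m := m) (lam := lam) hS hν hρ hK hK0
  set V : (Fin p → ℝ) × (Fin m → ℝ) → ℝ := fun z => t * lipBound k lam z with hV
  set τ : ℝ := 4 * (t * K) with hτ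
  have hτ0 : 0 < τ := by positivity
  have hVτ : ∀ z, V z / τ = lipBound k lam z / (4 * K) := fun z => by
    simp only [hV, hτ]
    field_simp
  simp only [← hVτ] at hexp hexp2
  set T : Set (Matrix (Fin m) (Fin p) ℝ) :=
    {M | ∃ W ∈ tangentDirections D₀, ∃ v ∈ unitSphere p, M = curve D₀ W v t} with hT
  -- Radius t and mesh θt: the ratio is 1/θ, so the cardinality of the net does not depend on t.
  obtain ⟨F, hFT, hFcard, hFcov⟩ := exists_matrix_net T D₀ ht.le (mul_pos hθ0 ht) (by
    rintro _ ⟨W, hW, v, hv, rfl⟩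
    exact frob_curve_sub_le h.unit hW hv ht.le)
  have hwc0 : ∀ J : Finset (Fin p), J.card = k → WellConditioned (cols D₀ J) := fun J hJ =>
    (h.near_base hJ).wellConditioned h.small
  have hwc : ∀ M ∈ T, ∀ J : Finset (Fin p), J.card = k → WellConditioned (cols M J) := by
    rintro _ ⟨W, hW, v, hv, rfl⟩ J hJ
    exact (h.near_curve hW hv hJ).wellConditioned h.small
  have hfrob : ∀ M ∈ T, frob (M - D₀) ≤ t := by
    rintro _ ⟨W, hW, v, hv, rfl⟩
    exact frob_curve_sub_le h.unit hW hv ht.le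
  have : IsProbabilityMeasure (sampleLaw m S ν ρ) := isProbabilityMeasure_sampleLaw S
  have hdev := uniform_deviation hindep hlaw hτ0 F
    (f := fun d z => loss lam D₀ d z - loss lam D₀ D₀ z) (V := V)
    (by
      intro d hd
      obtain ⟨W, hW, v, hv, rfl⟩ := hFT hd
      exact (h.le_integral_loss_sub hS hν hρ hW hv hlam).1.aestronglyMeasurable.aemeasurable)
    (by
      intro d hd
      filter_upwards [ae_card_support hS hν] with z hz
      obtain ⟨J, hz, hJ⟩ := hz
      refine (abs_loss_sub_le hlam hwc0 (hwc d (hFT hd)) hwc0 hz hJ).trans ?_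
      exact mul_le_mul_of_nonneg_right (hfrob d (hFT hd)) (lipBound_nonneg k lam z))
    ((measurable_lipBound k lam).const_mul t) hexp hexp2 hθ0.le hθ1
  refine (measure_mono_ae ?_).trans (hdev.trans (ENNReal.ofReal_le_ofReal ?_))
  · filter_upwards [ae_forall_card_support hS hν hlaw] with ω hω hbad hgood
    refine hbad fun W hW v hv => ?_
    obtain ⟨hgood1, hgood2⟩ := hgood
    have hcT : curve D₀ W v t ∈ T := ⟨W, hW, v, hv, rfl⟩
    obtain ⟨d, hdF, hd⟩ := hFcov _ hcT
    have h1 := hgood1 d hdF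
    -- Passing to the nearest net point costs θt times the sum of Lipschitz bounds, that is θ ∑ V,
    -- which is controlled on the good event.
    have h2 : ∑ i, (loss lam D₀ d (α i ω, ε i ω) - loss lam D₀ D₀ (α i ω, ε i ω)) -
        θ * ∑ i, V (α i ω, ε i ω) ≤
        ∑ i, (loss lam D₀ (curve D₀ W v t) (α i ω, ε i ω) -
          loss lam D₀ D₀ (α i ω, ε i ω)) := by
      rw [Finset.mul_sum, ← Finset.sum_sub_distrib]
      refine Finset.sum_le_sum fun i _ => ?_
      obtain ⟨J, hz, hJ⟩ := hω i
      have h3 := abs_loss_sub_le (z := (α i ω, ε i ω)) hlam hwc0 (hwc _ hcT) (hwc d (hFT hdF)) hz hJ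
      have h4 := mul_le_mul_of_nonneg_right hd (lipBound_nonneg k lam (α i ω, ε i ω))
      have h5 := (abs_le.1 (h3.trans h4)).1
      simp only [hV]
      linarith
    have h3 := mul_le_mul_of_nonneg_left hgood2 hθ0.le
    obtain ⟨W', hW', v', hv', rfl⟩ := hFT hdF
    have h4 := (h.le_integral_loss_sub hS hν hρ hW' hv' hlam).2
    -- Deviation 15τθ plus discretization 5/2 · τθ. Here 35/2 · τ = 70tK has coefficients 1680,
    -- 1120t and 1260; t ≤ 1/6 brings the noise part below 2 · 3045, and the term λkσ_α is spare.
    have h5 : 35 / 2 * τ ≤ constB m k σα σ lam t := by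
      rw [constB, hτ, hK]
      have a1 : 0 ≤ t * (k * (σα : ℝ) ^ 2) := by positivity
      have a2 : 0 ≤ (m : ℝ) * (σ : ℝ) ^ 2 := by positivity
      have a3 : 0 ≤ t * (lam ^ 2 * k) := by positivity
      have a4 : 0 ≤ lam * k * (σα : ℝ) := by positivity
      have a5 : t * ((m : ℝ) * (σ : ℝ) ^ 2) ≤ 1 / 6 * ((m : ℝ) * (σ : ℝ) ^ 2) :=
        mul_le_mul_of_nonneg_right h.t_le a2
      linarith
    have h6 := mul_le_mul_of_nonneg_right h5 hθ0.le
    rw [deltaPhi_eq, lowerBound, one_div_mul_eq_div, le_div_iff₀ hn0, ← hθ]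
    set I := ∫ z, (loss lam D₀ (curve D₀ W' v' t) z - loss lam D₀ D₀ z) ∂(sampleLaw m S ν ρ)
    have h7 : n * (I - 15 * τ * θ) - θ * (n * (5 / 2 * τ)) = n * (I - 35 / 2 * τ * θ) := by ring
    refine le_trans ?_ ((sub_le_sub h1 h3).trans h2)
    rw [h7, mul_comm]
    exact mul_le_mul_of_nonneg_left (by linarith) hn0.le
  · have hc : (F.card : ℝ) ≤ (1 + 2 / θ) ^ (m * p) := by
      refine hFcard.trans_eq ?_
      rw [Fintype.card_fin, Fintype.card_fin]
      congr 2
      field_simp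
    have := net_probability_le (N := m * p) (Nat.mul_pos hm hp) hn
      (by push_cast; exact hnmp) hθ0 hθ1 (by push_cast; exact hθ2) hc
    push_cast at this
    exact this

end Main

end SparseCoding

theorem mainTheorem7 {m p n k : ℕ}
    (D₀ : Matrix (Fin m) (Fin p) ℝ) (hD₀ : D₀ ∈ SparseCoding.unitDictionaries m p)
    (S : PMF (Finset (Fin p))) (hS : SparseCoding.IsSupportScheme k S)
    (αmin : ℝ) (σα σ : ℝ≥0)
    (ν : Measure ℝ) [IsProbabilityMeasure ν] (hν : SparseCoding.IsCoefficientLaw αmin σα ν)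
    (ρ : Measure ℝ) [IsProbabilityMeasure ρ] (hρ : HasSubgaussianMGF id (σ ^ 2) ρ)
    {Ω : Type*} [MeasurableSpace Ω] (P : Measure Ω) [IsProbabilityMeasure P]
    (α : Fin n → Ω → Fin p → ℝ) (ε : Fin n → Ω → Fin m → ℝ)
    (hindep : iIndepFun (fun i ω => (α i ω, ε i ω)) P)
    (hlaw : ∀ i, HasLaw (fun ω => (α i ω, ε i ω)) (SparseCoding.sampleLaw m S ν ρ) P)
    (lam t : ℝ) (hlam : 0 ≤ lam) (ht : 0 ≤ t)
    (hkμ : k * SparseCoding.coherenceAt D₀ t ≤ 1 / 2)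
    (hn : 2 ≤ n) (hnmp : (n : ℝ) / Real.log n ≥ m * p) :
    P {ω | ¬ (SparseCoding.lowerBound k n D₀ ν σα σ lam t : EReal) ≤
        ⨅ W ∈ SparseCoding.tangentDirections D₀, ⨅ v ∈ SparseCoding.unitSphere p,
          (SparseCoding.deltaPhi lam D₀ (fun i => α i ω) (fun i => ε i ω) W v t : EReal)}
      ≤ ENNReal.ofReal (((m : ℝ) * p * n / 9) ^ (-((m : ℝ) * p) / 2)) := by
  have hsub : {ω | ¬ (SparseCoding.lowerBound k n D₀ ν σα σ lam t : EReal) ≤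
        ⨅ W ∈ SparseCoding.tangentDirections D₀, ⨅ v ∈ SparseCoding.unitSphere p,
          (SparseCoding.deltaPhi lam D₀ (fun i => α i ω) (fun i => ε i ω) W v t : EReal)} ⊆
      {ω | ¬ ∀ W ∈ SparseCoding.tangentDirections D₀, ∀ v ∈ SparseCoding.unitSphere p,
        SparseCoding.lowerBound k n D₀ ν σα σ lam t ≤
          SparseCoding.deltaPhi lam D₀ (fun i => α i ω) (fun i => ε i ω) W v t} := by
    -- In the extended reals the infimum over an empty set is ⊤, so a pointwise bound suffices
    -- without nonemptiness or boundedness.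
    intro ω hω hall
    refine hω (le_iInf₂ fun W hW => le_iInf₂ fun v hv => ?_)
    exact EReal.coe_le_coe_iff.2 (hall W hW v hv)
  -- In these degenerate cases the increment vanishes almost surely and the lower bound is
  -- nonpositive; the net argument needs t > 0 and k > 0.
  by_cases h0 : t = 0 ∨ k = 0
  · have hlb := SparseCoding.lowerBound_nonpos_of_eq_zero (m := m) n D₀ ν σα σ hlam ht h0
    refine le_trans (le_of_eq ?_) zero_le
    refine measure_mono_null hsub (ae_iff.1 ?_)
    filter_upwards [SparseCoding.ae_forall_card_support hS hν hlaw] with ω hω W _ v _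
    refine hlb.trans_eq ?_
    rw [SparseCoding.deltaPhi_eq, Finset.sum_eq_zero fun i _ => ?_, mul_zero]
    rcases h0 with rfl | rfl
    · rw [SparseCoding.curve_zero, sub_self]
    · obtain ⟨J, hJ, hcard⟩ := hω i
      rw [Finset.card_eq_zero.1 hcard, Finset.coe_empty] at hJ
      rw [SparseCoding.loss_eq_of_support_eq_empty _ D₀ hJ, sub_self]
  · push Not at h0
    have h : SparseCoding.Admissible k D₀ t := ⟨hD₀, Nat.pos_of_ne_zero h0.2, ht, hkμ⟩
    exact (measure_mono hsub).trans (h.measure_not_lowerBound_le (lt_of_le_of_ne ht h0.1.symm)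
      hS hν hρ hindep hlaw hlam hn hnmp)
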